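/- Let $n\ge 1$ and let $a^{(1)},\dots,a^{(N)}\in\mathbb Z^n$ generate $\mathbb Z^n$ as an abelian group; put $A=\{a^{(1)},\dots,a^{(N)}\}$. Let $\mathcal D=\mathbb C\langle\lambda_1,\dots,\lambda_N,\partial_1,\dots,\partial_N\rangle$ be the ring of differential operators with coefficients in $\mathbb C[\lambda]=\mathbb C[\lambda_1,\dots,\lambda_N]$. For $\alpha\in\mathbb C^n$ let $$\mathcal M_\alpha=\mathcal D\Big/\Big(\sum_{l\in L}\mathcal D\,\Box_l+\sum_{i=1}^n\mathcal D\,Z_{i,\alpha}\Big),\qquad \Box_l=\prod_{l_j>0}\partial_j^{l_j}-\prod_{l_j<0}\partial_j^{-l_j},\qquad Z_{i,\alpha}=\sum_{j=1}^N a^{(j)}_i\lambda_j\partial_j-\alpha_i,$$ where $L=\{l\in\mathbb Z^N\mid\sum_j l_ja^{(j)}=0\}$. Let $\ell_1,\dots,\ell_s$ be the linear forms with relatively prime integer coefficients that define the codimension-one faces of the real cone $C(A)\subseteq\mathbb R^n$ generated by $A$ and are nonnegative on $C(A)$. Call $\alpha$ nonresonant for $A$ if $\ell_i(\alpha)\notin\mathbb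 Z$ for all $i$. Suppose that $f=\sum_{j=1}^N\lambda_jx^{a^{(j)}}$ has the form $f=x_n\,g$ with $g\in\mathbb C[\lambda][x_1^{\pm1},\dots,x_{n-1}^{\pm1}]$. Let $U$ be the open subset $g\ne 0$ of the $(n-1)$-torus over $\mathbb C[\lambda]$ with coordinates $x_1,\dots,x_{n-1}$. For $\beta\in\mathbb C^n$ let $$\widetilde\nabla_\beta(\omega)=d\omega+\sum_{i=1}^{n-1}\beta_i\frac{dx_i}{x_i}\wedge\omega-\beta_n\frac{dg}{g}\wedge\omega$$ on the relative differential forms $\Omega^\bullet_{U/\mathbb C[\lambda]}$. On the cohomology of $(\Omega^\bullet_{U/\mathbb C[\lambda]},\widetilde\nabla_\beta)$ the ring $\mathcal D$ acts so that $\lambda_j$ acts by multiplication and $\partial_j$ acts as $\partial_j-\beta_n\,g^{-1}\,\partial g/\partial\lambda_j$, where $\partial_j$ is applied to the coefficients of forms with respect to the products of the $dx_i/x_i$. Suppose that $\alpha\in\mathbb C^n$ is nonresonant for $A$. Then: 1. There is an isomorphism of $\mathcal D$-modules $\mathcal M_\alpha\cong H^{n-1}(\Omega^\bullet_{U/\mathbb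 C[\lambda]},\widetilde\nabla_{-\alpha})$. 2. If in addition $\alpha\in\mathbb Q^n$, then $\mathcal M_\alpha$ comes from geometry: there are a smooth scheme $X$ over $\mathbb C[\lambda]$ (which can be taken affine), a finite group $G$ acting on $X/\mathbb C[\lambda]$, an irreducible complex representation $\chi$ of $G$ and an integer $i$ such that $\mathcal M_\alpha$ is isomorphic as a $\mathcal D$-module to $H^i_{\rm DR}(X/\mathbb C[\lambda])^\chi$, the sum of all $G$-submodules of $H^i_{\rm DR}(X/\mathbb C[\lambda])$ that are isomorphic to $\chi$, with the Gauss–Manin connection. More explicitly, let $D\ge 1$ be any integer with $D\alpha\in\mathbb Z^n$. Then the hypersurface $X:\ x_n^D\,g(x_1^D,\dots,x_{n-1}^D)=1$ in the $n$-torus over $\mathbb C[\lambda]$ is smooth over $\mathbb C[\lambda]$, and $$\mathcal M_\alpha\cong H^{n-1}_{\rm DR}(X/\mathbb C[\lambda])^\chi$$ as $\mathcal D$-modules, where $\zeta\in(\boldsymbol\mu_D)^n$ acts on the functions on $X$ by $x_i\mapsto\zeta_ix_i$ and $\chi(\zeta)=\prod_{i=1}^n\zeta_i^{-D\alpha_i}$.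 -/

import Mathlib

open scoped KaehlerDifferential

namespace AHyp

/-! ### The algebra of relative differential forms -/

/-- The exterior algebra of the module of relative differentials `Ω¹_{B/A}`. Its piece of
degree `k` is `⋀[B]^k Ω[B⁄A]`. -/
abbrev Forms (A B : Type) [CommRing A] [CommRing B] [Algebra A B] : Type :=
  ExteriorAlgebra B Ω[B⁄A]

namespace Forms

section Basic

variable {A B S : Type} [CommRing A] [CommRing B] [Algebra A B] [Ring S]

/-- A function as a form of degree 0. -/
noncomputable abbrev fn (b : B) : Forms A B := algebraMap B (Forms A B) b

variable (A) in
/-- The 1-form `db`. -/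
noncomputable abbrev dd (b : B) : Forms A B := ExteriorAlgebra.ι B (KaehlerDifferential.D A B b)

theorem induction {P : Forms A B → Prop} (hfn : ∀ b, P (fn b)) (hd : ∀ b, P (dd A b))
    (hmul : ∀ x y, P x → P y → P (x * y)) (hadd : ∀ x y, P x → P y → P (x + y))
    (x : Forms A B) : P x := by
  refine CliffordAlgebra.induction hfn (fun ω => ?_) hmul hadd x
  have h : ω ∈ Submodule.span B (Set.range (KaehlerDifferential.D A B)) := by
    rw [KaehlerDifferential.span_range_derivation]; trivial
  induction h using Submodule.span_induction with
  | mem y hy => obtain ⟨b, rfl⟩ := hy; exact hd b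
  | zero => simpa using hfn 0
  | add y z _ _ h1 h2 => simpa using hadd _ _ h1 h2
  | smul b y _ h1 =>
    have := hmul _ _ (hfn b) h1
    rwa [← Algebra.smul_def, ← map_smul] at this

/-- The universal property: a ring homomorphism `φ : B → S` with central image, together with
`δ : B → S` which is an `A`-derivation along `φ` with `δ(b)² = 0`, extends to the algebra of forms
by `b ↦ φ b`, `db ↦ δ b`. -/
noncomputable def lift (φ : B →+* S) (hφ : ∀ b s, φ b * s = s * φ b) (δ : B →+ S)
    (hA : ∀ a, δ (algebraMap A B a) = 0) (hδ : ∀ b c, δ (b * c) = φ b * δ c + φ c * δ b)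
    (hsq : ∀ b, δ b * δ b = 0) : Forms A B →+* S :=
  letI : Algebra B S := φ.toAlgebra' hφ
  letI : Module A S := Module.compHom S (algebraMap A B)
  haveI : IsScalarTower A B S := ⟨fun a b s => by
    rw [Algebra.smul_def a b, mul_smul]; rfl⟩
  let D : Derivation A B S := Derivation.mk'
    { toFun := δ
      map_add' := map_add δ
      map_smul' := fun a b => by
        rw [Algebra.smul_def, hδ, hA, mul_zero, add_zero]; rfl }
    (fun b c => hδ b c)
  have hanti : ∀ b c, δ b * δ c + δ c * δ b = 0 := fun b c => by
    have h := hsq (b + c)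
    rw [map_add, add_mul, mul_add, mul_add, hsq, hsq, zero_add, add_zero] at h
    exact h
  have hsm : ∀ (b : B) (s t : S), (b • s) * t = b • (s * t) := fun b s t => smul_mul_assoc b s t
  have hms : ∀ (b : B) (s t : S), s * (b • t) = b • (s * t) := fun b s t => mul_smul_comm b s t
  have hD : ∀ b, D.liftKaehlerDifferential (KaehlerDifferential.D A B b) = δ b :=
    fun b => D.liftKaehlerDifferential_comp_D b
  have htop : ∀ ω : Ω[B⁄A], ω ∈ Submodule.span B (Set.range (KaehlerDifferential.D A B)) :=
    fun ω => by rw [KaehlerDifferential.span_range_derivation]; trivial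
  have h1 : ∀ (ω : Ω[B⁄A]) (c : B),
      D.liftKaehlerDifferential ω * δ c + δ c * D.liftKaehlerDifferential ω = 0 := fun ω c => by
    induction htop ω using Submodule.span_induction with
    | mem y hy => obtain ⟨b, rfl⟩ := hy; rw [hD]; exact hanti b c
    | zero => simp
    | add y z _ _ h1 h2 =>
      rw [map_add, add_mul, mul_add, add_add_add_comm, h1, h2, add_zero]
    | smul b y _ h1 => rw [map_smul, hsm, hms, ← smul_add, h1, smul_zero]
  have h2 : ∀ (ω η : Ω[B⁄A]), D.liftKaehlerDifferential ω * D.liftKaehlerDifferential η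
      + D.liftKaehlerDifferential η * D.liftKaehlerDifferential ω = 0 := fun ω η => by
    induction htop η using Submodule.span_induction with
    | mem y hy => obtain ⟨b, rfl⟩ := hy; rw [hD]; exact h1 ω b
    | zero => simp
    | add y z _ _ h1 h2 =>
      rw [map_add, add_mul, mul_add, add_add_add_comm, h1, h2, add_zero]
    | smul b y _ h1 => rw [map_smul, hsm, hms, ← smul_add, h1, smul_zero]
  have h3 : ∀ (ω : Ω[B⁄A]),
      D.liftKaehlerDifferential ω * D.liftKaehlerDifferential ω = 0 := fun ω => by
    induction htop ω using Submodule.span_induction with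
    | mem y hy => obtain ⟨b, rfl⟩ := hy; rw [hD]; exact hsq b
    | zero => simp
    | add y z _ _ hy hz =>
      rw [map_add, add_mul, mul_add, mul_add, hy, hz, zero_add, add_zero]; exact h2 y z
    | smul b y _ h1 => rw [map_smul, hsm, hms, h1, smul_zero, smul_zero]
  (ExteriorAlgebra.lift B ⟨D.liftKaehlerDifferential, h3⟩).toRingHom

theorem lift_fn (φ : B →+* S) (hφ) (δ : B →+ S) (hA) (hδ) (hsq) (b : B) :
    lift (A := A) φ hφ δ hA hδ hsq (fn b) = φ b := by
  let _ : Algebra B S := φ.toAlgebra' hφ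
  exact AlgHom.commutes (A := Forms A B) (B := S) _ b

theorem lift_dd (φ : B →+* S) (hφ) (δ : B →+ S) (hA) (hδ) (hsq) (b : B) :
    lift (A := A) φ hφ δ hA hδ hsq (dd A b) = δ b := by
  let _ : Algebra B S := φ.toAlgebra' hφ
  let _ : Module A S := Module.compHom S (algebraMap A B)
  have : IsScalarTower A B S := ⟨fun a b s => by rw [Algebra.smul_def a b, mul_smul]; rfl⟩
  refine (ExteriorAlgebra.lift_ι_apply B _ _ _).trans ?_
  exact Derivation.liftKaehlerDifferential_comp_D _ b

theorem fn_comm (b : B) (x : Forms A B) : fn b * x = x * fn b := Algebra.commutes b x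

theorem fn_add (b c : B) : (fn (b + c) : Forms A B) = fn b + fn c := map_add _ b c

theorem fn_mul (b c : B) : (fn (b * c) : Forms A B) = fn b * fn c := map_mul _ b c

theorem dd_mul (b c : B) : dd A (b * c) = fn b * dd A c + fn c * dd A b := by
  simp [dd, Algebra.smul_def]

theorem dd_sq (b : B) : dd A b * dd A b = 0 := ExteriorAlgebra.ι_sq_zero _

theorem dd_anti (b c : B) : dd A b * dd A c + dd A c * dd A b = 0 :=
  ExteriorAlgebra.ι_add_mul_swap _ _

theorem dd_algebraMap (a : A) : dd A (algebraMap A B a) = 0 := by simp [dd]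

/-- `b ↦ db` as an additive map. -/
noncomputable def ddHom (A : Type) {B : Type} [CommRing A] [CommRing B] [Algebra A B] :
    B →+ Forms A B where
  toFun := dd A
  map_zero' := by simp [dd]
  map_add' := by simp [dd]

end Basic
end Forms

namespace Forms

section Derivative

variable {A B : Type} [CommRing A] [CommRing B] [Algebra A B]

/-- The sign involution `ω ↦ (-1)^k ω` on `k`-forms. -/
noncomputable abbrev sgn : Forms A B →ₐ[B] Forms A B := CliffordAlgebra.involute

theorem sgn_dd (b : B) : sgn (dd A b) = -dd A b := CliffordAlgebra.involute_ι _

theorem dd_comm (b : B) (x : Forms A B) : dd A b * x = sgn x * dd A b := by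
  induction x using Forms.induction with
  | hfn c => rw [← fn_comm, AlgHom.commutes]
  | hd c => rw [sgn_dd, neg_mul, eq_neg_iff_add_eq_zero, dd_anti]
  | hmul x y hx hy => rw [map_mul, ← mul_assoc, hx, mul_assoc, hy, mul_assoc]
  | hadd x y hx hy => rw [map_add, mul_add, add_mul, hx, hy]

/-- Auxiliary ring: pairs `(x, y)` of forms with
`(x, y) * (x', y') = (x * x', sgn x * y' + y * x')`. -/
@[ext] structure Skew (A B : Type) [CommRing A] [CommRing B] [Algebra A B] where
  fst : Forms A B
  snd : Forms A B

namespace Skew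

noncomputable instance : Zero (Skew A B) := ⟨⟨0, 0⟩⟩
noncomputable instance : One (Skew A B) := ⟨⟨1, 0⟩⟩
noncomputable instance : Add (Skew A B) := ⟨fun x y => ⟨x.1 + y.1, x.2 + y.2⟩⟩
noncomputable instance : Neg (Skew A B) := ⟨fun x => ⟨-x.1, -x.2⟩⟩
noncomputable instance : Mul (Skew A B) :=
  ⟨fun x y => ⟨x.1 * y.1, sgn x.1 * y.2 + x.2 * y.1⟩⟩

@[simp] theorem zero_fst : (0 : Skew A B).fst = 0 := rfl
@[simp] theorem zero_snd : (0 : Skew A B).snd = 0 := rfl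
@[simp] theorem one_fst : (1 : Skew A B).fst = 1 := rfl
@[simp] theorem one_snd : (1 : Skew A B).snd = 0 := rfl
@[simp] theorem add_fst (x y : Skew A B) : (x + y).fst = x.fst + y.fst := rfl
@[simp] theorem add_snd (x y : Skew A B) : (x + y).snd = x.snd + y.snd := rfl
@[simp] theorem neg_fst (x : Skew A B) : (-x).fst = -x.fst := rfl
@[simp] theorem neg_snd (x : Skew A B) : (-x).snd = -x.snd := rfl
@[simp] theorem mul_fst (x y : Skew A B) : (x * y).fst = x.fst * y.fst := rfl
@[simp] theorem mul_snd (x y : Skew A B) :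
    (x * y).snd = sgn x.fst * y.snd + x.snd * y.fst := rfl

noncomputable instance : Ring (Skew A B) where
  add_assoc x y z := by ext <;> simp [add_assoc]
  zero_add x := by ext <;> simp
  add_zero x := by ext <;> simp
  add_comm x y := by ext <;> simp [add_comm]
  left_distrib x y z := by ext <;> simp [mul_add]; abel
  right_distrib x y z := by ext <;> simp [add_mul]; abel
  zero_mul x := by ext <;> simp
  mul_zero x := by ext <;> simp
  mul_assoc x y z := by ext <;> simp [mul_add, add_mul, mul_assoc, add_assoc]
  one_mul x := by ext <;> simp
  mul_one x := by ext <;> simp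
  neg_add_cancel x := by ext <;> simp
  nsmul := nsmulRec
  zsmul := zsmulRec

end Skew

/-- `x ↦ (x, dx)`. -/
noncomputable def dAux (A B : Type) [CommRing A] [CommRing B] [Algebra A B] :
    Forms A B →+* Skew A B :=
  lift
    { toFun := fun b => ⟨fn b, dd A b⟩
      map_one' := by ext <;> simp [dd]
      map_zero' := by ext <;> simp [dd]
      map_mul' := fun b c => by
        ext
        · simp
        · simp only [Skew.mul_snd, dd_mul, AlgHom.commutes, fn_comm c]
      map_add' := fun b c => by ext <;> simp [dd] }
    (fun b s => by
      ext
      · exact fn_comm b s.fst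
      · change sgn (fn b) * s.snd + dd A b * s.fst = sgn s.fst * dd A b + s.snd * fn b
        rw [AlgHom.commutes, fn_comm, dd_comm, add_comm])
    { toFun := fun b => ⟨dd A b, 0⟩
      map_zero' := by ext <;> simp [dd]
      map_add' := fun b c => by ext <;> simp [dd] }
    (fun a => by ext <;> simp [dd])
    (fun b c => by
      ext
      · exact dd_mul b c
      · change 0 = (sgn (fn b) * 0 + dd A b * dd A c) + (sgn (fn c) * 0 + dd A c * dd A b)
        rw [mul_zero, mul_zero, zero_add, zero_add, dd_anti])
    (fun b => by
      ext
      · exact dd_sq b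
      · change sgn (dd A b) * 0 + 0 * dd A b = 0
        simp)

theorem dAux_fst (x : Forms A B) : (dAux A B x).fst = x := by
  induction x using Forms.induction with
  | hfn b => rw [dAux, lift_fn]; rfl
  | hd b => rw [dAux, lift_dd]; rfl
  | hmul x y hx hy => rw [map_mul, Skew.mul_fst, hx, hy]
  | hadd x y hx hy => rw [map_add, Skew.add_fst, hx, hy]

theorem dAux_mul (x y : Forms A B) :
    (dAux A B (x * y)).snd = sgn x * (dAux A B y).snd + (dAux A B x).snd * y := by
  rw [map_mul, Skew.mul_snd, dAux_fst, dAux_fst]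

/-- The exterior derivative `d` on relative forms: the unique `A`-linear map with `d(b) = db`,
`d(db) = 0` and `d(xy) = dx y + (-1)^k x dy` for a `k`-form `x`. -/
noncomputable def d (A B : Type) [CommRing A] [CommRing B] [Algebra A B] :
    Forms A B →ₗ[A] Forms A B where
  toFun x := (dAux A B x).snd
  map_add' x y := by rw [map_add, Skew.add_snd]
  map_smul' a x := by
    have h : (dAux A B (fn (algebraMap A B a))).snd = 0 := by
      rw [dAux, lift_fn]; exact dd_algebraMap a
    rw [algebra_compatible_smul B a x, Algebra.smul_def, dAux_mul, h, zero_mul, add_zero,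
      AlgHom.commutes, RingHom.id_apply, algebra_compatible_smul B a (dAux A B x).snd,
      Algebra.smul_def]

theorem d_fn (b : B) : d A B (fn b) = dd A b := by
  change (dAux A B _).snd = _
  rw [dAux, lift_fn]; rfl

theorem d_dd (b : B) : d A B (dd A b) = 0 := by
  change (dAux A B _).snd = _
  rw [dAux, lift_dd]; rfl

theorem d_mul (x y : Forms A B) : d A B (x * y) = sgn x * d A B y + d A B x * y := dAux_mul x y

end Derivative

section Lie

variable {K A B : Type} [CommRing K] [CommRing A] [CommRing B] [Algebra A B] [Algebra K B]

/-- The dual number `x + ε y` on forms. -/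
noncomputable abbrev dual (x y : Forms A B) : TrivSqZeroExt (Forms A B) (Forms A B) :=
  .inl x + .inr y

theorem dual_fst (x y : Forms A B) : (dual x y).fst = x := by simp [dual]

theorem dual_snd (x y : Forms A B) : (dual x y).snd = y := by simp [dual]

theorem dual_mul (x y x' y' : Forms A B) :
    dual x y * dual x' y' = dual (x * x') (x * y' + y * x') := by
  ext
  · rw [TrivSqZeroExt.fst_mul, dual_fst, dual_fst, dual_fst]
  · rw [TrivSqZeroExt.snd_mul, dual_fst, dual_fst, dual_snd, dual_snd, dual_snd, smul_eq_mul,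
      op_smul_eq_mul]

theorem dual_add (x y x' y' : Forms A B) :
    dual x y + dual x' y' = dual (x + x') (y + y') := by
  ext <;> simp [dual]

theorem dual_zero : dual (0 : Forms A B) 0 = 0 := by simp [dual]

theorem eq_dual (s : TrivSqZeroExt (Forms A B) (Forms A B)) : s = dual s.fst s.snd :=
  (TrivSqZeroExt.inl_fst_add_inr_snd_eq s).symm

/-- `x ↦ x + ε L_θ x`. -/
noncomputable def lieAux (θ : Derivation K B B)
    (hθ : ∀ a : A, ∃ a' : A, θ (algebraMap A B a) = algebraMap A B a') :
    Forms A B →+* TrivSqZeroExt (Forms A B) (Forms A B) :=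
  lift
    { toFun := fun b => dual (fn b) (fn (θ b))
      map_one' := by simp [dual]
      map_zero' := by simp [dual]
      map_mul' := fun b c => by
        rw [dual_mul, θ.leibniz, smul_eq_mul, smul_eq_mul, mul_comm c, fn_mul, fn_add, fn_mul,
          fn_mul]
      map_add' := fun b c => by rw [dual_add, map_add, fn_add, fn_add] }
    (fun b s => by
      rw [eq_dual s]
      change dual (fn b) (fn (θ b)) * _ = _ * dual (fn b) (fn (θ b))
      rw [dual_mul, dual_mul, fn_comm, fn_comm, fn_comm, add_comm])
    { toFun := fun b => dual (dd A b) (dd A (θ b))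
      map_zero' := by simp [dual, dd]
      map_add' := fun b c => by simp only [dual_add, dd, map_add] }
    (fun a => by
      obtain ⟨a', h⟩ := hθ a
      change dual (dd A _) (dd A (θ _)) = 0
      rw [h, dd_algebraMap, dd_algebraMap, dual_zero])
    (fun b c => by
      change dual (dd A _) (dd A (θ _)) = dual (fn b) (fn (θ b)) * dual (dd A c) (dd A (θ c))
        + dual (fn c) (fn (θ c)) * dual (dd A b) (dd A (θ b))
      rw [dual_mul, dual_mul, dual_add, ← dd_mul, θ.leibniz]
      congr 1
      have h : dd A (b • θ c + c • θ b) = dd A (b * θ c) + dd A (c * θ b) := by simp [dd]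
      rw [h, dd_mul, dd_mul]
      abel)
    (fun b => by
      change dual (dd A b) (dd A (θ b)) * dual (dd A b) (dd A (θ b)) = 0
      rw [dual_mul, dd_sq, dd_anti, dual_zero])

variable (θ : Derivation K B B)
  (hθ : ∀ a : A, ∃ a' : A, θ (algebraMap A B a) = algebraMap A B a')

theorem lieAux_fn (b : B) : lieAux θ hθ (fn b) = dual (fn b) (fn (θ b)) := by
  rw [lieAux, lift_fn]; rfl

theorem lieAux_dd (b : B) : lieAux θ hθ (dd A b) = dual (dd A b) (dd A (θ b)) := by
  rw [lieAux, lift_dd]; rfl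

theorem lieAux_fst (x : Forms A B) : (lieAux θ hθ x).fst = x := by
  induction x using Forms.induction with
  | hfn b => rw [lieAux_fn, dual_fst]
  | hd b => rw [lieAux_dd, dual_fst]
  | hmul x y hx hy => rw [map_mul, TrivSqZeroExt.fst_mul, hx, hy]
  | hadd x y hx hy => rw [map_add, TrivSqZeroExt.fst_add, hx, hy]

theorem lieAux_mul (x y : Forms A B) :
    (lieAux θ hθ (x * y)).snd = x * (lieAux θ hθ y).snd + (lieAux θ hθ x).snd * y := by
  rw [map_mul, TrivSqZeroExt.snd_mul, lieAux_fst, lieAux_fst, smul_eq_mul, op_smul_eq_mul]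

/-- The Lie derivative `L_θ` on relative forms along a derivation `θ` of `B` that maps the image
of `A` to itself: the unique `K`-linear derivation of the algebra of forms with `L_θ(b) = θ b` and
`L_θ(db) = d(θ b)`. -/
noncomputable def lie : Forms A B →ₗ[K] Forms A B where
  toFun x := (lieAux θ hθ x).snd
  map_add' x y := by rw [map_add, TrivSqZeroExt.snd_add]
  map_smul' k x := by
    rw [algebra_compatible_smul B k x, Algebra.smul_def, lieAux_mul, lieAux_fn, dual_snd,
      Derivation.map_algebraMap, fn, map_zero, zero_mul, add_zero, RingHom.id_apply,
      algebra_compatible_smul B k (lieAux θ hθ x).snd, Algebra.smul_def]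

theorem lie_fn (b : B) : lie θ hθ (fn b) = fn (θ b) := by
  change (lieAux θ hθ _).snd = _
  rw [lieAux_fn, dual_snd]

theorem lie_dd (b : B) : lie θ hθ (dd A b) = dd A (θ b) := by
  change (lieAux θ hθ _).snd = _
  rw [lieAux_dd, dual_snd]

theorem lie_mul (x y : Forms A B) : lie θ hθ (x * y) = x * lie θ hθ y + lie θ hθ x * y :=
  lieAux_mul θ hθ x y

theorem sgn_lie (x : Forms A B) : sgn (lie θ hθ x) = lie θ hθ (sgn x) := by
  induction x using Forms.induction with
  | hfn b => rw [lie_fn, AlgHom.commutes, AlgHom.commutes, lie_fn]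
  | hd b => rw [lie_dd, sgn_dd, sgn_dd, map_neg, lie_dd]
  | hmul x y hx hy => rw [lie_mul, map_mul sgn x y, lie_mul, map_add, map_mul, map_mul, hx, hy]
  | hadd x y hx hy => rw [map_add, map_add, map_add, map_add, hx, hy]

theorem d_lie (x : Forms A B) : d A B (lie θ hθ x) = lie θ hθ (d A B x) := by
  induction x using Forms.induction with
  | hfn b => rw [lie_fn, d_fn, d_fn, lie_dd]
  | hd b => rw [lie_dd, d_dd, d_dd, map_zero]
  | hmul x y hx hy =>
    rw [lie_mul, d_mul, map_add, map_add, lie_mul, lie_mul, d_mul, d_mul, sgn_lie, hx, hy]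
    abel
  | hadd x y hx hy => rw [map_add, map_add, map_add, map_add, hx, hy]

/-- `L_θ` preserves the degree. -/
theorem lie_mem (k : ℕ) (x : Forms A B) (hx : x ∈ ⋀[B]^k Ω[B⁄A]) :
    lie θ hθ x ∈ ⋀[B]^k Ω[B⁄A] := by
  have h1 : ∀ ω : Ω[B⁄A], lie θ hθ (ExteriorAlgebra.ι B ω) ∈
      LinearMap.range (ExteriorAlgebra.ι B (M := Ω[B⁄A])) := fun ω => by
    have h : ω ∈ Submodule.span B (Set.range (KaehlerDifferential.D A B)) := by
      rw [KaehlerDifferential.span_range_derivation]; trivial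
    induction h using Submodule.span_induction with
    | mem y hy => obtain ⟨b, rfl⟩ := hy; exact ⟨_, (lie_dd θ hθ b).symm⟩
    | zero => simp
    | add y z _ _ h1 h2 => rw [map_add, map_add]; exact add_mem h1 h2
    | smul b y _ h1 =>
      rw [map_smul, Algebra.smul_def, lie_mul, lie_fn, ← Algebra.smul_def, ← Algebra.smul_def]
      exact add_mem (Submodule.smul_mem _ _ h1) (Submodule.smul_mem _ _ ⟨y, rfl⟩)
  induction hx using Submodule.pow_induction_on_left' with
  | algebraMap b =>
    rw [lie_fn]
    change _ ∈ LinearMap.range (ExteriorAlgebra.ι B (M := Ω[B⁄A])) ^ 0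
    rw [pow_zero]
    exact Submodule.algebraMap_mem _
  | add x y i hx hy h1 h2 => rw [map_add]; exact add_mem h1 h2
  | mem_mul m hm i x hx ih =>
    obtain ⟨ω, rfl⟩ := hm
    rw [lie_mul]
    change _ ∈ LinearMap.range (ExteriorAlgebra.ι B (M := Ω[B⁄A])) ^ (i + 1)
    rw [pow_succ']
    exact add_mem (Submodule.mul_mem_mul ⟨ω, rfl⟩ ih) (Submodule.mul_mem_mul (h1 ω) hx)

end Lie

section Pullback

variable {A B : Type} [CommRing A] [CommRing B] [Algebra A B]

/-- `b ↦ σ b` as a form of degree 0. -/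
noncomputable def pullFn (σ : B ≃ₐ[A] B) : B →+* Forms A B :=
  (algebraMap B (Forms A B)).comp (σ : B →+* B)

/-- `b ↦ d(σ b)`. -/
noncomputable def pullD (σ : B ≃ₐ[A] B) : B →+ Forms A B := (ddHom A).comp (σ : B →+ B)

theorem pullFn_apply (σ : B ≃ₐ[A] B) (b : B) : pullFn σ b = fn (σ b) := rfl

theorem pullD_apply (σ : B ≃ₐ[A] B) (b : B) : pullD σ b = dd A (σ b) := rfl

theorem pullD_mul (σ : B ≃ₐ[A] B) (b c : B) :
    pullD σ (b * c) = pullFn σ b * pullD σ c + pullFn σ c * pullD σ b := by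
  simp only [pullD_apply, pullFn_apply, map_mul σ, dd_mul]

/-- The action on forms of an automorphism `σ` of the `A`-algebra `B`, as a ring homomorphism. -/
noncomputable def pullHom (σ : B ≃ₐ[A] B) : Forms A B →+* Forms A B :=
  lift (pullFn σ) (fun b s => by rw [pullFn_apply, fn_comm]) (pullD σ)
    (fun a => by rw [pullD_apply, AlgEquiv.commutes, dd_algebraMap])
    (pullD_mul σ)
    (fun b => by rw [pullD_apply, dd_sq])

theorem pullHom_fn (σ : B ≃ₐ[A] B) (b : B) : pullHom σ (fn b) = fn (σ b) := by
  rw [pullHom, lift_fn]; rfl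

theorem pullHom_dd (σ : B ≃ₐ[A] B) (b : B) : pullHom σ (dd A b) = dd A (σ b) := by
  rw [pullHom, lift_dd]; rfl

/-- The action on forms of an automorphism `σ` of the `A`-algebra `B`: the multiplicative map with
`b ↦ σ b` and `db ↦ d(σ b)`. -/
noncomputable def pull (σ : B ≃ₐ[A] B) : Forms A B →ₗ[A] Forms A B where
  toFun := pullHom σ
  map_add' := map_add _
  map_smul' a x := by
    rw [algebra_compatible_smul B a x, Algebra.smul_def, map_mul, pullHom_fn, AlgEquiv.commutes,
      ← Algebra.smul_def, algebraMap_smul, RingHom.id_apply]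

variable (σ : B ≃ₐ[A] B)

theorem pull_fn (b : B) : pull σ (fn b) = fn (σ b) := pullHom_fn σ b

theorem pull_dd (b : B) : pull σ (dd A b) = dd A (σ b) := pullHom_dd σ b

theorem pull_mul (x y : Forms A B) : pull σ (x * y) = pull σ x * pull σ y :=
  map_mul (pullHom σ) x y

theorem sgn_pull (x : Forms A B) : sgn (pull σ x) = pull σ (sgn x) := by
  induction x using Forms.induction with
  | hfn b => rw [pull_fn, AlgHom.commutes, AlgHom.commutes, pull_fn]
  | hd b => rw [pull_dd, sgn_dd, sgn_dd, map_neg, pull_dd]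
  | hmul x y hx hy => rw [pull_mul, map_mul sgn x y, pull_mul, map_mul, hx, hy]
  | hadd x y hx hy => rw [map_add, map_add, map_add, map_add, hx, hy]

theorem d_pull (x : Forms A B) : d A B (pull σ x) = pull σ (d A B x) := by
  induction x using Forms.induction with
  | hfn b => rw [pull_fn, d_fn, d_fn, pull_dd]
  | hd b => rw [pull_dd, d_dd, d_dd, map_zero]
  | hmul x y hx hy =>
    rw [pull_mul, d_mul, d_mul, map_add, pull_mul, pull_mul, sgn_pull, hx, hy]
  | hadd x y hx hy => rw [map_add, map_add, map_add, map_add, hx, hy]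

theorem pull_mem (k : ℕ) (x : Forms A B) (hx : x ∈ ⋀[B]^k Ω[B⁄A]) :
    pull σ x ∈ ⋀[B]^k Ω[B⁄A] := by
  have h1 : ∀ ω : Ω[B⁄A], pull σ (ExteriorAlgebra.ι B ω) ∈
      LinearMap.range (ExteriorAlgebra.ι B (M := Ω[B⁄A])) := fun ω => by
    have h : ω ∈ Submodule.span B (Set.range (KaehlerDifferential.D A B)) := by
      rw [KaehlerDifferential.span_range_derivation]; trivial
    induction h using Submodule.span_induction with
    | mem y hy => obtain ⟨b, rfl⟩ := hy; exact ⟨_, (pull_dd σ b).symm⟩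
    | zero => simp
    | add y z _ _ h1 h2 => rw [map_add, map_add]; exact add_mem h1 h2
    | smul b y _ h1 =>
      rw [map_smul, Algebra.smul_def, pull_mul, pull_fn, ← Algebra.smul_def]
      exact Submodule.smul_mem _ _ h1
  induction hx using Submodule.pow_induction_on_left' with
  | algebraMap b =>
    rw [pull_fn]
    change _ ∈ LinearMap.range (ExteriorAlgebra.ι B (M := Ω[B⁄A])) ^ 0
    rw [pow_zero]
    exact Submodule.algebraMap_mem _
  | add x y i hx hy h1 h2 => rw [map_add]; exact add_mem h1 h2
  | mem_mul m hm i x hx ih =>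
    obtain ⟨ω, rfl⟩ := hm
    rw [pull_mul]
    change _ ∈ LinearMap.range (ExteriorAlgebra.ι B (M := Ω[B⁄A])) ^ (i + 1)
    rw [pow_succ']
    exact Submodule.mul_mem_mul (h1 ω) ih

end Pullback

section Cohomology

variable {A B : Type} [CommRing A] [CommRing B] [Algebra A B]

/-- The twisted differential `∇_η(ω) = dω + η ∧ ω`, for a 1-form `η`. -/
noncomputable def nabla (η : Ω[B⁄A]) : Forms A B →ₗ[A] Forms A B :=
  d A B + LinearMap.mulLeft A (ExteriorAlgebra.ι B η)

/-- The `k`-forms `ω` with `∇_η ω = 0`. -/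
noncomputable def closed (η : Ω[B⁄A]) (k : ℕ) : Submodule A (Forms A B) :=
  (⋀[B]^k Ω[B⁄A]).restrictScalars A ⊓ LinearMap.ker (nabla η)

/-- The `k`-forms `∇_η ω`, for `ω` a `(k-1)`-form; this is 0 for `k = 0`. -/
noncomputable def exact (η : Ω[B⁄A]) : ℕ → Submodule A (Forms A B)
  | 0 => ⊥
  | k + 1 => ((⋀[B]^k Ω[B⁄A]).restrictScalars A).map (nabla η)

/-- The cohomology `H^k(Ω^•_{B/A}, ∇_η)` of the complex of relative forms, for a closed
1-form `η`. For `η = 0` this is the relative de Rham cohomology of the affine scheme `Spec B`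
over `Spec A`. -/
abbrev Cohomology (η : Ω[B⁄A]) (k : ℕ) : Type :=
  closed η k ⧸ (exact η k).comap (closed η k).subtype

/-- The map on cohomology that is induced by a map `T` of forms which preserves degrees and
commutes with `∇_η`. -/
noncomputable def cohMap {K : Type} [CommRing K] [Algebra K A] [Algebra K B] [IsScalarTower K A B]
    (η : Ω[B⁄A]) (k : ℕ) (T : Forms A B →ₗ[K] Forms A B)
    (hT : ∀ i x, x ∈ ⋀[B]^i Ω[B⁄A] → T x ∈ ⋀[B]^i Ω[B⁄A])
    (hη : ∀ x, nabla η (T x) = T (nabla η x)) : Cohomology η k →ₗ[K] Cohomology η k :=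
  Submodule.mapQ (((exact η k).comap (closed η k).subtype).restrictScalars K)
    (((exact η k).comap (closed η k).subtype).restrictScalars K)
    ((T.comp ((closed η k).restrictScalars K).subtype).codRestrict ((closed η k).restrictScalars K)
      (fun x => ⟨hT k _ x.2.1, by
        change nabla η (T x) = 0
        have h : nabla η x.1 = 0 := x.2.2
        rw [hη]; exact (congrArg T h).trans (map_zero T)⟩))
    (by
      intro x hx
      cases k with
      | zero =>
        have h : (x : Forms A B) = 0 := hx
        change T x = 0
        rw [h, map_zero]
      | succ k =>
        obtain ⟨y, hy, h⟩ := hx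
        exact ⟨T y, hT k y hy, (hη y).trans (congrArg T h)⟩)

end Cohomology

end Forms

/-! ### The Weyl algebra and hypergeometric modules -/

/-- The relations of the Weyl algebra, on generators `λ_j = inl j` and `∂_j = inr j`. -/
inductive WeylRel (N : ℕ) : FreeAlgebra ℂ (Fin N ⊕ Fin N) → FreeAlgebra ℂ (Fin N ⊕ Fin N) → Prop
  | lam (i j : Fin N) : WeylRel N
      (FreeAlgebra.ι ℂ (.inl i) * FreeAlgebra.ι ℂ (.inl j))
      (FreeAlgebra.ι ℂ (.inl j) * FreeAlgebra.ι ℂ (.inl i))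
  | par (i j : Fin N) : WeylRel N
      (FreeAlgebra.ι ℂ (.inr i) * FreeAlgebra.ι ℂ (.inr j))
      (FreeAlgebra.ι ℂ (.inr j) * FreeAlgebra.ι ℂ (.inr i))
  | comm (i j : Fin N) : WeylRel N
      (FreeAlgebra.ι ℂ (.inr i) * FreeAlgebra.ι ℂ (.inl j))
      (FreeAlgebra.ι ℂ (.inl j) * FreeAlgebra.ι ℂ (.inr i) + if i = j then 1 else 0)

/-- The ring `𝒟 = ℂ⟨λ_1, …, λ_N, ∂_1, …, ∂_N⟩` of differential operators with polynomial
coefficients. -/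
abbrev Weyl (N : ℕ) : Type := RingQuot (WeylRel N)

namespace Weyl

/-- The operator of multiplication by `λ_j`. -/
noncomputable def lam {N : ℕ} (j : Fin N) : Weyl N :=
  RingQuot.mkAlgHom ℂ (WeylRel N) (FreeAlgebra.ι ℂ (.inl j))

/-- The operator `∂_j = ∂/∂λ_j`. -/
noncomputable def par {N : ℕ} (j : Fin N) : Weyl N :=
  RingQuot.mkAlgHom ℂ (WeylRel N) (FreeAlgebra.ι ℂ (.inr j))

end Weyl

section GKZ

variable {n N : ℕ}

/-- The box operator `□_l = ∏_{l_j > 0} ∂_j^{l_j} - ∏_{l_j < 0} ∂_j^{-l_j}`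
(note that `Int.toNat` sends negative integers to 0). -/
noncomputable def boxOp (l : Fin N → ℤ) : Weyl N :=
  (List.ofFn fun j => Weyl.par j ^ (l j).toNat).prod -
    (List.ofFn fun j => Weyl.par j ^ (-l j).toNat).prod

/-- The Euler operator `Z_{i,α} = ∑_j a^{(j)}_i λ_j ∂_j - α_i`. -/
noncomputable def eulerOp (a : Fin N → Fin n → ℤ) (α : Fin n → ℂ) (i : Fin n) : Weyl N :=
  (∑ j, (a j i : ℂ) • (Weyl.lam j * Weyl.par j)) - algebraMap ℂ (Weyl N) (α i)

/-- The left ideal of `𝒟` generated by the operators `□_l`, for `l` in the lattice of relations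
between the `a^{(j)}`, and the operators `Z_{i,α}`. -/
noncomputable def gkzIdeal (a : Fin N → Fin n → ℤ) (α : Fin n → ℂ) :
    Submodule (Weyl N) (Weyl N) :=
  Submodule.span (Weyl N)
    ({P | ∃ l : Fin N → ℤ, ∑ j, l j • a j = 0 ∧ P = boxOp l} ∪ Set.range (eulerOp a α))

/-- The hypergeometric `𝒟`-module `ℳ_α`. -/
abbrev GKZ (a : Fin N → Fin n → ℤ) (α : Fin n → ℂ) : Type := Weyl N ⧸ gkzIdeal a α

/-- The real cone `C(A)` generated by the `a^{(j)}`. -/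
def cone (a : Fin N → Fin n → ℤ) : Set (Fin n → ℝ) :=
  {v | ∃ t : Fin N → ℝ, (∀ j, 0 ≤ t j) ∧ v = ∑ j, t j • fun i => (a j i : ℝ)}

/-- `c` is the coefficient vector of a normalized integral linear form that defines a
codimension-one face of `C(A)`. -/
def IsFacetForm (a : Fin N → Fin n → ℤ) (c : Fin n → ℤ) : Prop :=
  Finset.univ.gcd c = 1 ∧ (∀ v ∈ cone a, 0 ≤ ∑ i, (c i : ℝ) * v i) ∧
    Module.finrank ℝ (Submodule.span ℝ {v | v ∈ cone a ∧ ∑ i, (c i : ℝ) * v i = 0}) + 1 = n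

/-- `α` is nonresonant for `A`: no form that defines a codimension-one face of the cone takes an
integral value at `α`. -/
def Nonresonant (a : Fin N → Fin n → ℤ) (α : Fin n → ℂ) : Prop :=
  ∀ c : Fin n → ℤ, IsFacetForm a c → ∀ z : ℤ, ∑ i, (c i : ℂ) * α i ≠ z

end GKZ

/-! ### Laurent polynomials over `ℂ[λ]` -/

/-- The polynomial ring `ℂ[λ] = ℂ[λ_1, …, λ_N]`. -/
abbrev PolyRing (N : ℕ) : Type := MvPolynomial (Fin N) ℂ

/-- The ring `ℂ[λ][x_1^{±1}, …, x_n^{±1}]`. -/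
abbrev Laurent (N n : ℕ) : Type := AddMonoidAlgebra (PolyRing N) (Fin n → ℤ)

namespace Laurent

variable {N n m : ℕ}

/-- The monomial `x^u`. -/
noncomputable abbrev mon (u : Fin n → ℤ) : Laurent N n := AddMonoidAlgebra.single u 1

/-- The polynomial `f = ∑_j λ_j x^{a^{(j)}}`. -/
noncomputable def generic (a : Fin N → Fin n → ℤ) : Laurent N n :=
  ∑ j, AddMonoidAlgebra.single (a j) (MvPolynomial.X j)

/-- The homomorphism `(u_1, …, u_m) ↦ (D u_1, …, D u_m, 0)` on exponents. -/
def expHom (m D : ℕ) : (Fin m → ℤ) →+ (Fin (m + 1) → ℤ) where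
  toFun u := Fin.snoc (fun i => (D : ℤ) * u i) 0
  map_zero' := by
    funext i
    refine Fin.lastCases ?_ (fun i => ?_) i <;> simp
  map_add' u v := by
    funext i
    refine Fin.lastCases ?_ (fun i => ?_) i <;> simp [mul_add]

/-- The substitution `g(x_1, …, x_m) ↦ g(x_1^D, …, x_m^D)`, with values in the Laurent
polynomials in `x_1, …, x_{m+1}`. -/
noncomputable def subst (D : ℕ) : Laurent N m →ₐ[PolyRing N] Laurent N (m + 1) :=
  AddMonoidAlgebra.mapDomainAlgHom (PolyRing N) (PolyRing N) (expHom m D)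

/-- The map `∂_j = ∂/∂λ_j` on coefficients. -/
noncomputable def coefLin (n : ℕ) (j : Fin N) : Laurent N n →ₗ[ℂ] Laurent N n where
  toFun p := AddMonoidAlgebra.ofCoeff
    (p.coeff.mapRange (MvPolynomial.pderiv j) (map_zero (MvPolynomial.pderiv j)))
  map_add' p q := by ext; simp
  map_smul' c p := by ext; simp

theorem coefLin_single (j : Fin N) (u : Fin n → ℤ) (p : PolyRing N) :
    coefLin n j (AddMonoidAlgebra.single u p) =
      AddMonoidAlgebra.single u (MvPolynomial.pderiv j p) := by
  change AddMonoidAlgebra.ofCoeff ((Finsupp.single u p).mapRange _ _) =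
    AddMonoidAlgebra.ofCoeff (Finsupp.single u _)
  rw [Finsupp.mapRange_single]

/-- The derivation `∂_j = ∂/∂λ_j`, acting on coefficients (so that `∂_j x^u = 0`). -/
noncomputable def coefDer (n : ℕ) (j : Fin N) : Derivation ℂ (Laurent N n) (Laurent N n) :=
  Derivation.mk'
    (coefLin n j)
    (fun p q => by
      induction p using AddMonoidAlgebra.induction_linear with
      | zero => simp
      | add p p' h h' =>
        simp only [add_mul, map_add, h, h', smul_eq_mul, mul_add]
        ring
      | single u p =>
        induction q using AddMonoidAlgebra.induction_linear with
        | zero => simp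
        | add q q' h h' =>
          simp only [mul_add, map_add, h, h', smul_eq_mul, add_mul]
          ring
        | single v q =>
          simp only [AddMonoidAlgebra.single_mul_single, coefLin_single, smul_eq_mul,
            Derivation.leibniz, AddMonoidAlgebra.single_add, add_comm v u])

end Laurent

/-! ### The complex on the open set `g ≠ 0` of the torus -/

section OpenSet

variable {N m : ℕ}

/-- The ring of regular functions on the open subset `U` of the torus with coordinates
`x_1, …, x_m` over `ℂ[λ]` where `g` does not vanish. -/
abbrev OU (g : Laurent N m) : Type := Localization.Away g

namespace OU

variable (g : Laurent N m)

/-- The function `x^u` on `U`. -/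
noncomputable def mon (u : Fin m → ℤ) : OU g := algebraMap (Laurent N m) (OU g) (Laurent.mon u)

/-- The function `g` on `U`. -/
noncomputable def gU : OU g := algebraMap (Laurent N m) (OU g) g

/-- The function `1/g` on `U`. -/
noncomputable def gInv : OU g := IsLocalization.Away.invSelf g

theorem gU_mul_gInv : gU g * gInv g = 1 := IsLocalization.Away.mul_invSelf g

/-- The derivation `∂_j` of the ring of functions on `U` with `∂_j x_i = 0`: the unique extension
of the coefficientwise derivation of Laurent polynomials. -/
noncomputable def der (j : Fin N) : Derivation ℂ (OU g) (OU g) :=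
  ((((Algebra.linearMap (Laurent N m) (OU g)).compDer
    (Laurent.coefDer m j)).liftKaehlerDifferential.liftBaseChange (OU g)).comp
      (KaehlerDifferential.tensorKaehlerEquivOfFormallyEtale ℂ (Laurent N m)
        (OU g)).symm.toLinearMap).compDer (KaehlerDifferential.D ℂ (OU g))

theorem der_algebraMap (j : Fin N) (p : Laurent N m) :
    der g j (algebraMap (Laurent N m) (OU g) p) =
      algebraMap (Laurent N m) (OU g) (Laurent.coefDer m j p) := by
  simp [der, KaehlerDifferential.tensorKaehlerEquivOfFormallyEtale_symm_D_algebraMap]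

theorem der_mon (j : Fin N) (u : Fin m → ℤ) : der g j (mon g u) = 0 := by
  rw [mon, der_algebraMap]
  change algebraMap _ _ (Laurent.coefLin m j _) = _
  rw [Laurent.coefLin_single]
  simp

theorem der_poly (j : Fin N) (p : PolyRing N) :
    der g j (algebraMap (PolyRing N) (OU g) p) =
      algebraMap (PolyRing N) (OU g) (MvPolynomial.pderiv j p) := by
  rw [IsScalarTower.algebraMap_apply (PolyRing N) (Laurent N m) (OU g), der_algebraMap,
    IsScalarTower.algebraMap_apply (PolyRing N) (Laurent N m) (OU g)]
  congr 1
  exact Laurent.coefLin_single j 0 p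

theorem der_stable (j : Fin N) (p : PolyRing N) : ∃ q : PolyRing N,
    der g j (algebraMap (PolyRing N) (OU g) p) = algebraMap (PolyRing N) (OU g) q :=
  ⟨_, der_poly g j p⟩

/-- The 1-form `∑_{i=1}^{n-1} α_i dx_i/x_i - α_n dg/g`, where `n = m + 1`. -/
noncomputable def eta (α : Fin (m + 1) → ℂ) : Ω[OU g⁄PolyRing N] :=
  (∑ i : Fin m, (algebraMap ℂ (OU g) (α i.castSucc) * mon g (-Pi.single i 1)) •
    KaehlerDifferential.D (PolyRing N) (OU g) (mon g (Pi.single i 1))) -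
  (algebraMap ℂ (OU g) (α (Fin.last m)) * gInv g) • KaehlerDifferential.D (PolyRing N) (OU g) (gU g)

/-- The cohomology `H^k(Ω^•_{U/ℂ[λ]}, ∇̃_α)`, where
`∇̃_α(ω) = dω + ∑_{i=1}^{n-1} α_i (dx_i/x_i) ∧ ω - α_n (dg/g) ∧ ω`. -/
abbrev TwistedCohomology (α : Fin (m + 1) → ℂ) (k : ℕ) : Type := Forms.Cohomology (eta g α) k

/-- The function `-α_n (∂_j g)/g`. -/
noncomputable def shift (α : Fin (m + 1) → ℂ) (j : Fin N) : OU g :=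
  -(algebraMap ℂ (OU g) (α (Fin.last m)) * (gInv g * der g j (gU g)))

/-- The operator `D̃_j = ∂_j - α_n (∂_j g)/g` on forms, where `∂_j` acts on the coefficients of
forms with respect to the products of the `dx_i`. -/
noncomputable def opForms (α : Fin (m + 1) → ℂ) (j : Fin N) :
    Forms (PolyRing N) (OU g) →ₗ[ℂ] Forms (PolyRing N) (OU g) :=
  Forms.lie (der g j) (der_stable g j) + LinearMap.mulLeft ℂ (Forms.fn (shift g α j))

theorem opForms_apply (α : Fin (m + 1) → ℂ) (j : Fin N) (x : Forms (PolyRing N) (OU g)) :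
    opForms g α j x =
      Forms.lie (der g j) (der_stable g j) x + Forms.fn (shift g α j) * x := rfl

theorem opForms_mem (α : Fin (m + 1) → ℂ) (j : Fin N) (i : ℕ) (x : Forms (PolyRing N) (OU g))
    (hx : x ∈ ⋀[OU g]^i Ω[OU g⁄PolyRing N]) :
    opForms g α j x ∈ ⋀[OU g]^i Ω[OU g⁄PolyRing N] := by
  rw [opForms_apply, ← Algebra.smul_def]
  exact add_mem (Forms.lie_mem _ _ i x hx) (Submodule.smul_mem _ _ hx)

theorem dd_const (c : ℂ) (b : OU g) : Forms.dd (PolyRing N) (algebraMap ℂ (OU g) c * b) =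
    Forms.fn (algebraMap ℂ (OU g) c) * Forms.dd (PolyRing N) b := by
  rw [Forms.dd_mul, IsScalarTower.algebraMap_apply ℂ (PolyRing N) (OU g), Forms.dd_algebraMap,
    mul_zero, add_zero]

theorem lie_eta (α : Fin (m + 1) → ℂ) (j : Fin N) :
    Forms.lie (der g j) (der_stable g j) (ExteriorAlgebra.ι (OU g) (eta g α)) =
      Forms.dd (PolyRing N) (shift g α j) := by
  have h1 : ExteriorAlgebra.ι (OU g) (eta g α) =
      (∑ i : Fin m, Forms.fn (algebraMap ℂ (OU g) (α i.castSucc) * mon g (-Pi.single i 1)) *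
        Forms.dd (PolyRing N) (mon g (Pi.single i 1))) -
      Forms.fn (algebraMap ℂ (OU g) (α (Fin.last m)) * gInv g) *
        Forms.dd (PolyRing N) (gU g) := by
    simp only [eta, map_sub, map_sum, map_smul, Algebra.smul_def]
  have hk : ∀ c : ℂ, der g j (algebraMap ℂ (OU g) c) = 0 := fun c => Derivation.map_algebraMap _ c
  have hg : gInv g * gU g = 1 := by rw [mul_comm, gU_mul_gInv]
  have hz : Forms.dd (PolyRing N) (0 : OU g) = 0 := (Forms.ddHom (PolyRing N)).map_zero
  have hz' : Forms.fn (A := PolyRing N) (0 : OU g) = 0 := map_zero _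
  have h2 : Forms.dd (PolyRing N) (gInv g * der g j (gU g)) =
      Forms.fn (gInv g) * Forms.dd (PolyRing N) (der g j (gU g)) +
        Forms.fn (der g j (gInv g)) * Forms.dd (PolyRing N) (gU g) := by
    have h : Forms.dd (PolyRing N) (gInv g) = ExteriorAlgebra.ι (OU g)
        (-gInv g ^ 2 • KaehlerDifferential.D (PolyRing N) (OU g) (gU g)) :=
      congrArg _ ((KaehlerDifferential.D (PolyRing N) (OU g)).leibniz_of_mul_eq_one hg)
    rw [Forms.dd_mul, (der g j).leibniz_of_mul_eq_one hg, h]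
    simp only [← Algebra.smul_def, ← map_smul, smul_smul, smul_eq_mul]
    rw [mul_comm]
  have h3 : Forms.dd (PolyRing N) (shift g α j) =
      -(Forms.fn (algebraMap ℂ (OU g) (α (Fin.last m))) *
        Forms.dd (PolyRing N) (gInv g * der g j (gU g))) := by
    rw [← dd_const, shift]
    simp only [Forms.dd, map_neg]
  rw [h1, map_sub, map_sum, h3, h2]
  simp only [Forms.lie_mul, Forms.lie_fn, Forms.lie_dd, der_mon, hz, hz', hk, mul_zero, zero_mul,
    add_zero, Finset.sum_const_zero, zero_sub, Forms.fn_mul, mul_add, mul_assoc]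

theorem nabla_opForms (α : Fin (m + 1) → ℂ) (j : Fin N) (x : Forms (PolyRing N) (OU g)) :
    Forms.nabla (eta g α) (opForms g α j x) = opForms g α j (Forms.nabla (eta g α) x) := by
  have h : ∀ y, Forms.nabla (eta g α) y =
    Forms.d (PolyRing N) (OU g) y + ExteriorAlgebra.ι (OU g) (eta g α) * y := fun y => rfl
  rw [h, h, opForms_apply, opForms_apply, map_add, map_add, Forms.lie_mul, Forms.d_mul, Forms.d_fn,
    Forms.d_lie, lie_eta, AlgHom.commutes, mul_add, mul_add, ← mul_assoc _ (Forms.fn _),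
    ← mul_assoc (Forms.fn _) _ x, ← Forms.fn_comm]
  abel

/-- The operator `D̃_j` on `H^k(Ω^•_{U/ℂ[λ]}, ∇̃_α)`, by which `∂_j` acts there. -/
noncomputable def op (α : Fin (m + 1) → ℂ) (k : ℕ) (j : Fin N) :
    TwistedCohomology g α k →ₗ[ℂ] TwistedCohomology g α k :=
  Forms.cohMap (eta g α) k (opForms g α j) (opForms_mem g α j) (nabla_opForms g α j)

end OU

end OpenSet

/-! ### Relative de Rham cohomology, isotypic components, and modules from geometry -/

section Geometry

variable {N : ℕ} {B : Type} [CommRing B] [Algebra (PolyRing N) B] [Algebra ℂ B]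
  [IsScalarTower ℂ (PolyRing N) B]

theorem nabla_zero {A C : Type} [CommRing A] [CommRing C] [Algebra A C] (x : Forms A C) :
    Forms.nabla 0 x = Forms.d A C x := by
  simp [Forms.nabla]

/-- The relative de Rham cohomology `H^k_DR(X/ℂ[λ])` of the affine scheme `X = Spec B`. -/
abbrev HDR (N : ℕ) (B : Type) [CommRing B] [Algebra (PolyRing N) B] (k : ℕ) : Type :=
  Forms.Cohomology (A := PolyRing N) (B := B) 0 k

/-- A derivation `θ` of `B` lifts `∂_j`: it restricts to `∂/∂λ_j` on `ℂ[λ]`. -/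
def IsLift (j : Fin N) (θ : Derivation ℂ B B) : Prop :=
  ∀ p : PolyRing N, θ (algebraMap (PolyRing N) B p) =
    algebraMap (PolyRing N) B (MvPolynomial.pderiv j p)

/-- The action on `H^k_DR(X/ℂ[λ])` of the Lie derivative along a lift of `∂_j`. If `X` is smooth
over `ℂ[λ]`, then lifts exist and all of them act in the same way, namely by the Gauss-Manin
connection `∇_{∂_j}`. -/
noncomputable def gaussManin (k : ℕ) (j : Fin N) (θ : Derivation ℂ B B) (hθ : IsLift j θ) :
    HDR N B k →ₗ[ℂ] HDR N B k :=
  Forms.cohMap 0 k (Forms.lie θ fun p => ⟨_, hθ p⟩) (Forms.lie_mem θ _)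
    (fun x => by rw [nabla_zero, nabla_zero, Forms.d_lie])

/-- The action on `H^k_DR(X/ℂ[λ])` of an automorphism of `X` over `ℂ[λ]`. -/
noncomputable def autAct (k : ℕ) (σ : B ≃ₐ[PolyRing N] B) : HDR N B k →ₗ[ℂ] HDR N B k :=
  Forms.cohMap 0 k ((Forms.pull σ).restrictScalars ℂ) (Forms.pull_mem σ)
    (fun x => by
      rw [nabla_zero, nabla_zero]
      exact Forms.d_pull σ x)

variable {G V : Type} [Group G] [AddCommGroup V] [Module ℂ V]

/-- The `χ`-isotypic component of `H^k_DR(X/ℂ[λ])`, where the group `G` acts on `X` over `ℂ[λ]`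
through `ψ`: the sum of all `G`-submodules that are isomorphic to `χ`. -/
noncomputable def isotypicPart (k : ℕ) (ψ : G →* (B ≃ₐ[PolyRing N] B))
    (χ : Representation ℂ G V) : Submodule ℂ (HDR N B k) :=
  sSup {W | ∃ f : V ≃ₗ[ℂ] W, ∀ s v, (f (χ s v) : HDR N B k) = autAct k (ψ s) (f v)}

/-- The `𝒟`-module `M` is isomorphic to the `χ`-isotypic component of `H^k_DR(X/ℂ[λ])`, on which
`𝒟` acts by the Gauss-Manin connection. Since `𝒟` is generated by `ℂ` and the `λ_j` and `∂_j`, an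
isomorphism of `𝒟`-modules is a `ℂ`-linear bijection that commutes with the `λ_j` and `∂_j`. -/
def IsIsotypicPart (M : Type) [AddCommGroup M] [Module ℂ M] [Module (Weyl N) M]
    (k : ℕ) (ψ : G →* (B ≃ₐ[PolyRing N] B)) (χ : Representation ℂ G V) : Prop :=
  ∃ (θ : Fin N → Derivation ℂ B B) (hθ : ∀ j, IsLift j (θ j))
    (e : M ≃ₗ[ℂ] isotypicPart k ψ χ), ∀ j u,
      (e (Weyl.lam j • u) : HDR N B k) = (MvPolynomial.X j : PolyRing N) • (e u : HDR N B k) ∧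
      (e (Weyl.par j • u) : HDR N B k) = gaussManin k j (θ j) (hθ j) (e u)

end Geometry

/-- A `𝒟`-module comes from geometry: it is isomorphic to `H^k_DR(X/ℂ[λ])^χ` for a smooth affine
scheme `X = Spec B` over `ℂ[λ]`, a finite group `G` acting on `X` over `ℂ[λ]`, and an irreducible
representation `χ` of `G`. -/
def ComesFromGeometry (N : ℕ) (M : Type) [AddCommGroup M] [Module ℂ M] [Module (Weyl N) M] :
    Prop :=
  ∃ (B : Type) (_ : CommRing B) (_ : Algebra (PolyRing N) B) (_ : Algebra ℂ B)
    (_ : IsScalarTower ℂ (PolyRing N) B) (G V : Type) (_ : Group G) (_ : AddCommGroup V)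
    (_ : Module ℂ V) (ψ : G →* (B ≃ₐ[PolyRing N] B)) (χ : Representation ℂ G V) (k : ℕ),
    Algebra.Smooth (PolyRing N) B ∧ Finite G ∧ χ.IsIrreducible ∧ IsIsotypicPart M k ψ χ

/-! ### The hypersurface `x_n^D g(x_1^D, …, x_{n-1}^D) = 1` -/

section Hypersurface

variable {N m : ℕ}

/-- The Laurent polynomial `x_n^D g(x_1^D, …, x_{n-1}^D)`, where `n = m + 1`. -/
noncomputable def hyperPoly (g : Laurent N m) (D : ℕ) : Laurent N (m + 1) :=
  Laurent.mon (Pi.single (Fin.last m) (D : ℤ)) * Laurent.subst D g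

/-- The coordinate ring of the hypersurface `x_n^D g(x_1^D, …, x_{n-1}^D) = 1` in the torus with
coordinates `x_1, …, x_n` over `ℂ[λ]`. -/
abbrev OX (g : Laurent N m) (D : ℕ) : Type :=
  Laurent N (m + 1) ⧸ Ideal.span {hyperPoly g D - 1}

/-- The automorphism `x_i ↦ s_i x_i` of Laurent polynomials. -/
noncomputable def scale {n : ℕ} (N : ℕ) (s : Fin n → ℂˣ) : Laurent N n →ₐ[PolyRing N] Laurent N n :=
  AddMonoidAlgebra.lift (PolyRing N) (Laurent N n) (Fin n → ℤ)
    { toFun := fun u => AddMonoidAlgebra.single u.toAdd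
        (MvPolynomial.C ((∏ i, s i ^ u.toAdd i : ℂˣ) : ℂ))
      map_one' := by simp [AddMonoidAlgebra.one_def]
      map_mul' := fun u v => by
        simp [AddMonoidAlgebra.single_mul_single, zpow_add, Finset.prod_mul_distrib] }

theorem scale_single {n : ℕ} (s : Fin n → ℂˣ) (u : Fin n → ℤ) (p : PolyRing N) :
    scale N s (AddMonoidAlgebra.single u p) =
      AddMonoidAlgebra.single u (p * MvPolynomial.C ((∏ i, s i ^ u i : ℂˣ) : ℂ)) := by
  simp [scale]

theorem scale_comp {n : ℕ} (s t : Fin n → ℂˣ) (p : Laurent N n) :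
    scale N s (scale N t p) = scale N (s * t) p := by
  induction p using AddMonoidAlgebra.induction_linear with
  | zero => simp
  | add p q hp hq => simp only [map_add, hp, hq]
  | single u p =>
    simp only [scale_single, Pi.mul_apply, mul_zpow, Finset.prod_mul_distrib, Units.val_mul,
      map_mul]
    congr 1
    ring

theorem scale_one {n : ℕ} (p : Laurent N n) : scale N 1 p = p := by
  induction p using AddMonoidAlgebra.induction_linear with
  | zero => simp
  | add p q hp hq => simp only [map_add, hp, hq]
  | single u p => simp [scale_single]

variable (g : Laurent N m) (D : ℕ)

theorem scale_hyperPoly (s : Fin (m + 1) → rootsOfUnity D ℂ) :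
    scale N (fun i => (s i : ℂˣ)) (hyperPoly g D) = hyperPoly g D := by
  have h : ∀ i, (s i : ℂˣ) ^ D = 1 := fun i => (s i).2
  have h1 : scale N (fun i => (s i : ℂˣ)) (Laurent.mon (Pi.single (Fin.last m) (D : ℤ))) =
      Laurent.mon (Pi.single (Fin.last m) (D : ℤ)) := by
    rw [Laurent.mon, scale_single, Fin.prod_univ_castSucc]
    simp [h]
  have h2 : ∀ p : Laurent N m, scale N (fun i => (s i : ℂˣ)) (Laurent.subst D p) =
      Laurent.subst D p := fun p => by
    induction p using AddMonoidAlgebra.induction_linear with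
    | zero => simp
    | add p q hp hq => simp only [map_add, hp, hq]
    | single u p =>
      have h3 : Laurent.subst D (AddMonoidAlgebra.single u p) =
          AddMonoidAlgebra.single (Laurent.expHom m D u) p := by
        simp [Laurent.subst]
      rw [h3, scale_single, Fin.prod_univ_castSucc]
      simp [Laurent.expHom, zpow_mul, h]
  rw [hyperPoly, map_mul, h1, h2]

/-- The automorphism `x_i ↦ s_i x_i` of the hypersurface, for `D`-th roots of unity `s_i`. -/
noncomputable def muHom (s : Fin (m + 1) → rootsOfUnity D ℂ) : OX g D →ₐ[PolyRing N] OX g D :=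
  Ideal.quotientMapₐ _ (scale N fun i => (s i : ℂˣ)) (by
    rw [Ideal.span_le, Set.singleton_subset_iff]
    change scale N _ (hyperPoly g D - 1) ∈ Ideal.span {hyperPoly g D - 1}
    rw [map_sub, map_one, scale_hyperPoly]
    exact Ideal.mem_span_singleton_self _)

theorem muHom_mk (s : Fin (m + 1) → rootsOfUnity D ℂ) (p : Laurent N (m + 1)) :
    muHom g D s (Ideal.Quotient.mk _ p) =
      Ideal.Quotient.mk _ (scale N (fun i => (s i : ℂˣ)) p) := rfl

theorem muHom_comp (s t : Fin (m + 1) → rootsOfUnity D ℂ) (x : OX g D) :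
    muHom g D s (muHom g D t x) = muHom g D (s * t) x := by
  obtain ⟨p, rfl⟩ := Ideal.Quotient.mk_surjective x
  rw [muHom_mk, muHom_mk, muHom_mk, scale_comp]
  rfl

theorem muHom_one (x : OX g D) : muHom g D 1 x = x := by
  obtain ⟨p, rfl⟩ := Ideal.Quotient.mk_surjective x
  rw [muHom_mk]
  exact congrArg _ (scale_one p)

/-- The action of the group `(μ_D)^n` on the hypersurface, by `x_i ↦ s_i x_i`. -/
noncomputable def muAct : (Fin (m + 1) → rootsOfUnity D ℂ) →* (OX g D ≃ₐ[PolyRing N] OX g D) where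
  toFun s := AlgEquiv.ofAlgHom (muHom g D s) (muHom g D s⁻¹)
    (by ext1 x; rw [AlgHom.comp_apply, muHom_comp, mul_inv_cancel, muHom_one]; rfl)
    (by ext1 x; rw [AlgHom.comp_apply, muHom_comp, inv_mul_cancel, muHom_one]; rfl)
  map_one' := by ext1 x; exact muHom_one g D x
  map_mul' s t := by ext1 x; exact (muHom_comp g D s t x).symm

/-- The character `s ↦ ∏ s_i^{k_i}` of `(μ_D)^n`, as a one-dimensional representation. -/
noncomputable def muChar (n D : ℕ) (k : Fin n → ℤ) :
    Representation ℂ (Fin n → rootsOfUnity D ℂ) ℂ where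
  toFun s := ((∏ i, (s i : ℂˣ) ^ k i : ℂˣ) : ℂ) • LinearMap.id
  map_one' := by ext; simp
  map_mul' s t := by
    ext
    simp [mul_zpow, Finset.prod_mul_distrib, mul_comm]

end Hypersurface

end AHyp

open AHyp

/-! Let f = ∑ λ_j x^{a^(j)}, and let 𝒟 act on Laurent polynomials over ℂ[λ] so that λ_j multiplies
and ∂_j acts as e^{-f} ∂_j e^f = ∂_j + x^{a^(j)}. The orbit of 1 is the span of the monomials with
exponents in the semigroup ℕA, and the annihilator of 1 is generated by the box operators. Applied
to 1, Z_{i,α} gives E_i(1) with E_i = e^{-f} (x_i ∂/∂x_i - α_i) e^f, and the E_i commute with 𝒟. So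
the hypergeometric module is ℂ[λ][ℕA] modulo the images of the E_i (`Weyl.mem_gkzIdeal_iff`).

Nonresonance makes the exponent set irrelevant. Suppose that two exponent sets, stable under adding
the a^(j), differ only on a hyperplane ℓ = k, where ℓ = ∑ c_i u_i defines a facet. Then ∑ c_i E_i
acts on the quotient by the scalar k - ℓ(α) ≠ 0; as the E_i commute, the quotient contributes
nothing (`Laurent.EulerEquiv.of_scalar`, `Laurent.EulerEquiv.of_level`). Moving facet hyperplanes
one unit at a time, every stable set that contains all lattice points deep inside the cone can be
exchanged for ℤ^n (`Laurent.EulerEquiv.of_deep`). By Farkas' lemma and a conductor argument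
(`exists_conductor`) this applies to ℕA, and also to a half-space u_n ≥ k₀.

On the half-space x_n is integrated out. All a^(j) have last coordinate 1, and the integral of
x_n^{k-α_n} e^{x_n g} dx_n/x_n is a Gamma factor times g^{α_n-k}. The formal version `OU.residue`
kills exactly the image of E_n and turns the other E_i into the operators x_i ∂/∂x_i + c_i of the
twisted connection on U (`OU.residue_mem_imageSum_iff`). Since the dx_i/x_i form a basis of the
1-forms, the functions on U modulo the images of these operators are the top cohomology
(`LogFrame.topEquiv`).

For rational α put e = -Dα. On X one has x_n^D = 1/g(x_1^D, …), so x_i ↦ x_i^D maps X to U with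
group (μ_D)^n. Multiplication by x^e untwists the connection (`HyperRing.dlog_mon_mul`) and lands in
the part of character χ; averaging over the group shows that it gives all of that part of the
cohomology (`HyperRing.eigen_iff`). Smoothness of X holds because a first-order error in the
equation can be absorbed by rescaling x_n, as D is invertible. -/

namespace AHyp

/-! ### Logarithmic coordinates and twisted cohomology in the top degree. -/

/-- Units `x_i` of `B` whose logarithmic differentials form a basis of `Ω_{B/A}`, with the dual
derivations `δ_i = x_i ∂/∂x_i`. -/
structure LogFrame (A B : Type) [CommRing A] [CommRing B] [Algebra A B] (m : ℕ) where
  x : Fin m → Bˣ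
  δ : Fin m → Derivation A B B
  δ_x : ∀ i k, δ i (x k) = if i = k then (x k : B) else 0
  D_eq : ∀ b, KaehlerDifferential.D A B b =
    ∑ i, δ i b • (((x i)⁻¹ : Bˣ) : B) • KaehlerDifferential.D A B (x i)

namespace LogFrame

variable {A B : Type} [CommRing A] [CommRing B] [Algebra A B] {m : ℕ} (F : LogFrame A B m)

/-- The logarithmic differential `dx_i/x_i`. -/
noncomputable def τ (i : Fin m) : Ω[B⁄A] :=
  (((F.x i)⁻¹ : Bˣ) : B) • KaehlerDifferential.D A B (F.x i)

/-- The form `dx_1/x_1 ∧ … ∧ dx_m/x_m`. -/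
noncomputable def vol : Forms A B := ExteriorAlgebra.ιMulti B m F.τ

theorem ι_τ (i : Fin m) : ExteriorAlgebra.ι B (F.τ i) =
    Forms.fn (((F.x i)⁻¹ : Bˣ) : B) * Forms.dd A (F.x i : B) := by
  rw [τ, map_smul, Algebra.smul_def]

theorem D_eq' (b : B) : KaehlerDifferential.D A B b = ∑ i, F.δ i b • F.τ i := F.D_eq b

theorem span_τ : Submodule.span B (Set.range F.τ) = ⊤ := by
  rw [eq_top_iff, ← KaehlerDifferential.span_range_derivation, Submodule.span_le]
  rintro _ ⟨b, rfl⟩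
  rw [F.D_eq']
  exact Submodule.sum_mem _ fun i _ =>
    Submodule.smul_mem _ _ (Submodule.subset_span ⟨i, rfl⟩)

theorem d_ι_τ (i : Fin m) : Forms.d A B (ExteriorAlgebra.ι B (F.τ i)) = 0 := by
  have h : KaehlerDifferential.D A B (((F.x i)⁻¹ : Bˣ) : B) =
      -(((F.x i)⁻¹ : Bˣ) : B) ^ 2 • KaehlerDifferential.D A B (F.x i : B) :=
    (KaehlerDifferential.D A B).leibniz_of_mul_eq_one (by simp)
  rw [ι_τ, Forms.d_mul, Forms.d_dd, mul_zero, zero_add, Forms.d_fn]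
  simp only [Forms.dd]
  rw [h, map_smul, smul_mul_assoc, ExteriorAlgebra.ι_sq_zero, smul_zero]

theorem ιMulti_cons {k : ℕ} (i : Fin m) (f : Fin k → Fin m) :
    ExteriorAlgebra.ιMulti B (k + 1) (fun j => F.τ ((Fin.cons i f : Fin (k + 1) → Fin m) j)) =
      ExteriorAlgebra.ι B (F.τ i) * ExteriorAlgebra.ιMulti B k (fun j => F.τ (f j)) := by
  rw [ExteriorAlgebra.ιMulti_succ_apply]
  rfl

theorem d_ιMulti {k : ℕ} (f : Fin k → Fin m) :
    Forms.d A B (ExteriorAlgebra.ιMulti B k (fun j => F.τ (f j))) = 0 := by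
  induction k with
  | zero =>
    rw [ExteriorAlgebra.ιMulti_zero_apply]
    have := Forms.d_fn (A := A) (1 : B)
    simpa [Forms.dd] using this
  | succ k ih =>
    have h := F.ιMulti_cons (f 0) (Fin.tail f)
    rw [Fin.cons_self_tail] at h
    rw [h, Forms.d_mul, ih, d_ι_τ, mul_zero, zero_mul, add_zero]

/-- The operator `δ_i + c_i`. -/
noncomputable def op (c : Fin m → B) (i : Fin m) : B →ₗ[A] B :=
  (F.δ i).toLinearMap + LinearMap.mulLeft A (c i)

theorem op_apply (c : Fin m → B) (i : Fin m) (b : B) : F.op c i b = F.δ i b + c i * b := rfl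

/-- Products of the dx_i/x_i are closed, so ∇ acts on the coefficient only: the wedge with dx_i/x_i
receives δ_i b from d and c_i b from the twist. -/
theorem nabla_smul_ιMulti (c : Fin m → B) {k : ℕ} (f : Fin k → Fin m) (b : B) :
    Forms.nabla (∑ i, c i • F.τ i) (b • ExteriorAlgebra.ιMulti B k (fun j => F.τ (f j))) =
      ∑ i, F.op c i b • ExteriorAlgebra.ιMulti B (k + 1)
        (fun j => F.τ ((Fin.cons i f : Fin (k + 1) → Fin m) j)) := by
  have h1 : Forms.d A B (b • ExteriorAlgebra.ιMulti B k (fun j => F.τ (f j))) =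
      ∑ i, F.δ i b • (ExteriorAlgebra.ι B (F.τ i) *
        ExteriorAlgebra.ιMulti B k (fun j => F.τ (f j))) := by
    rw [Algebra.smul_def, Forms.d_mul, d_ιMulti, mul_zero, zero_add, Forms.d_fn, Forms.dd, F.D_eq',
      map_sum, Finset.sum_mul]
    simp only [map_smul, smul_mul_assoc]
  change Forms.d A B _ + ExteriorAlgebra.ι B _ * _ = _
  rw [h1, map_sum, Finset.sum_mul, ← Finset.sum_add_distrib]
  refine Finset.sum_congr rfl fun i _ => ?_
  rw [ιMulti_cons, op_apply, add_smul, map_smul, mul_smul_comm, smul_mul_assoc, smul_smul,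
    mul_comm b]

/-- Packs the alternating rules into one integer, a permutation sign or 0; ε * ε = 1 lets a sign be
removed by multiplying with it once more. -/
theorem exists_ιMulti_eq (h : Fin m → Fin m) : ∃ ε : ℤ, (¬ Function.Injective h → ε = 0) ∧
    (Function.Injective h → ε * ε = 1) ∧
    ExteriorAlgebra.ιMulti B m (fun j => F.τ (h j)) = ε • F.vol := by
  by_cases hh : Function.Injective h
  · let σ : Equiv.Perm (Fin m) := Equiv.ofBijective h (Finite.injective_iff_bijective.1 hh)
    exact ⟨Equiv.Perm.sign σ, fun h' => absurd hh h', fun _ => Int.units_coe_mul_self _,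
      (ExteriorAlgebra.ιMulti B m (M := Ω[B⁄A])).map_perm F.τ σ⟩
  · refine ⟨0, fun _ => rfl, fun h' => absurd h' hh, ?_⟩
    rw [zero_smul]
    exact (ExteriorAlgebra.ιMulti B m (M := Ω[B⁄A])).map_eq_zero_of_not_injective _
      fun h' => hh fun a b hab => h' (by simp only [hab])

theorem vol_mem : F.vol ∈ ⋀[B]^m Ω[B⁄A] := ExteriorAlgebra.ιMulti_range B m ⟨_, rfl⟩

theorem exists_eq_smul_vol {y : Forms A B} (hy : y ∈ ⋀[B]^m Ω[B⁄A]) : ∃ b : B, y = b • F.vol := by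
  rw [← exteriorPower.ιMulti_span_fixedDegree_of_span_eq_top B m _ F.span_τ] at hy
  suffices h : y ∈ Submodule.span B {F.vol} by
    obtain ⟨b, hb⟩ := Submodule.mem_span_singleton.1 h
    exact ⟨b, hb.symm⟩
  refine Submodule.span_le.2 ?_ hy
  rintro _ ⟨v, hv, rfl⟩
  choose h hh using fun j => hv ⟨j, rfl⟩
  obtain ⟨ε, -, -, he⟩ := F.exists_ιMulti_eq h
  have : v = fun j => F.τ (h j) := funext fun j => (hh j).symm
  rw [this, he, ← Int.cast_smul_eq_zsmul B]
  exact Submodule.smul_mem _ _ (Submodule.mem_span_singleton_self _)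

/-- The coordinates of 1-forms with respect to the `dx_i/x_i`. -/
noncomputable def coord : Ω[B⁄A] →ₗ[B] Fin m → B :=
  LinearMap.pi fun i => (F.δ i).liftKaehlerDifferential

theorem coord_τ (k : Fin m) : F.coord (F.τ k) = Pi.single k 1 := by
  funext i
  simp only [coord, LinearMap.pi_apply, τ, map_smul, Derivation.liftKaehlerDifferential_comp_D,
    F.δ_x, Pi.single_apply]
  split_ifs <;> simp

/-- The determinant in the coordinates `coord`, extended to the exterior algebra, is a `B`-linear
functional with value 1 at `vol`. -/
theorem smul_vol_eq_zero {b : B} (h : b • F.vol = 0) : b = 0 := by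
  let g : Forms A B →ₗ[B] B := ExteriorAlgebra.liftAlternating
    (Function.update 0 m (Matrix.detRowAlternating.compLinearMap F.coord))
  have hg : g F.vol = 1 := by
    change ExteriorAlgebra.liftAlternating _ (ExteriorAlgebra.ιMulti B m F.τ) = 1
    rw [ExteriorAlgebra.liftAlternating_apply_ιMulti, Function.update_self,
      AlternatingMap.compLinearMap_apply]
    have : (fun i => F.coord (F.τ i)) = (1 : Matrix (Fin m) (Fin m) B) := by
      funext i j
      rw [coord_τ, Matrix.one_apply, Pi.single_apply]
      simp only [eq_comm]
    change Matrix.det (fun i => F.coord (F.τ i)) = 1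
    rw [this, Matrix.det_one]
  simpa [hg] using congrArg g h

theorem nabla_vol (c : Fin m → B) (b : B) : Forms.nabla (∑ i, c i • F.τ i) (b • F.vol) = 0 := by
  refine (F.nabla_smul_ιMulti c id b).trans (Finset.sum_eq_zero fun i _ => ?_)
  rw [(ExteriorAlgebra.ιMulti B (m + 1) (M := Ω[B⁄A])).map_eq_zero_of_not_injective, smul_zero]
  intro h
  have := h (a₁ := 0) (a₂ := i.succ) (by simp)
  exact (Fin.succ_ne_zero i) this.symm

/-- The sum of the images of the operators `δ_i + c_i`. -/
noncomputable def imageSum (c : Fin m → B) : Submodule A B := ⨆ i, LinearMap.range (F.op c i)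

theorem op_mem (c : Fin m → B) (i : Fin m) (b : B) : F.op c i b ∈ F.imageSum c :=
  Submodule.mem_iSup_of_mem (p := fun i => LinearMap.range (F.op c i)) i ⟨b, rfl⟩

/-- On b times a product of m - 1 distinct dx_k/x_k, ∇ gives, up to sign, (δ_i + c_i) b times `vol`,
where i is the missing index. Uniqueness of the coefficient of `vol` then translates exactness of
forms into a statement about functions. -/
theorem smul_vol_mem_exact (c : Fin m → B) (b : B) :
    b • F.vol ∈ Forms.exact (∑ i, c i • F.τ i) m ↔ b ∈ F.imageSum c := by
  cases m with
  | zero =>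
    have h1 : F.imageSum c = ⊥ := by simp [imageSum]
    rw [h1]
    change b • F.vol = 0 ↔ b = 0
    exact ⟨F.smul_vol_eq_zero, fun h => by rw [h, zero_smul]⟩
  | succ m =>
    constructor
    · rintro ⟨y, hy, h⟩
      suffices hs : ∃ b' ∈ F.imageSum c, Forms.nabla (∑ i, c i • F.τ i) y = b' • F.vol by
        obtain ⟨b', hb', h'⟩ := hs
        have : b = b' := by
          rw [← sub_eq_zero]
          apply F.smul_vol_eq_zero
          rw [sub_smul, ← h', h, sub_self]
        rwa [this]
      have hy' : y ∈ ⋀[B]^m Ω[B⁄A] := hy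
      rw [← exteriorPower.ιMulti_span_fixedDegree_of_span_eq_top B m _ F.span_τ] at hy'
      refine Submodule.closure_induction (p := fun y _ =>
        ∃ b' ∈ F.imageSum c, Forms.nabla (∑ i, c i • F.τ i) y = b' • F.vol) ?_ ?_ ?_
        (x := y) hy'
      · exact ⟨0, zero_mem _, by simp⟩
      · rintro y z _ _ ⟨b1, h1, e1⟩ ⟨b2, h2, e2⟩
        exact ⟨b1 + b2, add_mem h1 h2, by rw [map_add, e1, e2, add_smul]⟩
      · rintro r _ ⟨v, hv, rfl⟩
        choose f hf using fun j => hv ⟨j, rfl⟩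
        have : v = fun j => F.τ (f j) := funext fun j => (hf j).symm
        rw [this, F.nabla_smul_ιMulti]
        choose ε _ _ he using fun i => F.exists_ιMulti_eq (Fin.cons i f)
        refine ⟨∑ i, F.op c i (ε i • r), Submodule.sum_mem _ fun i _ => F.op_mem c i _, ?_⟩
        rw [Finset.sum_smul]
        refine Finset.sum_congr rfl fun i _ => ?_
        rw [he, map_zsmul, smul_assoc, smul_comm]
    · intro hb
      refine Submodule.iSup_induction (fun i => LinearMap.range (F.op c i))
        (motive := fun b => b • F.vol ∈ Forms.exact (∑ i, c i • F.τ i) (m + 1)) hb ?_ ?_ ?_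
      · rintro i _ ⟨b, rfl⟩
        -- The preimage uses the product over all indices except i: wedging with dx_k/x_k for k ≠ i
        -- repeats a factor, so only the term of i survives, and the factor ε i in the witness
        -- cancels its sign.
        choose ε h0 h1 he using fun k => F.exists_ιMulti_eq (Fin.cons k (Fin.succAbove i))
        have hi : Function.Injective (Fin.cons i (Fin.succAbove i) : Fin (m + 1) → Fin (m + 1)) :=
          Fin.cons_injective_iff.2 ⟨by simp, Fin.succAbove_right_injective⟩
        refine ⟨(ε i • b) • ExteriorAlgebra.ιMulti B m (fun j => F.τ (i.succAbove j)),
          Submodule.smul_mem _ _ (ExteriorAlgebra.ιMulti_range B m ⟨_, rfl⟩), ?_⟩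
        rw [F.nabla_smul_ιMulti, Finset.sum_eq_single i]
        · rw [he, map_zsmul, smul_assoc, smul_comm, smul_smul, h1 i hi, one_smul]
        · intro k _ hk
          rw [he, h0 k, zero_smul, smul_zero]
          intro hk'
          obtain ⟨j, hj⟩ := Fin.exists_succAbove_eq hk
          exact (Fin.cons_injective_iff.1 hk').1 ⟨j, hj⟩
        · simp
      · rw [zero_smul]; exact zero_mem _
      · intro y z hy hz
        rw [add_smul]; exact add_mem hy hz

/-- The cohomology in the top degree is the quotient of `B` by the images of the `δ_i + c_i`. -/
noncomputable def topEquiv {c : Fin m → B} {η : Ω[B⁄A]} (hη : η = ∑ i, c i • F.τ i) :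
    (B ⧸ F.imageSum c) ≃ₗ[A] Forms.Cohomology η m :=
  let P := (Forms.exact η m).comap (Forms.closed η m).subtype
  let f : B →ₗ[A] Forms.Cohomology η m :=
    P.mkQ.comp (LinearMap.codRestrict (Forms.closed η m)
      ((LinearMap.toSpanSingleton B (Forms A B) F.vol).restrictScalars A)
      fun b => ⟨Submodule.smul_mem _ _ F.vol_mem, hη ▸ F.nabla_vol c b⟩)
  have hf : Function.Surjective f := fun y => by
    obtain ⟨y, rfl⟩ := Submodule.Quotient.mk_surjective _ y
    obtain ⟨b, hb⟩ := F.exists_eq_smul_vol y.2.1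
    exact ⟨b, congrArg P.mkQ (Subtype.ext hb.symm)⟩
  have hk : F.imageSum c = LinearMap.ker f := by
    ext b
    rw [← F.smul_vol_mem_exact, LinearMap.mem_ker, ← hη]
    exact (Submodule.Quotient.mk_eq_zero P (x := ⟨b • F.vol,
      Submodule.smul_mem _ _ F.vol_mem, hη ▸ F.nabla_vol c b⟩)).symm
  (Submodule.quotEquivOfEq _ _ hk).trans (f.quotKerEquivOfSurjective hf)

theorem topEquiv_mk {c : Fin m → B} {η : Ω[B⁄A]} (hη : η = ∑ i, c i • F.τ i) (b : B) :
    F.topEquiv hη (Submodule.Quotient.mk b) = Submodule.Quotient.mk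
      ⟨b • F.vol, Submodule.smul_mem _ _ F.vol_mem, hη ▸ F.nabla_vol c b⟩ := rfl

/-- Computing an operator on top cohomology thus reduces to its effect on multiples of `vol`, that
is, on coefficients. -/
theorem cohMap_topEquiv {K : Type} [CommRing K] [Algebra K A] [Algebra K B] [IsScalarTower K A B]
    {c : Fin m → B} {η : Ω[B⁄A]} (hη : η = ∑ i, c i • F.τ i) (T : Forms A B →ₗ[K] Forms A B)
    (hT : ∀ i x, x ∈ ⋀[B]^i Ω[B⁄A] → T x ∈ ⋀[B]^i Ω[B⁄A])
    (hT' : ∀ x, Forms.nabla η (T x) = T (Forms.nabla η x))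
    {b b' : B} (h : T (b • F.vol) = b' • F.vol) :
    Forms.cohMap η m T hT hT' (F.topEquiv hη (Submodule.Quotient.mk b)) =
      F.topEquiv hη (Submodule.Quotient.mk b') := by
  rw [topEquiv_mk, topEquiv_mk]
  exact congrArg Submodule.Quotient.mk (Subtype.ext h)

/-- A derivation that kills the x_i has a Lie derivative that kills each dx_i/x_i, so only the
coefficient is differentiated. -/
theorem lie_smul_vol {K : Type} [CommRing K] [Algebra K B] (θ : Derivation K B B)
    (hθ : ∀ a : A, ∃ a' : A, θ (algebraMap A B a) = algebraMap A B a')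
    (hx : ∀ i, θ (F.x i) = 0) (b : B) : Forms.lie θ hθ (b • F.vol) = θ b • F.vol := by
  have hτ : ∀ i, Forms.lie θ hθ (ExteriorAlgebra.ι B (F.τ i)) = 0 := fun i => by
    have h : θ (((F.x i)⁻¹ : Bˣ) : B) = 0 := by
      rw [θ.leibniz_of_mul_eq_one (b := (F.x i : B)) (by simp), hx, smul_zero]
    rw [ι_τ, Forms.lie_mul, Forms.lie_dd, Forms.lie_fn, hx, h]
    simp [Forms.dd]
  have hk : ∀ (k : ℕ) (f : Fin k → Fin m),
      Forms.lie θ hθ (ExteriorAlgebra.ιMulti B k (fun j => F.τ (f j))) = 0 := fun k => by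
    induction k with
    | zero =>
      intro f
      rw [ExteriorAlgebra.ιMulti_zero_apply]
      have := Forms.lie_fn θ hθ (1 : B)
      simpa using this
    | succ k ih =>
      intro f
      have h := F.ιMulti_cons (f 0) (Fin.tail f)
      rw [Fin.cons_self_tail] at h
      rw [h, Forms.lie_mul, ih, hτ, mul_zero, zero_mul, add_zero]
  rw [Algebra.smul_def, Forms.lie_mul, Forms.lie_fn,
    show Forms.lie θ hθ F.vol = 0 from hk m id, mul_zero, zero_add, ← Algebra.smul_def]

/-- A logarithmic differential does not change when its function is multiplied by a constant of `A`.
-/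
theorem pull_smul_vol (σ : B ≃ₐ[A] B) (s : Fin m → A) (hσ : ∀ i, σ (F.x i) = s i • (F.x i : B))
    (b : B) : Forms.pull σ (b • F.vol) = σ b • F.vol := by
  have hτ : ∀ i, Forms.pull σ (ExteriorAlgebra.ι B (F.τ i)) =
      ExteriorAlgebra.ι B (F.τ i) := fun i => by
    have h1 : σ (((F.x i)⁻¹ : Bˣ) : B) * σ (F.x i) = 1 := by rw [← map_mul]; simp
    have h : σ (((F.x i)⁻¹ : Bˣ) : B) * algebraMap A B (s i) = (((F.x i)⁻¹ : Bˣ) : B) := by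
      rw [hσ, Algebra.smul_def, ← mul_assoc] at h1
      exact Units.eq_inv_of_mul_eq_one_left ((mul_comm _ _).trans h1)
    rw [ι_τ, Forms.pull_mul, Forms.pull_fn, Forms.pull_dd, hσ, Algebra.smul_def, Forms.dd_mul,
      Forms.dd_algebraMap, mul_zero, add_zero, ← mul_assoc, ← Forms.fn_mul, h]
  have hk : ∀ (k : ℕ) (f : Fin k → Fin m),
      Forms.pull σ (ExteriorAlgebra.ιMulti B k (fun j => F.τ (f j))) =
        ExteriorAlgebra.ιMulti B k (fun j => F.τ (f j)) := fun k => by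
    induction k with
    | zero =>
      intro f
      rw [ExteriorAlgebra.ιMulti_zero_apply]
      have := Forms.pull_fn σ (1 : B)
      simpa using this
    | succ k ih =>
      intro f
      have h := F.ιMulti_cons (f 0) (Fin.tail f)
      rw [Fin.cons_self_tail] at h
      rw [h, Forms.pull_mul, ih, hτ]
  rw [Algebra.smul_def, Forms.pull_mul, Forms.pull_fn,
    show Forms.pull σ F.vol = F.vol from hk m id, ← Algebra.smul_def]

end LogFrame

/-! ### Rational convex geometry: Farkas' lemma and extremal forms. -/

section Cone

open Matrix

/-- Induction on the number of generators: if the form that separates b from the earlier generators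
is negative at the last one, project along that generator and use the induction hypothesis there.
Rational coefficients are what the later rounding and clearing of denominators need. -/
theorem farkas {n : ℕ} (N : ℕ) (a : Fin N → Fin n → ℚ) (b : Fin n → ℚ) :
    (∃ t : Fin N → ℚ, (∀ j, 0 ≤ t j) ∧ b = ∑ j, t j • a j) ∨
      ∃ y : Fin n → ℚ, (∀ j, 0 ≤ y ⬝ᵥ a j) ∧ y ⬝ᵥ b < 0 := by
  induction N generalizing b with
  | zero =>
    by_cases hb : b = 0
    · exact .inl ⟨0, fun j => j.elim0, by simp [hb]⟩
    · refine .inr ⟨-b, fun j => j.elim0, ?_⟩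
      rw [neg_dotProduct, neg_lt_zero]
      exact lt_of_le_of_ne (Finset.sum_nonneg fun i _ => mul_self_nonneg _)
        fun h => hb (dotProduct_self_eq_zero.1 h.symm)
  | succ N ih =>
    rcases ih (fun j => a j.castSucc) b with ⟨t, ht, h⟩ | ⟨y₀, h₀, hb₀⟩
    · refine .inl ⟨Fin.snoc t 0, fun j => ?_, ?_⟩
      · refine Fin.lastCases ?_ (fun j => ?_) j <;> simp [ht]
      · simp [Fin.sum_univ_castSucc, ← h]
    by_cases hl : 0 ≤ y₀ ⬝ᵥ a (Fin.last N)
    · exact .inr ⟨y₀, fun j => Fin.lastCases hl h₀ j, hb₀⟩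
    push Not at hl
    set v := a (Fin.last N)
    obtain ⟨s, hs, hsv⟩ : ∃ s : ℚ, 0 < s ∧ s * (y₀ ⬝ᵥ v) = -1 :=
      ⟨-(y₀ ⬝ᵥ v)⁻¹, by simpa using hl, by rw [neg_mul, inv_mul_cancel₀ hl.ne]⟩
    have hyv : (s • y₀) ⬝ᵥ v = -1 := by rw [smul_dotProduct, smul_eq_mul, hsv]
    have hya : ∀ j : Fin N, 0 ≤ (s • y₀) ⬝ᵥ a j.castSucc := fun j => by
      rw [smul_dotProduct]; exact mul_nonneg hs.le (h₀ j)
    have hyb : (s • y₀) ⬝ᵥ b < 0 := by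
      rw [smul_dotProduct]; exact mul_neg_of_pos_of_neg hs hb₀
    generalize s • y₀ = y at hyv hya hyb
    -- With y(v) = -1, the map w ↦ w + y(w) v is the projection along v onto the kernel of y. A
    -- positive solution for the projections lifts with coefficient ∑ t_j y(a_j) - y(b) ≥ 0 at v; a
    -- separating form z lifts to z + z(v) y, the composite of z with the projection.
    rcases ih (fun j => a j.castSucc + (y ⬝ᵥ a j.castSucc) • v) (b + (y ⬝ᵥ b) • v) with
      ⟨t, ht, h⟩ | ⟨z, hz, hzb⟩
    · refine .inl ⟨Fin.snoc t ((∑ j, t j * (y ⬝ᵥ a j.castSucc)) - y ⬝ᵥ b), fun j => ?_, ?_⟩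
      · refine Fin.lastCases ?_ (fun j => ?_) j
        · rw [Fin.snoc_last]
          have := Finset.sum_nonneg fun j (_ : j ∈ Finset.univ) => mul_nonneg (ht j) (hya j)
          linarith
        · simp [ht]
      · rw [Fin.sum_univ_castSucc]
        simp only [Fin.snoc_castSucc, Fin.snoc_last, sub_smul, Finset.sum_smul]
        have h' := eq_sub_of_add_eq h
        simp only [smul_add, Finset.sum_add_distrib, ← mul_smul] at h'
        exact h'.trans (add_sub_assoc _ _ _)
    · refine .inr ⟨z + (z ⬝ᵥ v) • y, fun j => ?_, ?_⟩
      · refine Fin.lastCases ?_ (fun j => ?_) j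
        · change 0 ≤ _ ⬝ᵥ v
          rw [add_dotProduct, smul_dotProduct, hyv, smul_eq_mul]
          simp
        · have := hz j
          rw [dotProduct_add, dotProduct_smul, smul_eq_mul] at this
          rw [add_dotProduct, smul_dotProduct, smul_eq_mul]
          linarith
      · rw [dotProduct_add, dotProduct_smul, smul_eq_mul] at hzb
        rw [add_dotProduct, smul_dotProduct, smul_eq_mul]
        linarith

/-- A linear form that is nonnegative on the `a_j` and negative at `b` can be chosen so that it is
determined up to a factor by the `a_j` at which it vanishes. -/
theorem exists_extremal_form {n N : ℕ} (a : Fin N → Fin n → ℚ) (b : Fin n → ℚ)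
    (ha : ∀ y : Fin n → ℚ, (∀ j, y ⬝ᵥ a j = 0) → y = 0)
    (hy : ∃ y : Fin n → ℚ, (∀ j, 0 ≤ y ⬝ᵥ a j) ∧ y ⬝ᵥ b < 0) :
    ∃ y : Fin n → ℚ, (∀ j, 0 ≤ y ⬝ᵥ a j) ∧ y ⬝ᵥ b < 0 ∧
      ∀ z : Fin n → ℚ, (∀ j, y ⬝ᵥ a j = 0 → z ⬝ᵥ a j = 0) → ∃ r : ℚ, z = r • y := by
  by_contra! hcon
  -- If no admissible form were extremal, an admissible form could always be tilted so as to vanish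
  -- at one more generator while keeping its old zeros; this is absurd beyond N zeros.
  have key : ∀ k : ℕ, ∃ y : Fin n → ℚ, (∀ j, 0 ≤ y ⬝ᵥ a j) ∧ y ⬝ᵥ b < 0 ∧
      k ≤ (Finset.univ.filter fun j => y ⬝ᵥ a j = 0).card := fun k => by
    induction k with
    | zero => obtain ⟨y, h1, h2⟩ := hy; exact ⟨y, h1, h2, Nat.zero_le _⟩
    | succ k ih =>
      obtain ⟨y, h1, h2, h3⟩ := ih
      obtain ⟨z, hz, hzy⟩ := hcon y h1 h2
      obtain ⟨w, hw, hwb, j, hj⟩ : ∃ w : Fin n → ℚ, (∀ j, y ⬝ᵥ a j = 0 → w ⬝ᵥ a j = 0) ∧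
          w ⬝ᵥ b = 0 ∧ ∃ j, w ⬝ᵥ a j < 0 := by
        -- Subtracting a multiple of y makes w vanish at b, so moving y in the direction of w does
        -- not affect y(b) < 0.
        set w := z - (z ⬝ᵥ b / y ⬝ᵥ b) • y with hw
        have hw1 : ∀ j, y ⬝ᵥ a j = 0 → w ⬝ᵥ a j = 0 := fun j h => by
          rw [hw, sub_dotProduct, smul_dotProduct, h, hz j h]; simp
        have hw2 : w ⬝ᵥ b = 0 := by
          rw [hw, sub_dotProduct, smul_dotProduct, smul_eq_mul, div_mul_cancel₀ _ h2.ne, sub_self]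
        have hw3 : ∃ j, w ⬝ᵥ a j ≠ 0 := by
          by_contra! h
          exact hzy _ (sub_eq_zero.1 (ha w h))
        obtain ⟨j, hj⟩ := hw3
        rcases lt_or_gt_of_ne hj with h | h
        · exact ⟨w, hw1, hw2, j, h⟩
        · exact ⟨-w, fun j h => by rw [neg_dotProduct, hw1 j h, neg_zero],
            by rw [neg_dotProduct, hw2, neg_zero], j, by rw [neg_dotProduct]; linarith⟩
      obtain ⟨j₀, hj₀, hmin⟩ := Finset.exists_min_image
        (Finset.univ.filter fun j => w ⬝ᵥ a j < 0) (fun j => y ⬝ᵥ a j / -(w ⬝ᵥ a j)) ⟨j, by simpa⟩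
      rw [Finset.mem_filter] at hj₀
      -- The largest t for which y + t w stays nonnegative on all generators; the minimum is
      -- attained at j₀, which becomes a new zero.
      set t := y ⬝ᵥ a j₀ / -(w ⬝ᵥ a j₀) with ht
      have ht0 : 0 ≤ t := div_nonneg (h1 _) (by linarith [hj₀.2])
      have hd : ∀ v, (y + t • w) ⬝ᵥ v = y ⬝ᵥ v + t * (w ⬝ᵥ v) := fun v => by
        rw [add_dotProduct, smul_dotProduct, smul_eq_mul]
      refine ⟨y + t • w, fun j => ?_, by rw [hd, hwb]; linarith, ?_⟩
      · rw [hd]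
        by_cases hj : w ⬝ᵥ a j < 0
        · have := hmin j (by simpa)
          rw [le_div_iff₀ (by linarith)] at this
          linarith
        · exact add_nonneg (h1 j) (mul_nonneg ht0 (not_lt.1 hj))
      · refine h3.trans_lt (Finset.card_lt_card ⟨fun j hj => ?_, fun h => ?_⟩)
        · simp only [Finset.mem_filter, Finset.mem_univ, true_and] at hj ⊢
          rw [hd, hj, hw j hj]; simp
        · have : j₀ ∈ Finset.univ.filter fun j => y ⬝ᵥ a j = 0 := h (by
            simp only [Finset.mem_filter, Finset.mem_univ, true_and]
            rw [hd, ht]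
            field_simp [hj₀.2.ne]
            ring)
          simp only [Finset.mem_filter, Finset.mem_univ, true_and] at this
          exact hj₀.2.ne (hw _ this)
  obtain ⟨y, -, -, h⟩ := key (N + 1)
  have := Finset.card_filter_le (Finset.univ : Finset (Fin N)) fun j => y ⬝ᵥ a j = 0
  rw [Finset.card_univ, Fintype.card_fin] at this
  omega

/-- Clear denominators and divide by the gcd. The factor is positive so that sign conditions pass
from y to c. -/
theorem exists_primitive_multiple {n : ℕ} (y : Fin n → ℚ) (hy : y ≠ 0) :
    ∃ (c : Fin n → ℤ) (r : ℚ), 0 < r ∧ Finset.univ.gcd c = 1 ∧ ∀ i, (c i : ℚ) = r * y i := by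
  obtain ⟨i₀, hi₀⟩ := Function.ne_iff.1 hy
  set d : ℕ := ∏ i, (y i).den
  have hd : 0 < d := Finset.prod_pos fun i _ => (y i).den_pos
  have hz : ∀ i, ∃ z : ℤ, (z : ℚ) = d * y i := fun i => by
    obtain ⟨e, he⟩ : (y i).den ∣ d := Finset.dvd_prod_of_mem (fun i => (y i).den) (Finset.mem_univ i)
    refine ⟨(y i).num * e, ?_⟩
    push_cast
    rw [he, Nat.cast_mul, mul_right_comm, Rat.den_mul_eq_num]
  choose z hz using hz
  obtain ⟨c, hc, hg⟩ := Finset.extract_gcd z (s := Finset.univ) ⟨i₀, Finset.mem_univ _⟩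
  have hg0 : (0 : ℤ) < Finset.univ.gcd z := by
    refine lt_of_le_of_ne (Int.le_of_lt_add_one ?_) fun h => ?_
    · have := Int.nonneg_of_normalize_eq_self (Finset.normalize_gcd (s := Finset.univ) (f := z))
      omega
    · have := (Finset.gcd_eq_zero_iff.1 h.symm) i₀ (Finset.mem_univ _)
      have h2 := hz i₀
      rw [this, Int.cast_zero, zero_eq_mul] at h2
      rcases h2 with h2 | h2
      · exact hd.ne' (by exact_mod_cast h2)
      · exact hi₀ h2
  have hg0' : (0 : ℚ) < Finset.univ.gcd z := by exact_mod_cast hg0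
  refine ⟨c, d / Finset.univ.gcd z, by positivity, hg, fun i => ?_⟩
  rw [div_mul_eq_mul_div, eq_div_iff hg0'.ne', ← hz, hc i (Finset.mem_univ i)]
  push_cast
  ring

/-- If the rational vectors that are orthogonal to some integral vectors are the multiples of `y`,
then so are the real ones. -/
theorem real_multiple_of_rat_multiple {n N : ℕ} (a : Fin N → Fin n → ℤ) (y : Fin n → ℚ)
    (hy : y ≠ 0) (J : Fin N → Prop)
    (h : ∀ z : Fin n → ℚ, (∀ j, J j → ∑ i, z i * a j i = 0) → ∃ r : ℚ, z = r • y)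
    (z : Fin n → ℝ) (hz : ∀ j, J j → ∑ i, z i * a j i = 0) : ∃ r : ℝ, ∀ i, z i = r * y i := by
  obtain ⟨i₀, hi₀⟩ := Function.ne_iff.1 hy
  have hi₀' : (y i₀ : ℝ) ≠ 0 := by exact_mod_cast hi₀
  refine ⟨z i₀ / y i₀, fun i => ?_⟩
  rw [div_mul_eq_mul_div, eq_div_iff hi₀', ← sub_eq_zero,
    ← Module.forall_dual_apply_eq_zero_iff ℚ]
  -- ℚ-linear functionals ℝ → ℚ separate points, and applying one to each coordinate of a real
  -- solution gives a rational solution, to which the hypothesis applies.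
  intro φ
  have hφ : ∀ (q : ℚ) (x : ℝ), φ (x * q) = φ x * q := fun q x => by
    rw [mul_comm, ← Rat.smul_def, map_smul, smul_eq_mul, mul_comm]
  obtain ⟨r, hr⟩ := h (fun i => φ (z i)) fun j hj => by
    have := congrArg φ (hz j hj)
    rw [map_sum, map_zero] at this
    rw [← this]
    refine Finset.sum_congr rfl fun i _ => ?_
    have h1 := hφ (a j i) (z i)
    rw [Rat.cast_intCast] at h1
    exact h1.symm
  have hr' : ∀ i, φ (z i) = r * y i := fun i => congrFun hr i
  rw [map_sub, hφ, hφ, hr', hr']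
  ring

end Cone

/-! ### Facet forms of the cone. -/

section Facets

variable {n N : ℕ} (a : Fin N → Fin n → ℤ)

/-- The face c = 0 spans the kernel of c: a real functional that vanishes on the face vanishes at
the generators in it, so it is a multiple of c and vanishes on the whole kernel. The dimension is
then n - 1. -/
theorem isFacetForm_of_extremal (c : Fin n → ℤ) (hc : Finset.univ.gcd c = 1)
    (hn : ∀ j, 0 ≤ ∑ i, c i * a j i) (hc0 : c ≠ 0)
    (h : ∀ z : Fin n → ℚ, (∀ j, ∑ i, c i * a j i = 0 → ∑ i, z i * a j i = 0) →
      ∃ r : ℚ, z = r • fun i => (c i : ℚ)) : IsFacetForm a c := by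
  have hpair : ∀ t : Fin N → ℝ, ∑ i, (c i : ℝ) * (∑ j, t j • fun i => (a j i : ℝ)) i =
      ∑ j, t j * ((∑ i, c i * a j i : ℤ) : ℝ) := fun t => by
    simp only [Finset.sum_apply, Pi.smul_apply, smul_eq_mul, Finset.mul_sum]
    rw [Finset.sum_comm]
    refine Finset.sum_congr rfl fun j _ => ?_
    push_cast
    rw [Finset.mul_sum]
    exact Finset.sum_congr rfl fun i _ => by ring
  refine ⟨hc, ?_, ?_⟩
  · rintro v ⟨t, ht, rfl⟩
    rw [hpair]
    exact Finset.sum_nonneg fun j _ => mul_nonneg (ht j) (by exact_mod_cast hn j)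
  · let ℓ : Module.Dual ℝ (Fin n → ℝ) := ∑ i, (c i : ℝ) • LinearMap.proj i
    have hℓ : ∀ v, ℓ v = ∑ i, (c i : ℝ) * v i := fun v => by simp [ℓ]
    have hℓ0 : ℓ ≠ 0 := fun h0 => hc0 (funext fun i => by
      have := hℓ (Pi.single i 1)
      rw [h0] at this
      simpa [Pi.single_apply, eq_comm] using this)
    have hs : Submodule.span ℝ {v | v ∈ cone a ∧ ∑ i, (c i : ℝ) * v i = 0} = LinearMap.ker ℓ := by
      refine le_antisymm (Submodule.span_le.2 fun v hv => ?_) fun v hv => ?_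
      · rw [SetLike.mem_coe, LinearMap.mem_ker, hℓ]; exact hv.2
      · by_contra hv'
        obtain ⟨f, hfv, hf⟩ := Submodule.exists_le_ker_of_notMem hv'
        have hfe : ∀ w, f w = ∑ i, f (Pi.single i 1) * w i := fun w => by
          conv_lhs => rw [pi_eq_sum_univ' w]
          simp [mul_comm]
        obtain ⟨r, hr⟩ := real_multiple_of_rat_multiple a (fun i => (c i : ℚ))
          (fun h0 => hc0 (funext fun i => by simpa using congrFun h0 i))
          (fun j => ∑ i, c i * a j i = 0) h (fun i => f (Pi.single i 1)) fun j hj => by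
            have hm : (fun i => (a j i : ℝ)) ∈
                Submodule.span ℝ {v | v ∈ cone a ∧ ∑ i, (c i : ℝ) * v i = 0} := by
              refine Submodule.subset_span ⟨⟨Pi.single j 1, fun k => ?_, ?_⟩, ?_⟩
              · rw [Pi.single_apply]; split_ifs <;> simp
              · rw [Finset.sum_eq_single j]
                · simp
                · intro k _ hk; simp [hk]
                · simp
              · simp only
                exact_mod_cast hj
            have := hf hm
            rw [LinearMap.mem_ker, hfe] at this
            exact this
        apply hfv
        rw [hfe]
        simp only [hr, mul_assoc, ← Finset.mul_sum, Rat.cast_intCast]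
        rw [LinearMap.mem_ker, hℓ] at hv
        rw [hv, mul_zero]
    rw [hs]
    simpa using Module.Dual.finrank_ker_add_one_of_ne_zero hℓ0

/-- The integral points of `C(A)` are cut out by finitely many forms that define facets. -/
theorem exists_facetForms (ha : AddSubgroup.closure (Set.range a) = ⊤) :
    ∃ C : Finset (Fin n → ℤ), (∀ c ∈ C, IsFacetForm a c) ∧
      ∀ u : Fin n → ℤ, (∀ c ∈ C, 0 ≤ ∑ i, c i * u i) →
        ∃ t : Fin N → ℚ, (∀ j, 0 ≤ t j) ∧ ∀ i, (u i : ℚ) = ∑ j, t j * a j i := by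
  classical
  have hspan : ∀ y : Fin n → ℚ, (∀ j, ∑ i, y i * a j i = 0) → y = 0 := fun y hy => by
    have h : ∀ u : Fin n → ℤ, ∑ i, y i * u i = 0 := fun u => by
      have hu : u ∈ AddSubgroup.closure (Set.range a) := ha ▸ AddSubgroup.mem_top _
      induction hu using AddSubgroup.closure_induction with
      | mem u hu => obtain ⟨j, rfl⟩ := hu; exact hy j
      | zero => simp
      | add u v _ _ hu hv => simp [mul_add, Finset.sum_add_distrib, hu, hv]
      | neg u _ hu => simp [Finset.sum_neg_distrib, hu]
    funext i
    simpa [Pi.single_apply] using h (Pi.single i 1)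
  -- One form is chosen for each subset J of generators for which some facet form spans all forms
  -- that vanish on J. There are only finitely many J, so the family is finite.
  let P : Finset (Fin N) → (Fin n → ℤ) → Prop := fun J c => IsFacetForm a c ∧
    (∀ j, 0 ≤ ∑ i, c i * a j i) ∧
    ∀ z : Fin n → ℚ, (∀ j ∈ J, ∑ i, z i * a j i = 0) → ∃ r : ℚ, z = r • fun i => (c i : ℚ)
  let F : Finset (Fin N) → Fin n → ℤ := fun J => if h : ∃ c, P J c then h.choose else 0
  have hF : ∀ J, (∃ c, P J c) → P J (F J) := fun J h => by
    simp only [F, dif_pos h]; exact h.choose_spec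
  refine ⟨(Finset.univ.filter fun J => ∃ c, P J c).image F, fun c hc => ?_, fun u hu => ?_⟩
  · obtain ⟨J, hJ, rfl⟩ := Finset.mem_image.1 hc
    exact (hF J (Finset.mem_filter.1 hJ).2).1
  · rcases farkas N (fun j i => (a j i : ℚ)) (fun i => (u i : ℚ)) with ⟨t, ht, h⟩ | h
    · refine ⟨t, ht, fun i => ?_⟩
      simpa using congrFun h i
    · exfalso
      obtain ⟨y, h1, h2, h3⟩ := exists_extremal_form _ _ hspan h
      have hy0 : y ≠ 0 := fun h0 => by simp [h0] at h2
      obtain ⟨c, r, hr, hg, hc⟩ := exists_primitive_multiple y hy0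
      have hcy : ∀ v : Fin n → ℤ, ((∑ i, c i * v i : ℤ) : ℚ) = r * ∑ i, y i * v i := fun v => by
        push_cast
        rw [Finset.mul_sum]
        exact Finset.sum_congr rfl fun i _ => by rw [hc, mul_assoc]
      have hcn : ∀ j, 0 ≤ ∑ i, c i * a j i := fun j => by
        have : (0 : ℚ) ≤ (∑ i, c i * a j i : ℤ) := by
          rw [hcy]; exact mul_nonneg hr.le (h1 j)
        exact_mod_cast this
      have hcz : ∀ j, ∑ i, c i * a j i = 0 ↔ ∑ i, y i * a j i = 0 := fun j => by
        rw [← Int.cast_eq_zero (α := ℚ), hcy, mul_eq_zero, or_iff_right hr.ne']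
      have hmul : ∀ z : Fin n → ℚ, (∀ j, ∑ i, y i * a j i = 0 → ∑ i, z i * a j i = 0) →
          ∃ r : ℚ, z = r • fun i => (c i : ℚ) := fun z hz => by
        obtain ⟨s, rfl⟩ := h3 z hz
        refine ⟨s / r, funext fun i => ?_⟩
        simp only [Pi.smul_apply, smul_eq_mul, hc]
        field_simp
      have hc0 : c ≠ 0 := fun h0 => hy0 (funext fun i => by
        have := hc i
        rw [h0] at this
        simpa [hr.ne'] using this)
      have hfac : IsFacetForm a c := isFacetForm_of_extremal a c hg hcn hc0
        fun z hz => hmul z fun j hj => hz j ((hcz j).2 hj)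
      set J := Finset.univ.filter fun j => ∑ i, y i * a j i = 0 with hJ
      have hP : ∃ c, P J c := ⟨c, hfac, hcn, fun z hz => hmul z fun j hj => hz j (by simp [hJ, hj])⟩
      obtain ⟨-, hn, hm⟩ := hF J hP
      have hu' := hu (F J) (Finset.mem_image.2 ⟨J, by simpa using hP, rfl⟩)
      -- A point outside the cone is separated by an extremal y. Since y vanishes on its own zero
      -- set J, it is a multiple of the form chosen for J, with s > 0 because both are nonnegative
      -- on A and y is not zero there. So the chosen form is already negative at u.
      obtain ⟨s, hs⟩ := hm y fun j hj => by simpa [hJ] using hj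
      have hys : ∀ v : Fin n → ℤ, ∑ i, y i * v i = s * ((∑ i, F J i * v i : ℤ) : ℚ) := fun v => by
        push_cast
        rw [Finset.mul_sum]
        refine Finset.sum_congr rfl fun i _ => ?_
        rw [hs]; simp [mul_assoc]
      have hspos : 0 < s := by
        obtain ⟨j, hj⟩ : ∃ j, ∑ i, y i * a j i ≠ 0 := by
          by_contra! h; exact hy0 (hspan y h)
        have h4 : 0 < ∑ i, y i * a j i := lt_of_le_of_ne (h1 j) hj.symm
        rw [hys] at h4
        exact pos_of_mul_pos_left h4 (by exact_mod_cast hn j)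
      have h5 : ∑ i, y i * u i < 0 := h2
      rw [hys] at h5
      have : (0 : ℚ) ≤ (∑ i, F J i * u i : ℤ) := by exact_mod_cast hu'
      exact absurd h5 (not_lt.2 (mul_nonneg hspos.le this))

end Facets


/-! ### Lattice points deep inside the cone lie in the semigroup. -/

section Conductor

variable {n N : ℕ} (a : Fin N → Fin n → ℤ)

/-- The map `q ↦ ∑ q_j a^{(j)}`, whose image is the semigroup `ℕA`. -/
def expSum : (Fin N →₀ ℕ) →+ (Fin n → ℤ) where
  toFun q := ∑ j, q j • a j
  map_zero' := by simp
  map_add' p q := by simp [add_smul, Finset.sum_add_distrib]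

theorem expSum_apply (q : Fin N →₀ ℕ) : expSum a q = ∑ j, q j • a j := rfl

theorem expSum_single (j : Fin N) : expSum a (Finsupp.single j 1) = a j := by
  rw [expSum_apply, Finset.sum_eq_single j]
  · simp
  · intro k _ hk; simp [hk.symm]
  · simp

theorem exists_expSum_add (ha : AddSubgroup.closure (Set.range a) = ⊤) (u : Fin n → ℤ) :
    ∃ p q, expSum a p + u = expSum a q := by
  have hu : u ∈ AddSubgroup.closure (Set.range a) := ha ▸ AddSubgroup.mem_top _
  induction hu using AddSubgroup.closure_induction with
  | mem u hu =>
    obtain ⟨j, rfl⟩ := hu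
    exact ⟨0, Finsupp.single j 1, by rw [map_zero, zero_add, expSum_single]⟩
  | zero => exact ⟨0, 0, by simp⟩
  | add u v _ _ hu hv =>
    obtain ⟨p, q, h⟩ := hu
    obtain ⟨p', q', h'⟩ := hv
    exact ⟨p + p', q + q', by rw [map_add, map_add, ← h, ← h']; abel⟩
  | neg u _ hu =>
    obtain ⟨p, q, h⟩ := hu
    exact ⟨q, p, by rw [← h]; abel⟩

/-- The semigroup `ℕA` contains all the integral points that are far inside `C(A)`. -/
theorem exists_conductor (ha : AddSubgroup.closure (Set.range a) = ⊤) :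
    ∃ C : Finset (Fin n → ℤ), (∀ c ∈ C, IsFacetForm a c) ∧
      ∃ k : ℤ, ∀ u : Fin n → ℤ, (∀ c ∈ C, k ≤ ∑ i, c i * u i) → u ∈ Set.range (expSum a) := by
  obtain ⟨C, hC, hcone⟩ := exists_facetForms a ha
  choose p q hpq using exists_expSum_add a ha
  -- The box from -M to M contains every lattice point ∑ t_j a_j with 0 ≤ t_j < 1. Each r in it is a
  -- difference q - p of elements of ℕA; adding up all the p gives one b for which b + r lies in ℕA
  -- for every r in the box.
  let M : Fin n → ℤ := fun i => ∑ j, |a j i|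
  let b := ∑ r ∈ Finset.Icc (-M) M, p r
  have hb : ∀ r ∈ Finset.Icc (-M) M, ∃ s, expSum a b + r = expSum a s := fun r hr => by
    refine ⟨(∑ r ∈ (Finset.Icc (-M) M).erase r, p r) + q r, ?_⟩
    rw [map_add, ← hpq, ← add_assoc, ← map_add, Finset.sum_erase_add _ _ hr]
  -- This bound dominates every form in `C` at b, so u - b still lies in the cone.
  refine ⟨C, hC, ∑ c ∈ C, |∑ i, c i * expSum a b i|, fun u hu => ?_⟩
  obtain ⟨t, ht, h⟩ := hcone (u - expSum a b) fun c hc => by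
    have h1 := hu c hc
    have h2 := Finset.single_le_sum (f := fun c : Fin n → ℤ => |∑ i, c i * expSum a b i|)
      (fun c _ => abs_nonneg _) hc
    have h3 := le_abs_self (∑ i, c i * expSum a b i)
    simp only [Pi.sub_apply, mul_sub, Finset.sum_sub_distrib]
    linarith
  -- Integer parts give an element of ℕA; the fractional parts leave a lattice point r of the box,
  -- and b + r lies in ℕA.
  let fl : Fin N →₀ ℕ := Finsupp.equivFunOnFinite.symm fun j => ⌊t j⌋.toNat
  have hfl : ∀ j, ((fl j : ℤ) : ℚ) = ⌊t j⌋ := fun j => by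
    have : (fl j : ℤ) = ⌊t j⌋ := Int.toNat_of_nonneg (Int.floor_nonneg.2 (ht j))
    rw [this]
  obtain ⟨s, hs⟩ := hb (u - expSum a b - expSum a fl) (by
    have hr : ∀ i, |((u - expSum a b - expSum a fl) i : ℚ)| ≤ (M i : ℚ) := fun i => by
      have : ((u - expSum a b - expSum a fl) i : ℚ) = ∑ j, Int.fract (t j) * a j i := by
        have h1 : ((u - expSum a b - expSum a fl) i : ℚ) =
            ((u - expSum a b) i : ℚ) - (expSum a fl i : ℤ) := by simp
        rw [h1, h i, expSum_apply, Finset.sum_apply, Int.cast_sum, ← Finset.sum_sub_distrib]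
        refine Finset.sum_congr rfl fun j _ => ?_
        rw [Pi.smul_apply, nsmul_eq_mul, Int.cast_mul, hfl, ← Int.self_sub_floor]
        ring
      rw [this]
      refine (Finset.abs_sum_le_sum_abs _ _).trans ?_
      push_cast [M]
      refine Finset.sum_le_sum fun j _ => ?_
      rw [abs_mul, Int.abs_fract]
      exact mul_le_of_le_one_left (abs_nonneg _) (Int.fract_lt_one _).le
    rw [Finset.mem_Icc]
    constructor <;> intro i <;> have := abs_le.1 (hr i)
    · exact_mod_cast this.1
    · exact_mod_cast this.2)
  exact ⟨s + fl, by rw [map_add, ← hs]; abel⟩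

end Conductor

/-! ### Differential operators on Laurent polynomials conjugated by e^f. -/

namespace Laurent

variable {N n : ℕ}

/-- The `ℂ[λ]`-linear map on Laurent polynomials with given values at the monomials. -/
noncomputable def linLift {M : Type*} [AddCommGroup M] [Module (PolyRing N) M]
    (φ : (Fin n → ℤ) → M) : Laurent N n →ₗ[PolyRing N] M :=
  (Finsupp.linearCombination (PolyRing N) φ).comp
    (AddMonoidAlgebra.coeffLinearEquiv (PolyRing N)).toLinearMap

theorem linLift_single {M : Type*} [AddCommGroup M] [Module (PolyRing N) M]
    (φ : (Fin n → ℤ) → M) (u : Fin n → ℤ) (p : PolyRing N) :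
    linLift φ (AddMonoidAlgebra.single u p) = p • φ u :=
  Finsupp.linearCombination_single _ _ _

/-- The derivation `∑ c_i x_i ∂/∂x_i`. -/
noncomputable def toricLin (c : Fin n → ℂ) : Laurent N n →ₗ[PolyRing N] Laurent N n :=
  linLift fun u => (∑ i, c i * u i) • mon u

theorem toricLin_single (c : Fin n → ℂ) (u : Fin n → ℤ) (p : PolyRing N) :
    toricLin c (AddMonoidAlgebra.single u p) =
      (∑ i, c i * u i) • AddMonoidAlgebra.single u p := by
  rw [toricLin, linLift_single, smul_comm]
  simp

/-- The derivation `∑ c_i x_i ∂/∂x_i`. -/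
noncomputable def toric (c : Fin n → ℂ) : Derivation (PolyRing N) (Laurent N n) (Laurent N n) :=
  Derivation.mk' (toricLin c) (fun p q => by
    induction p using AddMonoidAlgebra.induction_linear with
    | zero => simp
    | add p p' h h' =>
      simp only [add_mul, map_add, h, h', smul_eq_mul, mul_add]
      ring
    | single u p =>
      induction q using AddMonoidAlgebra.induction_linear with
      | zero => simp
      | add q q' h h' =>
        simp only [mul_add, map_add, h, h', smul_eq_mul, add_mul]
        ring
      | single v q =>
        simp only [AddMonoidAlgebra.single_mul_single, toricLin_single, smul_eq_mul, mul_smul_comm,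
          ← add_smul, add_comm v u, mul_comm q p, Pi.add_apply, Int.cast_add, mul_add,
          Finset.sum_add_distrib]
        rw [add_comm])

theorem toric_single (c : Fin n → ℂ) (u : Fin n → ℤ) (p : PolyRing N) :
    toric c (AddMonoidAlgebra.single u p) =
      (∑ i, c i * u i) • AddMonoidAlgebra.single u p := toricLin_single c u p

theorem toric_smul (c : Fin n → ℂ) (r : ℂ) (w : Laurent N n) :
    toric c (r • w) = r • toric c w := by
  rw [← algebraMap_smul (PolyRing N) r w, Derivation.map_smul, algebraMap_smul]

theorem toric_comm (c c' : Fin n → ℂ) (w : Laurent N n) :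
    toric c (toric c' w) = toric c' (toric c w) := by
  induction w using AddMonoidAlgebra.induction_linear with
  | zero => simp
  | add p q hp hq => simp only [map_add, hp, hq]
  | single u p => simp only [toric_single, toric_smul, smul_smul, mul_comm]

theorem toric_eq_sum (c : Fin n → ℂ) (w : Laurent N n) :
    toric c w = ∑ i, c i • toric (Pi.single i 1) w := by
  induction w using AddMonoidAlgebra.induction_linear with
  | zero => simp
  | add p q hp hq => simp only [map_add, hp, hq, smul_add, Finset.sum_add_distrib]
  | single u p =>
    simp only [toric_single, smul_smul, ← Finset.sum_smul]
    simp [Pi.single_apply]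

theorem toric_coefLin (c : Fin n → ℂ) (j : Fin N) (w : Laurent N n) :
    toric c (coefLin n j w) = coefLin n j (toric c w) := by
  induction w using AddMonoidAlgebra.induction_linear with
  | zero => simp
  | add p q hp hq => simp only [map_add, hp, hq]
  | single u p => simp only [coefLin_single, toric_single, map_smul]

theorem coefLin_mul (j : Fin N) (w w' : Laurent N n) :
    coefLin n j (w * w') = w * coefLin n j w' + coefLin n j w * w' := by
  have := (coefDer n j).leibniz w w'
  rw [smul_eq_mul, smul_eq_mul, mul_comm w'] at this
  exact this

theorem coefLin_generic (a : Fin N → Fin n → ℤ) (j : Fin N) :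
    coefLin n j (generic a) = mon (a j) := by
  rw [generic, map_sum, Finset.sum_eq_single j]
  · rw [coefLin_single, MvPolynomial.pderiv_X_self]
  · intro k _ hk
    rw [coefLin_single, MvPolynomial.pderiv_X_of_ne hk, AddMonoidAlgebra.single_zero]
  · simp

theorem smul_eq_single_mul (p : PolyRing N) (w : Laurent N n) :
    p • w = AddMonoidAlgebra.single 0 p * w := by
  rw [Algebra.smul_def]
  rfl

/-- The operator `e^{-f} (∑ c_i (x_i ∂/∂x_i - α_i)) e^f`, for `f = ∑_j λ_j x^{a^{(j)}}`. -/
noncomputable def euler (a : Fin N → Fin n → ℤ) (α c : Fin n → ℂ) :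
    Laurent N n →ₗ[PolyRing N] Laurent N n :=
  (toric c).toLinearMap +
    LinearMap.mulLeft _ (toric c (generic a) - algebraMap ℂ _ (∑ i, c i * α i))

theorem euler_apply (a : Fin N → Fin n → ℤ) (α c : Fin n → ℂ) (w : Laurent N n) :
    euler a α c w = toric c w + (toric c (generic a) - algebraMap ℂ _ (∑ i, c i * α i)) * w := rfl

/-- The operator `e^{-f} ∂_j e^f`, for `f = ∑_j λ_j x^{a^{(j)}}`. -/
noncomputable def parOp (a : Fin N → Fin n → ℤ) (j : Fin N) : Laurent N n →ₗ[ℂ] Laurent N n :=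
  coefLin n j + LinearMap.mulLeft ℂ (mon (a j))

theorem parOp_apply (a : Fin N → Fin n → ℤ) (j : Fin N) (w : Laurent N n) :
    parOp a j w = coefLin n j w + mon (a j) * w := rfl

variable (a : Fin N → Fin n → ℤ) (α : Fin n → ℂ)

theorem toric_algebraMap (c : Fin n → ℂ) (r : ℂ) :
    toric c (algebraMap ℂ (Laurent N n) r) = 0 := by
  rw [IsScalarTower.algebraMap_apply ℂ (PolyRing N) (Laurent N n), Derivation.map_algebraMap]

/-- These operators are conjugates by e^f of the commuting operators ∑ c_i (x_i ∂/∂x_i - α_i). -/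
theorem euler_comm (c c' : Fin n → ℂ) (w : Laurent N n) :
    euler a α c (euler a α c' w) = euler a α c' (euler a α c w) := by
  simp only [euler_apply, map_add, Derivation.leibniz, map_sub, toric_algebraMap, smul_eq_mul,
    toric_comm c c']
  ring

theorem euler_eq_sum (c : Fin n → ℂ) (w : Laurent N n) :
    euler a α c w = ∑ i, c i • euler a α (Pi.single i 1) w := by
  have h : algebraMap ℂ (Laurent N n) (∑ i, c i * α i) =
      ∑ i, c i • algebraMap ℂ (Laurent N n) (∑ k, (Pi.single i 1 : Fin n → ℂ) k * α k) := by
    rw [map_sum]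
    refine Finset.sum_congr rfl fun i _ => ?_
    simp [Pi.single_apply, Algebra.smul_def]
  simp only [euler_apply]
  rw [toric_eq_sum, toric_eq_sum c (generic a), h, ← Finset.sum_sub_distrib, Finset.sum_mul,
    ← Finset.sum_add_distrib]
  refine Finset.sum_congr rfl fun i _ => ?_
  rw [smul_add, ← smul_sub, smul_mul_assoc]

/-- Before conjugation by e^f these are a toric derivation in x, shifted by a constant, and ∂/∂λ_j,
which commute. Hence the images of the Euler operators are stable under the ∂_j. -/
theorem euler_parOp (c : Fin n → ℂ) (j : Fin N) (w : Laurent N n) :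
    euler a α c (parOp a j w) = parOp a j (euler a α c w) := by
  have h : coefLin n j (algebraMap ℂ (Laurent N n) (∑ i, c i * α i)) = 0 :=
    (coefDer n j).map_algebraMap _
  have h1 : coefLin n j (toric c (generic a)) = toric c (mon (a j)) := by
    rw [← toric_coefLin, coefLin_generic]
  simp only [euler_apply, parOp_apply, map_add, coefLin_mul, toric_coefLin, map_sub, h, h1,
    Derivation.leibniz, smul_eq_mul]
  ring

/-- With c read as a linear form ℓ, the diagonal term is the scalar ℓ(u) - ℓ(α), and the step to the
exponent a_j + u carries the weight ℓ(a_j), so no step stays on the level set of ℓ through u. This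
is what makes facet forms useful. -/
theorem euler_single (c : Fin n → ℂ) (u : Fin n → ℤ) (p : PolyRing N) :
    euler a α c (AddMonoidAlgebra.single u p) =
      ((∑ i, c i * u i) - ∑ i, c i * α i) • AddMonoidAlgebra.single u p +
        ∑ j, (∑ i, c i * a j i) • AddMonoidAlgebra.single (a j + u) (MvPolynomial.X j * p) := by
  rw [euler_apply, toric_single, sub_mul, ← Algebra.smul_def, generic, map_sum, Finset.sum_mul,
    sub_smul]
  simp only [toric_single, smul_mul_assoc, AddMonoidAlgebra.single_mul_single]
  abel

theorem parOp_single (j : Fin N) (u : Fin n → ℤ) (p : PolyRing N) :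
    parOp a j (AddMonoidAlgebra.single u p) =
      AddMonoidAlgebra.single u (MvPolynomial.pderiv j p) + AddMonoidAlgebra.single (a j + u) p := by
  rw [parOp_apply, coefLin_single, AddMonoidAlgebra.single_mul_single, one_mul]

end Laurent
-- Changing the exponent set for nonresonant parameters.
namespace Laurent

variable {N n : ℕ}

/-- The Laurent polynomials whose exponents lie in `S`. -/
noncomputable def supp (N : ℕ) (S : Set (Fin n → ℤ)) : Submodule (PolyRing N) (Laurent N n) :=
  Submodule.span (PolyRing N) ((fun u => mon u) '' S)

theorem supp_mono {S T : Set (Fin n → ℤ)} (h : S ⊆ T) : supp N S ≤ supp N T :=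
  Submodule.span_mono (Set.image_mono h)

theorem single_mem_supp {S : Set (Fin n → ℤ)} {u : Fin n → ℤ} (hu : u ∈ S) (p : PolyRing N) :
    AddMonoidAlgebra.single u p ∈ supp N S := by
  have : AddMonoidAlgebra.single u p = p • (mon u : Laurent N n) := by simp
  rw [this]
  exact Submodule.smul_mem _ _ (Submodule.subset_span ⟨u, hu, rfl⟩)

theorem supp_induction {S : Set (Fin n → ℤ)} {P : Laurent N n → Prop}
    (single : ∀ u ∈ S, ∀ p, P (AddMonoidAlgebra.single u p)) (zero : P 0)
    (add : ∀ v w, P v → P w → P (v + w)) {w : Laurent N n} (hw : w ∈ supp N S) : P w := by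
  refine Submodule.closure_induction (p := fun w _ => P w) zero (fun v w _ _ => add v w) ?_ hw
  rintro p _ ⟨u, hu, rfl⟩
  have := single u hu p
  simpa using this

theorem supp_univ : supp N (Set.univ : Set (Fin n → ℤ)) = ⊤ := by
  rw [eq_top_iff]
  rintro w -
  induction w using AddMonoidAlgebra.induction_linear with
  | zero => exact zero_mem _
  | add p q hp hq => exact add_mem hp hq
  | single u p => exact single_mem_supp (Set.mem_univ u) p

/-- The set `S` of exponents is stable under adding the `a^{(j)}`. -/
def Stable (a : Fin N → Fin n → ℤ) (S : Set (Fin n → ℤ)) : Prop := ∀ u ∈ S, ∀ j, a j + u ∈ S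

variable (a : Fin N → Fin n → ℤ) (α : Fin n → ℂ)

/-- The sum of the images of the Euler operators on the Laurent polynomials with exponents
in `S`. -/
noncomputable def eulerImage (S : Set (Fin n → ℤ)) : Submodule (PolyRing N) (Laurent N n) :=
  ⨆ i, (supp N S).map (euler a α (Pi.single i 1))

variable {a} {S T : Set (Fin n → ℤ)}

theorem euler_mem_supp (hS : Stable a S) (c : Fin n → ℂ) {w : Laurent N n} (hw : w ∈ supp N S) :
    euler a α c w ∈ supp N S := by
  refine supp_induction (P := fun w => euler a α c w ∈ supp N S) (fun u hu p => ?_) ?_ ?_ hw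
  · rw [euler_single]
    refine add_mem (Submodule.smul_of_tower_mem _ _ (single_mem_supp hu p))
      (Submodule.sum_mem _ fun j _ => Submodule.smul_of_tower_mem _ _
        (single_mem_supp (hS u hu j) _))
  · rw [map_zero]; exact zero_mem _
  · intro v w hv hw; rw [map_add]; exact add_mem hv hw

theorem parOp_mem_supp (hS : Stable a S) (j : Fin N) {w : Laurent N n} (hw : w ∈ supp N S) :
    parOp a j w ∈ supp N S := by
  refine supp_induction (P := fun w => parOp a j w ∈ supp N S) (fun u hu p => ?_) ?_ ?_ hw
  · rw [parOp_single]
    exact add_mem (single_mem_supp hu _) (single_mem_supp (hS u hu j) _)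
  · rw [map_zero]; exact zero_mem _
  · intro v w hv hw; rw [map_add]; exact add_mem hv hw

theorem euler_mem_eulerImage (c : Fin n → ℂ) {w : Laurent N n} (hw : w ∈ supp N S) :
    euler a α c w ∈ eulerImage a α S := by
  rw [euler_eq_sum]
  exact Submodule.sum_mem _ fun i _ => Submodule.smul_of_tower_mem _ _
    (Submodule.mem_iSup_of_mem (p := fun i => (supp N S).map (euler a α (Pi.single i 1))) i
      (Submodule.mem_map_of_mem hw))

theorem eulerImage_induction {P : Laurent N n → Prop}
    (euler : ∀ i, ∀ w ∈ supp N S, P (euler a α (Pi.single i 1) w)) (zero : P 0)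
    (add : ∀ v w, P v → P w → P (v + w)) {w : Laurent N n} (hw : w ∈ eulerImage a α S) : P w := by
  refine Submodule.iSup_induction _ (motive := P) hw ?_ zero add
  rintro i _ ⟨w, hw, rfl⟩
  exact euler i w hw

theorem eulerImage_le (hS : Stable a S) : eulerImage a α S ≤ supp N S :=
  iSup_le fun _ => Submodule.map_le_iff_le_comap.2 fun _ hw => euler_mem_supp α hS _ hw

theorem eulerImage_mono (h : S ⊆ T) : eulerImage a α S ≤ eulerImage a α T :=
  iSup_mono fun _ => Submodule.map_mono (supp_mono h)

variable (a) in
/-- The inclusion of the Laurent polynomials with exponents in `S` into those with exponents in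
`T` induces an isomorphism modulo the images of the Euler operators. -/
def EulerEquiv (S T : Set (Fin n → ℤ)) : Prop :=
  supp N T ≤ supp N S ⊔ eulerImage a α T ∧ supp N S ⊓ eulerImage a α T ≤ eulerImage a α S

theorem EulerEquiv.refl : EulerEquiv a α S S := ⟨le_sup_left, inf_le_right⟩

variable {α} in
theorem EulerEquiv.trans {R : Set (Fin n → ℤ)} (h1 : R ⊆ S) (h2 : S ⊆ T)
    (h : EulerEquiv a α R S) (h' : EulerEquiv a α S T) : EulerEquiv a α R T := by
  refine ⟨h'.1.trans (sup_le (h.1.trans (sup_le le_sup_left ?_)) le_sup_right), ?_⟩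
  · exact (eulerImage_mono α h2).trans le_sup_right
  · exact (le_inf inf_le_left ((inf_le_inf_right _ (supp_mono h1)).trans h'.2)).trans h.2

/-- If a combination of the Euler operators acts on the quotient by a nonzero scalar, then the
cohomology of the quotient vanishes. -/
theorem EulerEquiv.of_scalar (hS : Stable a S) (hT : Stable a T)
    (c : Fin n → ℂ) (s : ℂ) (hs : s ≠ 0)
    (h : ∀ w ∈ supp N T, euler a α c w - s • w ∈ supp N S) : EulerEquiv a α S T := by
  have hsm : ∀ (r : ℂ) (w : Laurent N n), euler a α c (r • w) = r • euler a α c w := fun r w =>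
    ((euler a α c).restrictScalars ℂ).map_smul r w
  -- Modulo S the operator is multiplication by s, so every w equals its value at s⁻¹ w up to an
  -- element supported on S.
  have hA : ∀ w ∈ supp N T, ∃ y ∈ supp N S, w = y + euler a α c (s⁻¹ • w) := fun w hw => by
    refine ⟨-(s⁻¹ • (euler a α c w - s • w)),
      neg_mem (Submodule.smul_of_tower_mem _ _ (h w hw)), ?_⟩
    rw [hsm, smul_sub, smul_smul, inv_mul_cancel₀ hs, one_smul]
    abel
  refine ⟨fun w hw => ?_, fun w hw => ?_⟩
  · obtain ⟨y, hy, e⟩ := hA w hw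
    rw [e]
    exact Submodule.add_mem_sup hy
      (euler_mem_eulerImage α c (Submodule.smul_of_tower_mem _ _ hw))
  -- Write E for the operator of c. Substituting w = y + E(s⁻¹ w) into E_i w and commuting E_i past
  -- E expresses an element of the image over T as an element of the image over S plus E z. If the
  -- sum is supported on S, so is E z, and hence so is z, on which E acts as s modulo S.
  · obtain ⟨y, hy, z, hz, e⟩ : ∃ y ∈ eulerImage a α S, ∃ z ∈ eulerImage a α T,
        w = y + euler a α c z := by
      refine eulerImage_induction α (P := fun w => ∃ y ∈ eulerImage a α S,
        ∃ z ∈ eulerImage a α T, w = y + euler a α c z) ?_ ⟨0, zero_mem _, 0, zero_mem _, by simp⟩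
        ?_ hw.2
      · intro i w hw
        obtain ⟨y, hy, e⟩ := hA w hw
        refine ⟨_, euler_mem_eulerImage α (Pi.single i 1) hy, _,
          euler_mem_eulerImage α (Pi.single i 1)
            (Submodule.smul_of_tower_mem _ s⁻¹ hw), ?_⟩
        rw [euler_comm, ← map_add, ← e]
      · rintro v w ⟨y, hy, z, hz, e⟩ ⟨y', hy', z', hz', e'⟩
        refine ⟨_, add_mem hy hy', _, add_mem hz hz', ?_⟩
        rw [map_add, e, e']
        abel
    have hz' : z ∈ supp N S := by
      have h1 := h z (eulerImage_le α hT hz)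
      have h2 : euler a α c z ∈ supp N S := by
        rw [eq_sub_of_add_eq' e.symm]
        exact sub_mem hw.1 (eulerImage_le α hS hy)
      have h3 : z = s⁻¹ • (euler a α c z - (euler a α c z - s • z)) := by
        rw [sub_sub_cancel, smul_smul, inv_mul_cancel₀ hs, one_smul]
      rw [h3]
      exact Submodule.smul_of_tower_mem _ _ (sub_mem h2 h1)
    rw [e]
    exact add_mem hy (euler_mem_eulerImage α c hz')

/-- All exponents in T outside S lie on one level ℓ = k, where the diagonal scalar is k - ℓ(α) ≠ 0.
A step by a_j either lands in S or stays on the level; in the latter case ℓ(a_j) = 0 and its weight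
vanishes. -/
theorem EulerEquiv.of_level (hS : Stable a S) (hT : Stable a T) (c : Fin n → ℤ) (k : ℤ)
    (hk : ∀ u ∈ T, u ∉ S → ∑ i, c i * u i = k) (hα : ∑ i, (c i : ℂ) * α i ≠ k) :
    EulerEquiv a α S T := by
  refine .of_scalar α hS hT (fun i => c i) (k - ∑ i, (c i : ℂ) * α i)
    (sub_ne_zero.2 hα.symm) fun w hw => ?_
  refine supp_induction (P := fun w => euler a α _ w - (k - ∑ i, (c i : ℂ) * α i) • w ∈ supp N S)
    ?_ ?_ ?_ hw
  · intro u hu p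
    have hcast : ∀ v : Fin n → ℤ, ∑ i, (c i : ℂ) * (v i : ℂ) = ((∑ i, c i * v i : ℤ) : ℂ) :=
      fun v => by push_cast; rfl
    rw [euler_single, add_sub_right_comm, ← sub_smul]
    refine add_mem ?_ (Submodule.sum_mem _ fun j _ => ?_)
    · by_cases hu' : u ∈ S
      · exact Submodule.smul_of_tower_mem _ _ (single_mem_supp hu' p)
      · rw [hcast, hk u hu hu', sub_self, zero_smul]
        exact zero_mem _
    · by_cases hu' : a j + u ∈ S
      · exact Submodule.smul_of_tower_mem _ _ (single_mem_supp hu' _)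
      · have h1 := hk _ (hT u hu j) hu'
        have h2 := hk u hu fun h => hu' (hS u h j)
        simp only [Pi.add_apply, mul_add, Finset.sum_add_distrib] at h1
        have h3 : ∑ i, c i * a j i = 0 := by omega
        rw [hcast, h3, Int.cast_zero, zero_smul]
        exact zero_mem _
  · rw [map_zero, smul_zero, sub_zero]; exact zero_mem _
  · intro v w hv hw
    rw [map_add, smul_add, add_sub_add_comm]
    exact add_mem hv hw

/-- For nonresonant `α`, a stable set can be replaced by any stable subset that contains all of
its points far inside the cone. -/
theorem EulerEquiv.of_deep (hS : Stable a S) (hT : Stable a T) (hST : S ⊆ T)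
    (C : Finset (Fin n → ℤ)) (hC : ∀ c ∈ C, IsFacetForm a c) (hα : Nonresonant a α) (k : ℤ)
    (hk : ∀ u : Fin n → ℤ, (∀ c ∈ C, k ≤ ∑ i, c i * u i) → u ∈ S) : EulerEquiv a α S T := by
  have hn : ∀ c ∈ C, ∀ j, 0 ≤ ∑ i, c i * a j i := fun c hc j => by
    have h := (hC c hc).2.1 (fun i => (a j i : ℝ)) ⟨Pi.single j 1, fun k => by
      rw [Pi.single_apply]; split_ifs <;> simp, by
      rw [Finset.sum_eq_single j]
      · simp
      · intro k _ hk; simp [hk]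
      · simp⟩
    exact_mod_cast h
  -- S together with the points of T where each facet form c is at least l + d_c. These sets
  -- interpolate between S and T: raising d shrinks the set to S, and lowering l exhausts T.
  let R : (C →₀ ℕ) → ℤ → Set (Fin n → ℤ) := fun d l =>
    S ∪ {u | u ∈ T ∧ ∀ c : C, l + d c ≤ ∑ i, c.1 i * u i}
  have hRs : ∀ d l, Stable a (R d l) := by
    rintro d l u (hu | ⟨hu, hu'⟩) j
    · exact .inl (hS u hu j)
    · refine .inr ⟨hT u hu j, fun c => ?_⟩
      have h1 := hu' c
      have h2 := hn c c.2 j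
      simp only [Pi.add_apply, mul_add, Finset.sum_add_distrib]
      omega
  have hRm : ∀ d e l, R (d + e) l ⊆ R d l := by
    rintro d e l u (hu | ⟨hu, hu'⟩)
    · exact .inl hu
    · refine .inr ⟨hu, fun c => ?_⟩
      have := hu' c
      rw [Finsupp.add_apply] at this
      push_cast at this
      omega
  have hRT : ∀ d l, R d l ⊆ T := fun d l => Set.union_subset hST fun u hu => hu.1
  -- Raising one bound by 1 removes only points on a single level of one facet form, where
  -- nonresonance gives a nonzero scalar.
  have step : ∀ d e l, EulerEquiv a α (R (d + e) l) (R d l) := fun d e l => by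
    induction e using Finsupp.induction_linear generalizing d with
    | zero => rw [add_zero]; exact .refl α
    | add e e' h h' =>
      rw [← add_assoc]
      exact (h' (d + e)).trans (hRm _ _ _) (hRm _ _ _) (h d)
    | single c r =>
      induction r with
      | zero => rw [Finsupp.single_zero, add_zero]; exact .refl α
      | succ r ih =>
        rw [Finsupp.single_add, ← add_assoc]
        refine EulerEquiv.trans (hRm _ _ _) (hRm _ _ _) ?_ ih
        generalize d + Finsupp.single c r = d'
        refine .of_level α (hRs _ _) (hRs _ _) c.1 (l + d' c) ?_ ?_
        · rintro u (hu | ⟨hu, hu'⟩) hu2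
          · exact absurd (.inl hu) hu2
          · by_contra hne
            refine hu2 (.inr ⟨hu, fun c' => ?_⟩)
            have h1 := hu' c'
            have h2 := hu' c
            rw [Finsupp.add_apply]
            by_cases hcc : c = c'
            · subst hcc
              rw [Finsupp.single_eq_same]
              push_cast
              omega
            · rw [Finsupp.single_eq_of_ne (Ne.symm hcc)]
              simpa using h1
        · exact hα c.1 (hC c c.2) _
  -- Once all bounds are at least k, the added points are deep and already belong to S.
  have hS' : ∀ l : ℕ, R (Finsupp.equivFunOnFinite.symm fun _ => (k + l).toNat) (-l) ⊆ S := by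
    rintro l u (hu | ⟨hu, hu'⟩)
    · exact hu
    · refine hk u fun c hc => ?_
      have := hu' ⟨c, hc⟩
      simp only [Finsupp.equivFunOnFinite_symm_apply_apply] at this
      have h2 := Int.self_le_toNat (k + l)
      omega
  have hSeq : ∀ l : ℕ, EulerEquiv a α S (R 0 (-l)) := fun l => by
    have h := step 0 (Finsupp.equivFunOnFinite.symm fun _ => (k + l).toNat) (-l)
    rwa [zero_add, (hS' l).antisymm Set.subset_union_left] at h
  have hmono : ∀ l l' : ℕ, l ≤ l' → R 0 (-l) ⊆ R 0 (-l') := by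
    rintro l l' h u (hu | ⟨hu, hu'⟩)
    · exact .inl hu
    · exact .inr ⟨hu, fun c => by have := hu' c; simp only [Finsupp.coe_zero, Pi.zero_apply] at *; omega⟩
  have hex : ∀ u ∈ T, ∃ l : ℕ, u ∈ R 0 (-l) := fun u hu => by
    refine ⟨∑ c : C, (∑ i, c.1 i * u i).natAbs, .inr ⟨hu, fun c => ?_⟩⟩
    have h1 := Finset.single_le_sum (f := fun c : C => (∑ i, c.1 i * u i).natAbs)
      (fun _ _ => Nat.zero_le _) (Finset.mem_univ c)
    simp only [Finsupp.coe_zero, Pi.zero_apply] at *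
    omega
  have hsupp : ∀ w ∈ supp N T, ∃ l : ℕ, w ∈ supp N (R 0 (-l)) := fun w hw => by
    refine supp_induction (P := fun w => ∃ l : ℕ, w ∈ supp N (R 0 (-l))) ?_ ⟨0, zero_mem _⟩ ?_ hw
    · intro u hu p
      obtain ⟨l, hl⟩ := hex u hu
      exact ⟨l, single_mem_supp hl p⟩
    · rintro v w ⟨l, hl⟩ ⟨l', hl'⟩
      exact ⟨max l l', add_mem (supp_mono (hmono _ _ (le_max_left _ _)) hl)
        (supp_mono (hmono _ _ (le_max_right _ _)) hl')⟩
  have himage : ∀ w ∈ eulerImage a α T, ∃ l : ℕ, w ∈ eulerImage a α (R 0 (-l)) := fun w hw => by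
    refine eulerImage_induction α (P := fun w => ∃ l : ℕ, w ∈ eulerImage a α (R 0 (-l))) ?_
      ⟨0, zero_mem _⟩ ?_ hw
    · intro i w hw
      obtain ⟨l, hl⟩ := hsupp w hw
      exact ⟨l, euler_mem_eulerImage α _ hl⟩
    · rintro v w ⟨l, hl⟩ ⟨l', hl'⟩
      exact ⟨max l l', add_mem (eulerImage_mono α (hmono _ _ (le_max_left _ _)) hl)
        (eulerImage_mono α (hmono _ _ (le_max_right _ _)) hl')⟩
  -- T is the increasing union of the sets R 0 (-l), and any membership involves finitely many
  -- monomials, so it can be tested at one finite l.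
  refine ⟨fun w hw => ?_, fun w hw => ?_⟩
  · obtain ⟨l, hl⟩ := hsupp w hw
    exact sup_le_sup_left (eulerImage_mono α (hRT _ _)) _ ((hSeq l).1 hl)
  · obtain ⟨l, hl⟩ := himage w hw.2
    exact (hSeq l).2 ⟨hw.1, hl⟩

end Laurent

/-! ### The Weyl algebra and its action on Laurent polynomials. -/

theorem adjoin_mul_comm {σ R : Type} [Ring R] [Algebra ℂ R] {x : σ → R}
    (hx : ∀ i j, x i * x j = x j * x i) (y z : Algebra.adjoin ℂ (Set.range x)) : y * z = z * y :=
  (Algebra.isMulCommutative_adjoin ℂ (by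
    rintro _ ⟨i, rfl⟩ _ ⟨j, rfl⟩
    exact hx i j)).is_comm.comm y z

/-- The homomorphism on polynomials that is given by commuting elements of an algebra. -/
noncomputable def commEval {σ R : Type} [Ring R] [Algebra ℂ R] (x : σ → R)
    (hx : ∀ i j, x i * x j = x j * x i) : MvPolynomial σ ℂ →ₐ[ℂ] R :=
  letI : CommRing (Algebra.adjoin ℂ (Set.range x)) :=
    { (inferInstance : Ring (Algebra.adjoin ℂ (Set.range x))) with mul_comm := adjoin_mul_comm hx }
  (Algebra.adjoin ℂ (Set.range x)).val.comp
    (MvPolynomial.aeval fun i =>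
      (⟨x i, Algebra.subset_adjoin ⟨i, rfl⟩⟩ : Algebra.adjoin ℂ (Set.range x)))

theorem commEval_X {σ R : Type} [Ring R] [Algebra ℂ R] (x : σ → R)
    (hx : ∀ i j, x i * x j = x j * x i) (i : σ) : commEval x hx (MvPolynomial.X i) = x i := by
  let _ : CommRing (Algebra.adjoin ℂ (Set.range x)) :=
    { (inferInstance : Ring (Algebra.adjoin ℂ (Set.range x))) with mul_comm := adjoin_mul_comm hx }
  exact congrArg Subtype.val (MvPolynomial.aeval_X (R := ℂ)
    (fun i => (⟨x i, Algebra.subset_adjoin ⟨i, rfl⟩⟩ : Algebra.adjoin ℂ (Set.range x))) i)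

theorem pderiv_comm {N : ℕ} (i j : Fin N) (p : PolyRing N) :
    MvPolynomial.pderiv i (MvPolynomial.pderiv j p) =
      MvPolynomial.pderiv j (MvPolynomial.pderiv i p) := by
  have h : ⁅MvPolynomial.pderiv (R := ℂ) i, MvPolynomial.pderiv j⁆ = 0 :=
    MvPolynomial.derivation_ext fun k => by
      rw [Derivation.commutator_apply, MvPolynomial.pderiv_X, MvPolynomial.pderiv_X,
        Pi.single_apply, Pi.single_apply]
      split_ifs <;> simp
  have := DFunLike.congr_fun h p
  rwa [Derivation.commutator_apply, Derivation.zero_apply, sub_eq_zero] at this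

theorem Laurent.coefLin_smul {N n : ℕ} (j : Fin N) (p : PolyRing N) (w : Laurent N n) :
    coefLin n j (p • w) = p • coefLin n j w + MvPolynomial.pderiv j p • w := by
  simp only [smul_eq_single_mul, coefLin_mul, coefLin_single]

namespace Weyl

variable {N : ℕ}

theorem lam_mul_lam (i j : Fin N) : lam i * lam j = lam j * lam i := by
  rw [lam, lam, ← map_mul, ← map_mul]
  exact RingQuot.mkAlgHom_rel ℂ (.lam i j)

theorem par_mul_par (i j : Fin N) : par i * par j = par j * par i := by
  rw [par, par, ← map_mul, ← map_mul]
  exact RingQuot.mkAlgHom_rel ℂ (.par i j)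

theorem par_mul_lam (i j : Fin N) : par i * lam j = lam j * par i + if i = j then 1 else 0 := by
  have := RingQuot.mkAlgHom_rel ℂ (WeylRel.comm (N := N) i j)
  rw [map_mul, map_add, map_mul] at this
  rw [par, lam, this]
  split_ifs <;> simp

/-- Polynomials in the `λ_j` as differential operators. -/
noncomputable def lamHom : PolyRing N →ₐ[ℂ] Weyl N := commEval lam lam_mul_lam

/-- Polynomials in the `∂_j` as differential operators. -/
noncomputable def parHom : PolyRing N →ₐ[ℂ] Weyl N := commEval par par_mul_par

theorem lamHom_X (j : Fin N) : lamHom (MvPolynomial.X j) = lam j := commEval_X _ _ j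

theorem parHom_X (j : Fin N) : parHom (MvPolynomial.X j) = par j := commEval_X _ _ j

theorem par_mul_lamHom (j : Fin N) (p : PolyRing N) :
    par j * lamHom p = lamHom p * par j + lamHom (MvPolynomial.pderiv j p) := by
  induction p using MvPolynomial.induction_on with
  | C c =>
    rw [MvPolynomial.pderiv_C, map_zero, add_zero]
    exact ((Algebra.commutes c (par j)).symm.trans (by rw [← MvPolynomial.algebraMap_eq,
      AlgHom.commutes])).symm.trans (by rw [← MvPolynomial.algebraMap_eq, AlgHom.commutes]) |>.symm
  | add p q hp hq => simp only [map_add, mul_add, add_mul, hp, hq]; abel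
  | mul_X p i hp =>
    rw [map_mul, ← mul_assoc, hp, Derivation.leibniz, smul_eq_mul, smul_eq_mul, map_add, map_mul,
      map_mul, lamHom_X, add_mul, mul_assoc, par_mul_lam, mul_add, mul_assoc, add_assoc]
    congr 1
    rw [← lamHom_X, ← map_mul, ← map_mul, ← map_mul, add_comm]
    have hc : lamHom (MvPolynomial.pderiv j p) * lamHom (MvPolynomial.X i) =
        lamHom (MvPolynomial.X i) * lamHom (MvPolynomial.pderiv j p) := by
      rw [← map_mul, mul_comm, map_mul]
    rw [MvPolynomial.pderiv_X, Pi.single_apply, map_mul]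
    simp only [eq_comm (a := i)]
    split_ifs <;> simp [hc, add_comm]

/-- Only left multiplication by generators occurs, which suits statements about P applied to a fixed
vector. -/
theorem induction {P : Weyl N → Prop} (one : P 1) (smul : ∀ (c : ℂ) x, P x → P (c • x))
    (add : ∀ x y, P x → P y → P (x + y)) (lam_mul : ∀ j x, P x → P (lam j * x))
    (par_mul : ∀ j x, P x → P (par j * x)) (x : Weyl N) : P x := by
  obtain ⟨y, rfl⟩ := RingQuot.mkAlgHom_surjective ℂ (WeylRel N) x
  suffices h : ∀ z, P z → P (RingQuot.mkAlgHom ℂ (WeylRel N) y * z) by simpa using h 1 one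
  induction y using FreeAlgebra.induction with
  | grade0 c =>
    intro z hz
    rw [AlgHom.commutes, ← Algebra.smul_def]
    exact smul c z hz
  | grade1 i =>
    intro z hz
    cases i with
    | inl j => exact lam_mul j z hz
    | inr j => exact par_mul j z hz
  | mul a b ha hb => intro z hz; rw [map_mul, mul_assoc]; exact ha _ (hb _ hz)
  | add a b ha hb => intro z hz; rw [map_add, add_mul]; exact add _ _ (ha z hz) (hb z hz)

section Action

variable {n : ℕ} (a : Fin N → Fin n → ℤ)

theorem parOp_comm (i j : Fin N) (w : Laurent N n) :
    Laurent.parOp a i (Laurent.parOp a j w) = Laurent.parOp a j (Laurent.parOp a i w) := by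
  induction w using AddMonoidAlgebra.induction_linear with
  | zero => simp
  | add p q hp hq => simp only [map_add, hp, hq]
  | single u p =>
    simp only [Laurent.parOp_single, map_add]
    rw [pderiv_comm, add_left_comm (a i)]
    abel

/-- The action of `𝒟` on Laurent polynomials in which `λ_j` acts by multiplication and `∂_j` acts
as `e^{-f} ∂_j e^f`, for `f = ∑_j λ_j x^{a^{(j)}}`. -/
noncomputable def act : Weyl N →ₐ[ℂ] Module.End ℂ (Laurent N n) :=
  RingQuot.liftAlgHom ℂ ⟨FreeAlgebra.lift ℂ (Sum.elim
    (fun j => Algebra.lsmul ℂ ℂ (Laurent N n) (MvPolynomial.X j : PolyRing N))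
    (fun j => Laurent.parOp a j)), by
    rintro _ _ (⟨i, j⟩ | ⟨i, j⟩ | ⟨i, j⟩)
    · simp only [map_mul, FreeAlgebra.lift_ι_apply, Sum.elim_inl]
      rw [← map_mul, ← map_mul, mul_comm]
    · simp only [map_mul, FreeAlgebra.lift_ι_apply, Sum.elim_inr]
      exact LinearMap.ext fun w => parOp_comm a i j w
    · simp only [map_mul, map_add, FreeAlgebra.lift_ι_apply, Sum.elim_inl, Sum.elim_inr]
      refine LinearMap.ext fun w => ?_
      have h : Laurent.parOp a i ((MvPolynomial.X j : PolyRing N) • w) =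
          (MvPolynomial.X j : PolyRing N) • Laurent.parOp a i w + if i = j then w else 0 := by
        rw [Laurent.parOp_apply, Laurent.coefLin_smul, Laurent.parOp_apply, smul_add,
          mul_smul_comm, MvPolynomial.pderiv_X, Pi.single_apply]
        simp only [eq_comm (a := j)]
        split_ifs
        · rw [one_smul]; abel
        · rw [zero_smul]; abel
      refine h.trans ?_
      split_ifs <;> simp⟩

theorem act_lam (j : Fin N) (w : Laurent N n) :
    act a (lam j) w = (MvPolynomial.X j : PolyRing N) • w := by
  rw [act, lam, RingQuot.liftAlgHom_mkAlgHom_apply, FreeAlgebra.lift_ι_apply]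
  rfl

theorem act_par (j : Fin N) (w : Laurent N n) : act a (par j) w = Laurent.parOp a j w := by
  rw [act, par, RingQuot.liftAlgHom_mkAlgHom_apply, FreeAlgebra.lift_ι_apply]
  rfl

theorem act_lamHom (p : PolyRing N) (w : Laurent N n) : act a (lamHom p) w = p • w := by
  induction p using MvPolynomial.induction_on generalizing w with
  | C c =>
    rw [← MvPolynomial.algebraMap_eq, AlgHom.commutes, AlgHom.commutes, algebraMap_smul]
    rfl
  | add p q hp hq => rw [map_add, map_add, LinearMap.add_apply, hp, hq, add_smul]
  | mul_X p i hp =>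
    rw [map_mul, map_mul, lamHom_X, Module.End.mul_apply, act_lam, hp, mul_smul]

theorem monomial_add_one (p q : Fin N →₀ ℕ) : MvPolynomial.monomial (p + q) (1 : ℂ) =
    MvPolynomial.monomial p 1 * MvPolynomial.monomial q 1 := by
  rw [MvPolynomial.monomial_mul, one_mul]

/-- The coefficient 1 is killed by ∂/∂λ_j, so ∂_j merely multiplies a bare monomial by x^{a_j}. -/
theorem act_parHom_mon (q : Fin N →₀ ℕ) (u : Fin n → ℤ) :
    act a (parHom (MvPolynomial.monomial q 1)) (Laurent.mon u) = Laurent.mon (expSum a q + u) := by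
  induction q using Finsupp.induction_linear generalizing u with
  | zero => rw [map_zero, zero_add, MvPolynomial.monomial_zero', map_one, map_one, map_one]; rfl
  | add p q hp hq =>
    rw [monomial_add_one, map_mul, map_mul, Module.End.mul_apply, hq, hp,
      map_add, add_assoc]
  | single j k =>
    induction k generalizing u with
    | zero =>
      rw [Finsupp.single_zero, map_zero, zero_add, MvPolynomial.monomial_zero', map_one, map_one,
        map_one]
      rfl
    | succ k ih =>
      rw [Finsupp.single_add, monomial_add_one, map_mul, map_mul,
        Module.End.mul_apply, map_add, expSum_single]
      change act a (parHom _) (act a (parHom (MvPolynomial.X j)) _) = _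
      rw [parHom_X, act_par, Laurent.parOp_single, Derivation.map_one_eq_zero, AddMonoidAlgebra.single_zero,
        zero_add, ih, add_assoc]

end Action

/-! ### The box ideal is the annihilator of 1. -/

section Boxes

theorem ofFn_par_pow (k : Fin N → ℕ) : (List.ofFn fun j => par j ^ k j).prod =
    parHom (MvPolynomial.monomial (Finsupp.equivFunOnFinite.symm k) 1) := by
  rw [MvPolynomial.monomial_eq, MvPolynomial.C_1, one_mul, Finsupp.prod_fintype _ _ (by simp),
    ← List.prod_ofFn, map_list_prod, List.map_ofFn]
  congr 2
  funext j
  simp [parHom_X]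

variable {n : ℕ} (a : Fin N → Fin n → ℤ)

/-- The left ideal that is generated by the box operators. -/
noncomputable def boxIdeal : Submodule (Weyl N) (Weyl N) :=
  Submodule.span (Weyl N) {P | ∃ l : Fin N → ℤ, ∑ j, l j • a j = 0 ∧ P = boxOp l}

/-- The common factor ∂^{min(p,q)} splits off on the left, and what remains is the box operator of l
= p - q. -/
theorem parHom_sub_mem_boxIdeal {p q : Fin N →₀ ℕ} (h : expSum a p = expSum a q) :
    parHom (MvPolynomial.monomial p 1) - parHom (MvPolynomial.monomial q 1) ∈ boxIdeal a := by
  let l : Fin N → ℤ := fun j => p j - q j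
  have hp : p = p ⊓ q + Finsupp.equivFunOnFinite.symm fun j => (l j).toNat := by
    ext j
    simp only [Finsupp.add_apply, Finsupp.inf_apply, Finsupp.equivFunOnFinite_symm_apply_apply, l]
    omega
  have hq : q = p ⊓ q + Finsupp.equivFunOnFinite.symm fun j => (-l j).toNat := by
    ext j
    simp only [Finsupp.add_apply, Finsupp.inf_apply, Finsupp.equivFunOnFinite_symm_apply_apply, l]
    omega
  have hl : ∑ j, l j • a j = 0 := by
    rw [expSum_apply, expSum_apply, ← sub_eq_zero, ← Finset.sum_sub_distrib] at h
    rw [← h]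
    refine Finset.sum_congr rfl fun j _ => ?_
    rw [sub_smul, natCast_zsmul, natCast_zsmul]
  have he : parHom (MvPolynomial.monomial p 1) - parHom (MvPolynomial.monomial q 1) =
      parHom (MvPolynomial.monomial (p ⊓ q) 1) * boxOp l := by
    rw [boxOp, ofFn_par_pow, ofFn_par_pow, mul_sub, ← map_mul, ← map_mul, MvPolynomial.monomial_mul,
      MvPolynomial.monomial_mul, ← hp, ← hq, one_mul]
  rw [he]
  exact Submodule.smul_mem _ _ (Submodule.subset_span ⟨l, hl, rfl⟩)

theorem act_boxOp (l : Fin N → ℤ) (hl : ∑ j, l j • a j = 0) : act a (boxOp l) 1 = 0 := by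
  have h : expSum a (Finsupp.equivFunOnFinite.symm fun j => (l j).toNat) =
      expSum a (Finsupp.equivFunOnFinite.symm fun j => (-l j).toNat) := by
    rw [expSum_apply, expSum_apply, ← sub_eq_zero, ← Finset.sum_sub_distrib, ← hl]
    refine Finset.sum_congr rfl fun j _ => ?_
    simp only [Finsupp.equivFunOnFinite_symm_apply_apply]
    rw [← natCast_zsmul, ← natCast_zsmul, ← sub_smul]
    congr 1
    omega
  rw [boxOp, ofFn_par_pow, ofFn_par_pow, map_sub, LinearMap.sub_apply, AddMonoidAlgebra.one_def]
  rw [act_parHom_mon, act_parHom_mon, h, sub_self]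

/-- The map `p(λ) x^u ↦ p(λ) ∂^q` for `u = ∑ q_j a^{(j)}`, which splits the action on `1`. -/
noncomputable def normalForm : Laurent N n →+ Weyl N ⧸ boxIdeal a := by
  classical
  exact (Finsupp.liftAddHom fun u => (boxIdeal a).mkQ.toAddMonoidHom.comp
    ((AddMonoidHom.mulRight (parHom (MvPolynomial.monomial
      (if h : ∃ q, expSum a q = u then h.choose else 0) 1))).comp
      (lamHom (N := N)).toRingHom.toAddMonoidHom)).comp
      (AddMonoidAlgebra.coeffAddEquiv (R := PolyRing N) (M := Fin n → ℤ)).toAddMonoidHom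

theorem normalForm_single (q : Fin N →₀ ℕ) (p : PolyRing N) :
    normalForm a (AddMonoidAlgebra.single (expSum a q) p) =
      Submodule.Quotient.mk (lamHom p * parHom (MvPolynomial.monomial q 1)) := by
  classical
  have h : ∃ q', expSum a q' = expSum a q := ⟨q, rfl⟩
  have h1 : normalForm a (AddMonoidAlgebra.single (expSum a q) p) =
      Submodule.Quotient.mk (lamHom p * parHom (MvPolynomial.monomial h.choose 1)) := by
    have := Finsupp.liftAddHom_apply_single (fun u => (boxIdeal a).mkQ.toAddMonoidHom.comp
      ((AddMonoidHom.mulRight (parHom (MvPolynomial.monomial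
        (if h : ∃ q, expSum a q = u then h.choose else 0) 1))).comp
        (lamHom (N := N)).toRingHom.toAddMonoidHom)) (expSum a q) p
    refine this.trans ?_
    rw [dif_pos h]
    rfl
  rw [h1, Submodule.Quotient.eq, ← mul_sub]
  exact Submodule.smul_mem _ _ (parHom_sub_mem_boxIdeal a h.choose_spec)

theorem normalForm_smul (p : PolyRing N) {w : Laurent N n}
    (hw : w ∈ Laurent.supp N (Set.range (expSum a))) :
    normalForm a (p • w) = lamHom p • normalForm a w := by
  refine Laurent.supp_induction (P := fun w => normalForm a (p • w) = lamHom p • normalForm a w)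
    ?_ (by simp) ?_ hw
  · rintro _ ⟨q, rfl⟩ p'
    rw [AddMonoidAlgebra.smul_single, normalForm_single, normalForm_single,
      ← Submodule.Quotient.mk_smul, smul_eq_mul, smul_eq_mul, map_mul, mul_assoc]
  · intro v w hv hw
    rw [smul_add, map_add, map_add, hv, hw, smul_add]

theorem normalForm_parOp (j : Fin N) {w : Laurent N n}
    (hw : w ∈ Laurent.supp N (Set.range (expSum a))) :
    normalForm a (Laurent.parOp a j w) = par j • normalForm a w := by
  refine Laurent.supp_induction (P := fun w => normalForm a (Laurent.parOp a j w) =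
    par j • normalForm a w) ?_ (by simp) ?_ hw
  · rintro _ ⟨q, rfl⟩ p
    rw [Laurent.parOp_single, map_add (normalForm a), ← expSum_single a j, ← map_add (expSum a), normalForm_single,
      normalForm_single, normalForm_single, ← Submodule.Quotient.mk_smul, smul_eq_mul,
      ← Submodule.Quotient.mk_add, ← mul_assoc, par_mul_lamHom, add_mul, add_comm, mul_assoc,
      ← parHom_X]
    rw [MvPolynomial.X, ← map_mul, MvPolynomial.monomial_mul, one_mul]
  · intro v w hv hw
    rw [map_add, map_add, map_add, hv, hw, smul_add]

theorem stable_range_expSum : Laurent.Stable a (Set.range (expSum a)) := by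
  rintro _ ⟨q, rfl⟩ j
  exact ⟨Finsupp.single j 1 + q, by rw [map_add, expSum_single]⟩

/-- The normal form inverts P ↦ P·1 modulo the box ideal, so that ideal contains the annihilator of
1. Both claims go through one induction, since the compatibility of `normalForm` with λ_j and ∂_j is
available only on exponents in ℕA. -/
theorem act_one_mem_supp_and_normalForm (P : Weyl N) :
    act a P 1 ∈ Laurent.supp N (Set.range (expSum a)) ∧
      normalForm a (act a P 1) = Submodule.Quotient.mk P := by
  induction P using Weyl.induction with
  | one =>
    rw [show act a 1 = 1 from map_one _, Module.End.one_apply, AddMonoidAlgebra.one_def,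
      ← map_zero (expSum a)]
    refine ⟨Laurent.single_mem_supp (Set.mem_range_self _) _, ?_⟩
    rw [normalForm_single, MvPolynomial.monomial_zero', map_one, map_one, map_one, one_mul]
  | smul c P h =>
    rw [map_smul, LinearMap.smul_apply, ← algebraMap_smul (PolyRing N)]
    refine ⟨Submodule.smul_mem _ _ h.1, ?_⟩
    rw [normalForm_smul a _ h.1, h.2, AlgHom.commutes, ← Submodule.Quotient.mk_smul, smul_eq_mul,
      Algebra.smul_def]
  | add P Q hP hQ =>
    rw [map_add, LinearMap.add_apply]
    exact ⟨add_mem hP.1 hQ.1, by rw [map_add, hP.2, hQ.2]; rfl⟩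
  | lam_mul j P h =>
    rw [map_mul, Module.End.mul_apply, act_lam]
    exact ⟨Submodule.smul_mem _ _ h.1, by rw [normalForm_smul a _ h.1, h.2, lamHom_X]; rfl⟩
  | par_mul j P h =>
    rw [map_mul, Module.End.mul_apply, act_par]
    exact ⟨Laurent.parOp_mem_supp (stable_range_expSum a) j h.1,
      by rw [normalForm_parOp a _ h.1, h.2]; rfl⟩

theorem mem_boxIdeal_of_act_eq_zero {P : Weyl N} (h : act a P 1 = 0) : P ∈ boxIdeal a := by
  rw [← Submodule.Quotient.mk_eq_zero, ← (act_one_mem_supp_and_normalForm a P).2, h, map_zero]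

theorem exists_act_eq {w : Laurent N n} (hw : w ∈ Laurent.supp N (Set.range (expSum a))) :
    ∃ P : Weyl N, act a P 1 = w := by
  refine Laurent.supp_induction (P := fun w => ∃ P : Weyl N, act a P 1 = w) ?_ ⟨0, by simp⟩ ?_ hw
  · rintro _ ⟨q, rfl⟩ p
    refine ⟨lamHom p * parHom (MvPolynomial.monomial q 1), ?_⟩
    rw [map_mul, Module.End.mul_apply, AddMonoidAlgebra.one_def, act_parHom_mon, act_lamHom,
      AddMonoidAlgebra.smul_single, add_zero, smul_eq_mul, mul_one]
  · rintro _ _ ⟨P, rfl⟩ ⟨Q, rfl⟩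
    exact ⟨P + Q, by rw [map_add, LinearMap.add_apply]⟩

end Boxes

/-! ### The hypergeometric module as a quotient of Laurent polynomials. -/

section Quotient

variable {n : ℕ} (a : Fin N → Fin n → ℤ) (α : Fin n → ℂ)

/-- The Euler operators are 𝒟-linear; so Q Z_i applied to 1 is E_i applied to Q·1. -/
theorem act_euler (P : Weyl N) (c : Fin n → ℂ) (w : Laurent N n) :
    act a P (Laurent.euler a α c w) = Laurent.euler a α c (act a P w) := by
  induction P using Weyl.induction with
  | one => rw [map_one]; rfl
  | smul r P h =>
    rw [map_smul, LinearMap.smul_apply, LinearMap.smul_apply, h]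
    exact (((Laurent.euler a α c).restrictScalars ℂ).map_smul r _).symm
  | add P Q hP hQ => rw [map_add, LinearMap.add_apply, LinearMap.add_apply, hP, hQ, map_add]
  | lam_mul j P h =>
    rw [map_mul, Module.End.mul_apply, Module.End.mul_apply, h, act_lam, act_lam, map_smul]
  | par_mul j P h =>
    rw [map_mul, Module.End.mul_apply, Module.End.mul_apply, h, act_par, act_par,
      Laurent.euler_parOp]

theorem act_eulerOp (i : Fin n) :
    act a (eulerOp a α i) 1 = Laurent.euler a α (Pi.single i 1) 1 := by
  rw [AddMonoidAlgebra.one_def, Laurent.euler_single, eulerOp, map_sub, map_sum, AlgHom.commutes,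
    LinearMap.sub_apply, LinearMap.sum_apply]
  simp only [map_smul, map_mul, LinearMap.smul_apply, Module.End.mul_apply, act_par, act_lam,
    Laurent.parOp_single, Pi.single_apply, ite_mul, one_mul, zero_mul,
    Finset.sum_ite_eq', Finset.mem_univ, if_true, Pi.zero_apply, Int.cast_zero, zero_sub]
  simp only [Derivation.map_one_eq_zero, AddMonoidAlgebra.single_zero, zero_add,
    AddMonoidAlgebra.smul_single, smul_eq_mul, mul_one, add_zero, Module.algebraMap_end_apply,
    neg_smul]
  abel

theorem parOp_mem_eulerImage {S : Set (Fin n → ℤ)} (hS : Laurent.Stable a S) (j : Fin N)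
    {w : Laurent N n} (hw : w ∈ Laurent.eulerImage a α S) :
    Laurent.parOp a j w ∈ Laurent.eulerImage a α S := by
  refine Laurent.eulerImage_induction α
    (P := fun w => Laurent.parOp a j w ∈ Laurent.eulerImage a α S) ?_ ?_ ?_ hw
  · intro i w hw
    rw [← Laurent.euler_parOp]
    exact Laurent.euler_mem_eulerImage α _ (Laurent.parOp_mem_supp hS j hw)
  · rw [map_zero]; exact zero_mem _
  · intro v w hv hw; rw [map_add]; exact add_mem hv hw

theorem act_mem_eulerImage (P : Weyl N) {w : Laurent N n}
    (hw : w ∈ Laurent.eulerImage a α Set.univ) : act a P w ∈ Laurent.eulerImage a α Set.univ := by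
  induction P using Weyl.induction with
  | one => rw [map_one]; exact hw
  | smul r P h => rw [map_smul]; exact Submodule.smul_of_tower_mem _ r h
  | add P Q hP hQ => rw [map_add]; exact add_mem hP hQ
  | lam_mul j P h => rw [map_mul, Module.End.mul_apply, act_lam]; exact Submodule.smul_mem _ _ h
  | par_mul j P h =>
    rw [map_mul, Module.End.mul_apply, act_par]
    exact parOp_mem_eulerImage a α (fun _ _ _ => Set.mem_univ _) j h

/-- If P·1 lies in the image of the E_i on all Laurent polynomials, the hypothesis moves it into
their image on exponents in ℕA. There every argument of E_i is some Q·1, so P·1 = P'·1 with P' in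
the left ideal of the Z_i, and P - P' is in the box ideal. -/
theorem mem_gkzIdeal_iff (h : Laurent.EulerEquiv a α (Set.range (expSum a)) Set.univ)
    (P : Weyl N) : P ∈ gkzIdeal a α ↔ act a P 1 ∈ Laurent.eulerImage a α Set.univ := by
  constructor
  · intro hP
    induction hP using Submodule.span_induction with
    | mem P hP =>
      rcases hP with ⟨l, hl, rfl⟩ | ⟨i, rfl⟩
      · rw [act_boxOp a l hl]; exact zero_mem _
      · rw [act_eulerOp]
        exact Laurent.euler_mem_eulerImage α _ (by rw [Laurent.supp_univ]; trivial)
    | zero => rw [map_zero]; exact zero_mem _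
    | add P Q _ _ hP hQ => rw [map_add]; exact add_mem hP hQ
    | smul Q P _ hP =>
      rw [smul_eq_mul, map_mul, Module.End.mul_apply]
      exact act_mem_eulerImage a α Q hP
  · intro hP
    have h1 := h.2 ⟨(act_one_mem_supp_and_normalForm a P).1, hP⟩
    obtain ⟨Q, hQ, e⟩ : ∃ Q ∈ gkzIdeal a α, act a Q 1 = act a P 1 := by
      refine Laurent.eulerImage_induction α (P := fun w => ∃ Q ∈ gkzIdeal a α, act a Q 1 = w)
        ?_ ⟨0, zero_mem _, by simp⟩ ?_ h1
      · intro i w hw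
        obtain ⟨Q, rfl⟩ := exists_act_eq a hw
        refine ⟨Q * eulerOp a α i,
          Submodule.smul_mem _ _ (Submodule.subset_span (.inr ⟨i, rfl⟩)), ?_⟩
        rw [map_mul, Module.End.mul_apply, act_eulerOp, act_euler]
      · rintro _ _ ⟨Q, hQ, rfl⟩ ⟨R, hR, rfl⟩
        exact ⟨Q + R, add_mem hQ hR, by rw [map_add, LinearMap.add_apply]⟩
    have h2 : P - Q ∈ boxIdeal a := mem_boxIdeal_of_act_eq_zero a (by
      rw [map_sub, LinearMap.sub_apply, e, sub_self])
    have h3 : boxIdeal a ≤ gkzIdeal a α := Submodule.span_mono Set.subset_union_left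
    simpa using add_mem (h3 h2) hQ

/-- The class of the action on `1`. -/
noncomputable def actOne : Weyl N →ₗ[ℂ] Laurent N n ⧸ Laurent.eulerImage a α Set.univ :=
  ((Laurent.eulerImage a α Set.univ).mkQ.restrictScalars ℂ).comp
    ((LinearMap.applyₗ (1 : Laurent N n)).comp (act a).toLinearMap)

theorem actOne_apply (P : Weyl N) :
    actOne a α P = Submodule.Quotient.mk (act a P 1) := rfl

variable {a α}

theorem actOne_surjective (h : Laurent.EulerEquiv a α (Set.range (expSum a)) Set.univ) :
    Function.Surjective (actOne a α) := by
  intro y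
  obtain ⟨w, rfl⟩ := Submodule.Quotient.mk_surjective _ y
  obtain ⟨v, hv, z, hz, rfl⟩ := Submodule.mem_sup.1 (h.1 (by
    rw [Laurent.supp_univ]; trivial : w ∈ Laurent.supp N Set.univ))
  obtain ⟨P, rfl⟩ := exists_act_eq a hv
  refine ⟨P, ?_⟩
  rw [actOne_apply, Submodule.Quotient.eq, sub_add_cancel_left]
  exact neg_mem hz

/-- The hypergeometric module as a quotient of the Laurent polynomials. -/
noncomputable def gkzEquiv (h : Laurent.EulerEquiv a α (Set.range (expSum a)) Set.univ) :
    GKZ a α ≃ₗ[ℂ] Laurent N n ⧸ Laurent.eulerImage a α Set.univ :=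
  have hk : (gkzIdeal a α).restrictScalars ℂ = LinearMap.ker (actOne a α) := by
    ext P
    rw [LinearMap.mem_ker, actOne_apply, Submodule.Quotient.mk_eq_zero, ← mem_gkzIdeal_iff a α h]
    rfl
  (Submodule.Quotient.restrictScalarsEquiv ℂ (gkzIdeal a α)).symm.trans
    ((Submodule.quotEquivOfEq _ _ hk).trans
      ((actOne a α).quotKerEquivOfSurjective (actOne_surjective h)))

theorem gkzEquiv_mk (h : Laurent.EulerEquiv a α (Set.range (expSum a)) Set.univ) (P : Weyl N) :
    gkzEquiv h (Submodule.Quotient.mk P) = Submodule.Quotient.mk (act a P 1) := rfl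

end Quotient

end Weyl

/-! ### Functions, derivations and logarithmic coordinates on U. -/

/-- A derivation is determined on a multiplicative family of units by its values at generators. -/
theorem derivation_apply_of_multiplicative {A B M : Type} [CommRing A] [CommRing B] [Algebra A B]
    [AddCommGroup M] [Module B M] [Module A M] (d : Derivation A B M) {n : ℕ}
    (μ : (Fin n → ℤ) → B) (h0 : μ 0 = 1) (hadd : ∀ u v, μ (u + v) = μ u * μ v)
    (u : Fin n → ℤ) :
    d (μ u) = μ u • ∑ i, u i • μ (-Pi.single i 1) • d (μ (Pi.single i 1)) := by
  have hneg : ∀ u, μ u * μ (-u) = 1 := fun u => by rw [← hadd, add_neg_cancel, h0]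
  let L : (Fin n → ℤ) →+ M :=
    { toFun := fun u => μ (-u) • d (μ u)
      map_zero' := by rw [h0, d.map_one_eq_zero, smul_zero]
      map_add' := fun u v => by
        rw [hadd, d.leibniz, neg_add, hadd, smul_add, smul_smul, smul_smul, add_comm]
        congr 2
        · linear_combination μ (-u) * hneg v
        · linear_combination μ (-v) * hneg u }
  have hL : d (μ u) = μ u • L u := by
    change _ = μ u • μ (-u) • d (μ u)
    rw [smul_smul, hneg, one_smul]
  have hu : u = ∑ i, u i • (Pi.single i 1 : Fin n → ℤ) := by
    funext k
    simp [Finset.sum_apply, Pi.single_apply]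
  have hs : L u = ∑ i, u i • L (Pi.single i 1) := by
    conv_lhs => rw [hu]
    simp only [map_sum, map_zsmul]
  rw [hL, hs]
  rfl

namespace OU

variable {N m : ℕ} (g : Laurent N m)

theorem mon_add (u v : Fin m → ℤ) : mon g (u + v) = mon g u * mon g v := by
  rw [mon, mon, mon, ← map_mul, AddMonoidAlgebra.single_mul_single, one_mul]

theorem mon_zero : mon g 0 = 1 := by
  exact map_one (algebraMap (Laurent N m) (OU g))

theorem algebraMap_single (u : Fin m → ℤ) (p : PolyRing N) :
    algebraMap (Laurent N m) (OU g) (AddMonoidAlgebra.single u p) = p • mon g u := by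
  have : AddMonoidAlgebra.single u p = p • (Laurent.mon u : Laurent N m) := by simp
  rw [this, mon, Algebra.smul_def, Algebra.smul_def, map_mul,
    ← IsScalarTower.algebraMap_apply]

theorem gInv_mul_gU : gInv g * gU g = 1 := by rw [mul_comm, gU_mul_gInv]

/-- The function `g` as a unit on `U`. -/
noncomputable def gUnit : (OU g)ˣ := ⟨gU g, gInv g, gU_mul_gInv g, gInv_mul_gU g⟩

theorem exists_mul_gU_pow (b : OU g) :
    ∃ (k : ℕ) (p : Laurent N m), b * gU g ^ k = algebraMap (Laurent N m) (OU g) p := by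
  obtain ⟨k, p, h⟩ := IsLocalization.Away.surj g b
  exact ⟨k, p, h⟩

theorem derivation_eq_zero {R M : Type} [CommRing R] [Algebra R (OU g)] [AddCommGroup M]
    [Module (OU g) M] [Module R M] (d : Derivation R (OU g) M)
    (h : ∀ p, d (algebraMap (Laurent N m) (OU g) p) = 0) (b : OU g) : d b = 0 := by
  obtain ⟨k, p, hp⟩ := exists_mul_gU_pow g b
  have h1 := congrArg d hp
  have h2 : d (gU g ^ k) = 0 := by rw [gU, ← map_pow, h]
  rw [h, d.leibniz, h2, smul_zero, zero_add] at h1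
  have h3 := congrArg (fun z => gInv g ^ k • z) h1
  simpa [smul_smul, ← mul_pow, gInv_mul_gU] using h3

/-- The extension to `U` of a derivation of the Laurent polynomials. -/
noncomputable def extDer (d : Derivation (PolyRing N) (Laurent N m) (Laurent N m)) :
    Derivation (PolyRing N) (OU g) (OU g) :=
  ((((Algebra.linearMap (Laurent N m) (OU g)).compDer
    d).liftKaehlerDifferential.liftBaseChange (OU g)).comp
      (KaehlerDifferential.tensorKaehlerEquivOfFormallyEtale (PolyRing N) (Laurent N m)
        (OU g)).symm.toLinearMap).compDer (KaehlerDifferential.D (PolyRing N) (OU g))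

theorem extDer_algebraMap (d : Derivation (PolyRing N) (Laurent N m) (Laurent N m))
    (p : Laurent N m) : extDer g d (algebraMap (Laurent N m) (OU g) p) =
      algebraMap (Laurent N m) (OU g) (d p) := by
  simp [extDer, KaehlerDifferential.tensorKaehlerEquivOfFormallyEtale_symm_D_algebraMap]

/-- The derivation `x_i ∂/∂x_i` on `U`. -/
noncomputable def dlog (i : Fin m) : Derivation (PolyRing N) (OU g) (OU g) :=
  extDer g (Laurent.toric (Pi.single i 1))

theorem dlog_algebraMap (i : Fin m) (p : Laurent N m) :
    dlog g i (algebraMap (Laurent N m) (OU g) p) =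
      algebraMap (Laurent N m) (OU g) (Laurent.toric (Pi.single i 1) p) :=
  extDer_algebraMap g _ p

theorem dlog_mon (i : Fin m) (u : Fin m → ℤ) : dlog g i (mon g u) = (u i : ℂ) • mon g u := by
  rw [mon, dlog_algebraMap, Laurent.toric_single]
  simp only [Pi.single_apply, ite_mul, one_mul, zero_mul, Finset.sum_ite_eq', Finset.mem_univ,
    if_true]
  rw [Algebra.smul_def, Algebra.smul_def, map_mul,
    ← IsScalarTower.algebraMap_apply ℂ (Laurent N m) (OU g)]

/-- The coordinates on `U`. -/
noncomputable def frame : LogFrame (PolyRing N) (OU g) m where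
  x i := ⟨mon g (Pi.single i 1), mon g (-Pi.single i 1),
    by rw [← mon_add, add_neg_cancel, mon_zero], by rw [← mon_add, neg_add_cancel, mon_zero]⟩
  δ := dlog g
  δ_x i k := by
    change dlog g i (mon g (Pi.single k 1)) = _
    rw [dlog_mon]
    by_cases h : i = k
    · subst h; simp
    · simp [h]
  D_eq b := by
    let T : Fin m → Ω[OU g⁄PolyRing N] := fun i => mon g (-Pi.single i 1) •
      KaehlerDifferential.D (PolyRing N) (OU g) (mon g (Pi.single i 1))
    -- The defect of the desired formula is itself a derivation on the localization, so it suffices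
    -- to see that it vanishes on monomials.
    let d : Derivation (PolyRing N) (OU g) (Ω[OU g⁄PolyRing N]) :=
      (LinearMap.id - ∑ i, (dlog g i).liftKaehlerDifferential.smulRight (T i)).compDer
        (KaehlerDifferential.D (PolyRing N) (OU g))
    have hd : ∀ b, d b = KaehlerDifferential.D (PolyRing N) (OU g) b - ∑ i, dlog g i b • T i :=
      fun b => by simp [d, Derivation.liftKaehlerDifferential_comp_D]
    have h := derivation_eq_zero g d (fun p => ?_) b
    · rw [hd, sub_eq_zero] at h
      exact h
    · induction p using AddMonoidAlgebra.induction_linear with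
      | zero => simp
      | add p q hp hq => rw [map_add, map_add, hp, hq, add_zero]
      | single u p =>
        rw [algebraMap_single, Derivation.map_smul, hd,
          derivation_apply_of_multiplicative (KaehlerDifferential.D (PolyRing N) (OU g)) (mon g)
            (mon_zero g) (mon_add g), Finset.smul_sum, sub_eq_zero.2, smul_zero]
        refine Finset.sum_congr rfl fun i _ => ?_
        rw [dlog_mon, smul_comm, smul_assoc, Int.cast_smul_eq_zsmul]

theorem frame_τ (i : Fin m) : (frame g).τ i = mon g (-Pi.single i 1) •
    KaehlerDifferential.D (PolyRing N) (OU g) (mon g (Pi.single i 1)) := rfl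

/-- The coefficients of the form `η` with respect to the `dx_i/x_i`. -/
noncomputable def etaCoeff (β : Fin (m + 1) → ℂ) (i : Fin m) : OU g :=
  algebraMap ℂ (OU g) (β i.castSucc) -
    algebraMap ℂ (OU g) (β (Fin.last m)) * (gInv g * dlog g i (gU g))

theorem eta_eq (β : Fin (m + 1) → ℂ) : eta g β = ∑ i, etaCoeff g β i • (frame g).τ i := by
  have h : KaehlerDifferential.D (PolyRing N) (OU g) (gU g) =
      ∑ i, dlog g i (gU g) • (frame g).τ i := (frame g).D_eq' _
  simp only [etaCoeff, sub_smul, Finset.sum_sub_distrib]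
  rw [eta, h, Finset.smul_sum]
  refine congrArg₂ (· - ·) (Finset.sum_congr rfl fun i _ => ?_) (Finset.sum_congr rfl fun i _ => ?_)
  · rw [frame_τ, smul_smul]
  · rw [smul_smul, mul_assoc]

/-- The function `x_1^{u_1} ⋯ x_m^{u_m} g^{-u_{m+1}}` on `U`. -/
noncomputable def emon (u : Fin (m + 1) → ℤ) : OU g :=
  mon g (Fin.init u) * ((gUnit g ^ (-u (Fin.last m)) : (OU g)ˣ) : OU g)

theorem emon_zero : emon g 0 = 1 := by
  have : Fin.init (0 : Fin (m + 1) → ℤ) = 0 := rfl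
  rw [emon, this, mon_zero]; simp

theorem emon_add (u v : Fin (m + 1) → ℤ) : emon g (u + v) = emon g u * emon g v := by
  have : Fin.init (u + v) = Fin.init u + Fin.init v := rfl
  rw [emon, this, mon_add, Pi.add_apply, neg_add, zpow_add, Units.val_mul, emon, emon]
  ring

theorem emon_last : emon g (Pi.single (Fin.last m) 1) = gInv g := by
  have : Fin.init (Pi.single (Fin.last m) 1 : Fin (m + 1) → ℤ) = 0 := by
    funext i; simp [Fin.init, Fin.castSucc_ne_last]
  rw [emon, this, mon_zero]
  simp [gUnit]

theorem emon_neg_last : emon g (-Pi.single (Fin.last m) 1) = gU g := by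
  have : Fin.init (-Pi.single (Fin.last m) 1 : Fin (m + 1) → ℤ) = 0 := by
    funext i; simp [Fin.init, Fin.castSucc_ne_last]
  rw [emon, this, mon_zero]
  simp [gUnit]

theorem init_single (i : Fin m) :
    Fin.init (Pi.single i.castSucc 1 : Fin (m + 1) → ℤ) = Pi.single i 1 := by
  funext k
  simp [Fin.init, Pi.single_apply]

theorem emon_castSucc (i : Fin m) : emon g (Pi.single i.castSucc 1) = mon g (Pi.single i 1) := by
  rw [emon, init_single]
  simp [(Fin.castSucc_lt_last i).ne']

theorem emon_neg_castSucc (i : Fin m) :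
    emon g (-Pi.single i.castSucc 1) = mon g (-Pi.single i 1) := by
  have : Fin.init (-Pi.single i.castSucc 1 : Fin (m + 1) → ℤ) =
    -Fin.init (Pi.single i.castSucc 1 : Fin (m + 1) → ℤ) := rfl
  rw [emon, this, init_single]
  simp [(Fin.castSucc_lt_last i).ne']

theorem emon_expHom (u : Fin m → ℤ) : emon g (Laurent.expHom m 1 u) = mon g u := by
  have : Fin.init (Laurent.expHom m 1 u) = u := by
    funext i; simp [Fin.init, Laurent.expHom]
  rw [emon, this]
  simp [Laurent.expHom]

/-- The logarithmic derivative is additive, and the last coordinate stands for 1/g, whence the minus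
sign. -/
theorem derivation_emon {R : Type} [CommRing R] [Algebra R (OU g)]
    (d : Derivation R (OU g) (OU g)) (u : Fin (m + 1) → ℤ) :
    d (emon g u) = emon g u * ((∑ i : Fin m, (u i.castSucc : OU g) *
      (mon g (-Pi.single i 1) * d (mon g (Pi.single i 1)))) -
        (u (Fin.last m) : OU g) * (gInv g * d (gU g))) := by
  have h : d (gInv g) = -gInv g ^ 2 * d (gU g) := d.leibniz_of_mul_eq_one (gInv_mul_gU g)
  rw [derivation_apply_of_multiplicative d (emon g) (emon_zero g) (emon_add g),
    Fin.sum_univ_castSucc, emon_last, emon_neg_last, h, smul_eq_mul]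
  congr 1
  simp only [emon_castSucc, emon_neg_castSucc, smul_eq_mul, zsmul_eq_mul, sub_eq_add_neg]
  congr 1
  linear_combination -(u (Fin.last m) : OU g) * (gInv g * d (gU g)) * gU_mul_gInv g

theorem dlog_emon (i : Fin m) (u : Fin (m + 1) → ℤ) : dlog g i (emon g u) =
    emon g u * (u i.castSucc - u (Fin.last m) * (gInv g * dlog g i (gU g))) := by
  rw [derivation_emon, Finset.sum_eq_single i]
  · rw [dlog_mon, mul_smul_comm, ← mon_add, neg_add_cancel, mon_zero]; simp
  · intro k _ hk
    rw [dlog_mon]; simp [hk.symm]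
  · simp

theorem der_emon (j : Fin N) (u : Fin (m + 1) → ℤ) : der g j (emon g u) =
    emon g u * -(u (Fin.last m) * (gInv g * der g j (gU g))) := by
  rw [derivation_emon]
  simp [der_mon]

end OU

/-! ### Integrating out x_n. -/

theorem exists_linearEquiv_of_ker_eq {R M P Q : Type*} [Ring R] [AddCommGroup M] [AddCommGroup P]
    [AddCommGroup Q] [Module R M] [Module R P] [Module R Q] (p : M →ₗ[R] P) (q : M →ₗ[R] Q)
    (hp : Function.Surjective p) (hq : Function.Surjective q)
    (h : LinearMap.ker p = LinearMap.ker q) : ∃ e : P ≃ₗ[R] Q, ∀ x, e (p x) = q x := by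
  refine ⟨(p.quotKerEquivOfSurjective hp).symm.trans
    ((Submodule.quotEquivOfEq _ _ h).trans (q.quotKerEquivOfSurjective hq)), fun x => ?_⟩
  have : (p.quotKerEquivOfSurjective hp).symm (p x) = Submodule.Quotient.mk x := by
    rw [LinearEquiv.symm_apply_eq]
    rfl
  rw [LinearEquiv.trans_apply, LinearEquiv.trans_apply, this]
  rfl

namespace Laurent

variable {N m : ℕ}

theorem subst_single (D : ℕ) (u : Fin m → ℤ) (p : PolyRing N) :
    subst D (AddMonoidAlgebra.single u p) = AddMonoidAlgebra.single (expHom m D u) p := by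
  simp [subst]

theorem subst_one_single (u : Fin m → ℤ) (p : PolyRing N) :
    subst 1 (AddMonoidAlgebra.single u p) = AddMonoidAlgebra.single (expHom m 1 u) p :=
  subst_single 1 u p

theorem toric_castSucc_subst (D : ℕ) (i : Fin m) (h : Laurent N m) :
    toric (Pi.single i.castSucc 1) (subst D h) = (D : ℂ) • subst D (toric (Pi.single i 1) h) := by
  induction h using AddMonoidAlgebra.induction_linear with
  | zero => simp
  | add p q hp hq => simp only [map_add, hp, hq, smul_add]
  | single u p =>
    rw [subst_single, toric_single, toric_single, ← algebraMap_smul (PolyRing N) (∑ i, _ : ℂ)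
      (AddMonoidAlgebra.single u p), map_smul, subst_single, algebraMap_smul, smul_smul]
    congr 1
    simp [Pi.single_apply, expHom]

theorem toric_castSucc_subst_one (i : Fin m) (h : Laurent N m) :
    toric (Pi.single i.castSucc 1) (subst 1 h) = subst 1 (toric (Pi.single i 1) h) := by
  rw [toric_castSucc_subst, Nat.cast_one, one_smul]

theorem toric_last_subst (D : ℕ) (c : ℂ) (h : Laurent N m) :
    toric (Pi.single (Fin.last m) c) (subst D h) = 0 := by
  induction h using AddMonoidAlgebra.induction_linear with
  | zero => simp
  | add p q hp hq => simp only [map_add, hp, hq, add_zero]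
  | single u p =>
    rw [subst_single, toric_single]
    simp [Pi.single_apply, expHom]

theorem coefLin_subst (D : ℕ) (j : Fin N) (h : Laurent N m) :
    coefLin (m + 1) j (subst D h) = subst D (coefLin m j h) := by
  induction h using AddMonoidAlgebra.induction_linear with
  | zero => simp
  | add p q hp hq => simp only [map_add, hp, hq]
  | single u p => simp [subst, coefLin_single]

theorem toric_single_one (i : Fin m) (u : Fin m → ℤ) (p : PolyRing N) :
    toric (Pi.single i 1) (AddMonoidAlgebra.single u p) =
      (u i : ℂ) • AddMonoidAlgebra.single u p := by
  rw [toric_single]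
  simp [Pi.single_apply]

end Laurent

namespace OU

variable {N m : ℕ} {g : Laurent N m} {a : Fin N → Fin (m + 1) → ℤ} {α : Fin (m + 1) → ℂ}

section Residue

variable (g) (α) (k₀ : ℤ)

/-- The factors `γ_k` with `γ_{k+1} = -(k - α_n) γ_k`, up to a constant the values
`(-1)^k Γ(k - α_n)`. -/
noncomputable def gam (s : ℂ) (k₀ k : ℤ) : ℂ :=
  ∏ i ∈ Finset.range (k - k₀).toNat, -((k₀ + i : ℤ) - s)

/-- For k < k₀ the truncated difference makes `gam` constantly 1 and the recursion can fail; hence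
the restriction to exponents with u_n ≥ k₀. -/
theorem gam_succ (s : ℂ) {k₀ k : ℤ} (hk : k₀ ≤ k) :
    gam s k₀ (k + 1) = -((k : ℂ) - s) * gam s k₀ k := by
  have h : (k + 1 - k₀).toNat = (k - k₀).toNat + 1 := by omega
  have h2 : k₀ + ((k - k₀).toNat : ℤ) = k := by omega
  rw [gam, h, Finset.prod_range_succ, h2, mul_comm]
  rfl

theorem gam_ne_zero {s : ℂ} {k₀ : ℤ} (h : ∀ k : ℤ, k₀ ≤ k → (k : ℂ) ≠ s) (k : ℤ) :
    gam s k₀ k ≠ 0 :=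
  Finset.prod_ne_zero_iff.2 fun i _ => neg_ne_zero.2 (sub_ne_zero.2 (h _ (by omega)))

/-- The map `p(λ) x^u ↦ γ_{u_n} p(λ) x_1^{u_1} ⋯ x_m^{u_m} g^{-u_n}`, up to a constant the integral
over `x_n` against `x_n^{-α_n} e^{x_n g} dx_n/x_n`. -/
noncomputable def residue : Laurent N (m + 1) →ₗ[PolyRing N] OU g :=
  Laurent.linLift fun u => gam (α (Fin.last m)) k₀ (u (Fin.last m)) • emon g u

theorem residue_single (u : Fin (m + 1) → ℤ) (p : PolyRing N) :
    residue g α k₀ (AddMonoidAlgebra.single u p) =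
      p • gam (α (Fin.last m)) k₀ (u (Fin.last m)) • emon g u := Laurent.linLift_single _ _ _

/-- Integration by parts in x_n: a factor x_n raises u_n by one, which costs -(u_n - α_n) in the
Gamma factor and 1/g in the function. -/
theorem residue_mul_single (h : Laurent N m) (u : Fin (m + 1) → ℤ) (p : PolyRing N)
    (hu : k₀ ≤ u (Fin.last m)) :
    residue g α k₀ (Laurent.mon (Pi.single (Fin.last m) 1) * Laurent.subst 1 h *
      AddMonoidAlgebra.single u p) =
      -(algebraMap ℂ (OU g) (u (Fin.last m) - α (Fin.last m)) *
        (gInv g * algebraMap (Laurent N m) (OU g) h) *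
          residue g α k₀ (AddMonoidAlgebra.single u p)) := by
  induction h using AddMonoidAlgebra.induction_linear with
  | zero => simp
  | add p q hp hq => rw [map_add, mul_add, add_mul, map_add, hp, hq, map_add]; ring
  | single v q =>
    rw [Laurent.subst_one_single, AddMonoidAlgebra.single_mul_single,
      AddMonoidAlgebra.single_mul_single, residue_single, residue_single, emon_add, emon_add,
      emon_last, emon_expHom, algebraMap_single]
    have h1 : (Pi.single (Fin.last m) 1 + Laurent.expHom m 1 v + u : Fin (m + 1) → ℤ) (Fin.last m) =
        u (Fin.last m) + 1 := by
      simp [Laurent.expHom, add_comm]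
    rw [h1, gam_succ _ hu]
    simp only [Algebra.smul_def, map_mul, map_neg, one_mul]
    ring

end Residue

/-- The exponents `u` with `u_n ≥ k₀`. -/
def upper (m : ℕ) (k₀ : ℤ) : Set (Fin (m + 1) → ℤ) := {u | k₀ ≤ u (Fin.last m)}

variable {k₀ : ℤ}

theorem upper_stable (h1 : ∀ j, a j (Fin.last m) = 1) : Laurent.Stable a (upper m k₀) := by
  intro u hu j
  have : k₀ ≤ u (Fin.last m) := hu
  change k₀ ≤ a j (Fin.last m) + u (Fin.last m)
  rw [h1]
  omega

theorem dlog_residue_single (i : Fin m) (u : Fin (m + 1) → ℤ) (p : PolyRing N) :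
    dlog g i (residue g α k₀ (AddMonoidAlgebra.single u p)) =
      residue g α k₀ (AddMonoidAlgebra.single u p) *
        (u i.castSucc - u (Fin.last m) * (gInv g * dlog g i (gU g))) := by
  rw [residue_single, ← algebraMap_smul (PolyRing N) (gam _ _ _), Derivation.map_smul,
    Derivation.map_smul, dlog_emon, smul_mul_assoc, smul_mul_assoc]

theorem der_smul (j : Fin N) (p : PolyRing N) (b : OU g) :
    der g j (p • b) = p • der g j b + MvPolynomial.pderiv j p • b := by
  rw [Algebra.smul_def, Derivation.leibniz, der_poly, smul_eq_mul, smul_eq_mul, Algebra.smul_def,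
    Algebra.smul_def, mul_comm b]

theorem der_residue_single (j : Fin N) (u : Fin (m + 1) → ℤ) (p : PolyRing N) :
    der g j (residue g α k₀ (AddMonoidAlgebra.single u p)) =
      residue g α k₀ (AddMonoidAlgebra.single u (MvPolynomial.pderiv j p)) -
        residue g α k₀ (AddMonoidAlgebra.single u p) *
          (u (Fin.last m) * (gInv g * der g j (gU g))) := by
  rw [residue_single, residue_single, der_smul, Derivation.map_smul, der_emon]
  simp only [Algebra.smul_def]
  ring

theorem toric_generic_castSucc
    (hf : Laurent.generic a = Laurent.mon (Pi.single (Fin.last m) 1) * Laurent.subst 1 g)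
    (i : Fin m) : Laurent.toric (Pi.single i.castSucc 1) (Laurent.generic a) =
      Laurent.mon (Pi.single (Fin.last m) 1) *
        Laurent.subst 1 (Laurent.toric (Pi.single i 1) g) := by
  rw [hf, Derivation.leibniz, Laurent.toric_castSucc_subst_one, Laurent.toric_single_one]
  simp [(Fin.castSucc_lt_last i).ne]

theorem toric_generic_last
    (hf : Laurent.generic a = Laurent.mon (Pi.single (Fin.last m) 1) * Laurent.subst 1 g) :
    Laurent.toric (Pi.single (Fin.last m) 1) (Laurent.generic a) =
      Laurent.mon (Pi.single (Fin.last m) 1) * Laurent.subst 1 g := by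
  rw [hf, Derivation.leibniz, Laurent.toric_last_subst, Laurent.toric_single_one]
  simp [mul_comm]

theorem mon_exponent
    (hf : Laurent.generic a = Laurent.mon (Pi.single (Fin.last m) 1) * Laurent.subst 1 g)
    (j : Fin N) : Laurent.mon (a j) =
      Laurent.mon (Pi.single (Fin.last m) 1) * Laurent.subst 1 (Laurent.coefLin m j g) := by
  rw [← Laurent.coefLin_generic, hf, Laurent.coefLin_mul, Laurent.coefLin_single,
    Laurent.coefLin_subst]
  simp

theorem residue_algebraMap_mul (r : ℂ) (w : Laurent N (m + 1)) :
    residue g α k₀ (algebraMap ℂ _ r * w) = algebraMap ℂ (OU g) r * residue g α k₀ w := by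
  rw [← Algebra.smul_def, ← Algebra.smul_def]
  exact ((residue g α k₀).restrictScalars ℂ).map_smul r w

/-- The term x_n (x_i ∂g/∂x_i) of E_i becomes -(u_n - α_n) times the logarithmic derivative of g.
The part with u_n comes from differentiating g^{-u_n}; the part with α_n is the twist. -/
theorem residue_euler_castSucc
    (hf : Laurent.generic a = Laurent.mon (Pi.single (Fin.last m) 1) * Laurent.subst 1 g)
    (i : Fin m) {w : Laurent N (m + 1)} (hw : w ∈ Laurent.supp N (upper m k₀)) :
    residue g α k₀ (Laurent.euler a α (Pi.single i.castSucc 1) w) =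
      (frame g).op (etaCoeff g (-α)) i (residue g α k₀ w) := by
  refine Laurent.supp_induction (P := fun w => residue g α k₀ (Laurent.euler a α _ w) =
    (frame g).op (etaCoeff g (-α)) i (residue g α k₀ w)) ?_ (by simp) ?_ hw
  · intro u hu p
    have h1 : ∑ k, (Pi.single i.castSucc 1 : Fin (m + 1) → ℂ) k * α k = α i.castSucc := by
      simp [Pi.single_apply]
    have h2 : residue g α k₀ ((u i.castSucc : ℂ) • AddMonoidAlgebra.single u p) =
        (u i.castSucc : OU g) * residue g α k₀ (AddMonoidAlgebra.single u p) := by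
      rw [Algebra.smul_def, residue_algebraMap_mul, map_intCast]
    rw [Laurent.euler_apply, toric_generic_castSucc hf, h1, sub_mul, map_add, map_sub,
      residue_mul_single _ _ _ _ _ _ hu, residue_algebraMap_mul, Laurent.toric_single_one, h2,
      LogFrame.op_apply]
    change _ = dlog g i _ + _
    rw [dlog_residue_single, etaCoeff, gU, dlog_algebraMap]
    simp only [Pi.neg_apply, map_neg, map_sub, map_intCast]
    ring
  · intro v w hv hw
    rw [map_add, map_add, hv, hw, map_add, map_add]

/-- The integral of a total derivative in x_n: the contribution -(u_n - α_n) g/g of x_n g cancels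
the diagonal scalar u_n - α_n. -/
theorem residue_euler_last
    (hf : Laurent.generic a = Laurent.mon (Pi.single (Fin.last m) 1) * Laurent.subst 1 g)
    {w : Laurent N (m + 1)} (hw : w ∈ Laurent.supp N (upper m k₀)) :
    residue g α k₀ (Laurent.euler a α (Pi.single (Fin.last m) 1) w) = 0 := by
  refine Laurent.supp_induction (P := fun w => residue g α k₀ (Laurent.euler a α _ w) = 0)
    ?_ (by simp) ?_ hw
  · intro u hu p
    have h1 : ∑ k, (Pi.single (Fin.last m) 1 : Fin (m + 1) → ℂ) k * α k = α (Fin.last m) := by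
      simp [Pi.single_apply]
    have h2 : residue g α k₀ ((u (Fin.last m) : ℂ) • AddMonoidAlgebra.single u p) =
        (u (Fin.last m) : OU g) * residue g α k₀ (AddMonoidAlgebra.single u p) := by
      rw [Algebra.smul_def, residue_algebraMap_mul, map_intCast]
    have h3 : gInv g * algebraMap (Laurent N m) (OU g) g = 1 := gInv_mul_gU g
    rw [Laurent.euler_apply, toric_generic_last hf, h1, sub_mul, map_add, map_sub,
      residue_mul_single _ _ _ _ _ _ hu, residue_algebraMap_mul, Laurent.toric_single_one, h2, h3]
    simp only [map_sub, map_intCast]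
    ring
  · intro v w hv hw
    rw [map_add, map_add, hv, hw, add_zero]

/-- Since x^{a_j} = x_n ∂g/∂λ_j, it contributes -(u_n - α_n) (∂_j g)/g, which splits into the
derivative of g^{-u_n} and the function `shift`. -/
theorem residue_parOp
    (hf : Laurent.generic a = Laurent.mon (Pi.single (Fin.last m) 1) * Laurent.subst 1 g)
    (j : Fin N) {w : Laurent N (m + 1)} (hw : w ∈ Laurent.supp N (upper m k₀)) :
    residue g α k₀ (Laurent.parOp a j w) =
      der g j (residue g α k₀ w) + shift g (-α) j * residue g α k₀ w := by
  refine Laurent.supp_induction (P := fun w => residue g α k₀ (Laurent.parOp a j w) =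
    der g j (residue g α k₀ w) + shift g (-α) j * residue g α k₀ w) ?_ (by simp) ?_ hw
  · intro u hu p
    have h1 : der g j (gU g) = algebraMap (Laurent N m) (OU g) (Laurent.coefLin m j g) :=
      der_algebraMap g j g
    rw [Laurent.parOp_apply, mon_exponent hf, map_add, Laurent.coefLin_single,
      residue_mul_single _ _ _ _ _ _ hu, der_residue_single, shift, h1]
    simp only [Pi.neg_apply, map_neg, map_sub, map_intCast]
    ring
  · intro v w hv hw
    rw [map_add, map_add, hv, hw, map_add, map_add]
    ring

theorem mon_mul_subst_mem (k : ℤ) (hk : k₀ ≤ k) (h : Laurent N m) :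
    Laurent.mon (Pi.single (Fin.last m) k) * Laurent.subst 1 h ∈ Laurent.supp N (upper m k₀) := by
  induction h using AddMonoidAlgebra.induction_linear with
  | zero => simp
  | add p q hp hq => rw [map_add, mul_add]; exact add_mem hp hq
  | single v q =>
    rw [Laurent.subst_one_single, AddMonoidAlgebra.single_mul_single]
    refine Laurent.single_mem_supp ?_ _
    simp [upper, Laurent.expHom, hk]

theorem euler_last_mon_mul_subst
    (hf : Laurent.generic a = Laurent.mon (Pi.single (Fin.last m) 1) * Laurent.subst 1 g)
    (k : ℤ) (h : Laurent N m) :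
    Laurent.euler a α (Pi.single (Fin.last m) 1)
      (Laurent.mon (Pi.single (Fin.last m) k) * Laurent.subst 1 h) =
      ((k : ℂ) - α (Fin.last m)) • (Laurent.mon (Pi.single (Fin.last m) k) * Laurent.subst 1 h) +
        Laurent.mon (Pi.single (Fin.last m) (k + 1)) * Laurent.subst 1 (g * h) := by
  have h1 : ∑ k, (Pi.single (Fin.last m) 1 : Fin (m + 1) → ℂ) k * α k = α (Fin.last m) := by
    simp [Pi.single_apply]
  have h2 : (Laurent.mon (Pi.single (Fin.last m) (k + 1)) : Laurent N (m + 1)) =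
      Laurent.mon (Pi.single (Fin.last m) 1) * Laurent.mon (Pi.single (Fin.last m) k) := by
    rw [AddMonoidAlgebra.single_mul_single, ← Pi.single_add, one_mul, add_comm k 1]
  rw [Laurent.euler_apply, toric_generic_last hf, h1, Derivation.leibniz, Laurent.toric_last_subst,
    Laurent.toric_single_one, h2, map_mul, Pi.single_eq_same]
  simp only [smul_eq_mul, Algebra.smul_def, map_sub, sub_mul]
  ring

/-- Modulo the image of the last Euler operator, Laurent polynomials can be moved into any
sufficiently high degree in `x_n`. -/
theorem exists_sub_mem_map_euler
    (hf : Laurent.generic a = Laurent.mon (Pi.single (Fin.last m) 1) * Laurent.subst 1 g)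
    (hk₀ : ∀ k : ℤ, k₀ ≤ k → (k : ℂ) ≠ α (Fin.last m)) {w : Laurent N (m + 1)}
    (hw : w ∈ Laurent.supp N (upper m k₀)) : ∃ K : ℤ, k₀ ≤ K ∧ ∀ k, K ≤ k → ∃ h : Laurent N m,
      w - Laurent.mon (Pi.single (Fin.last m) k) * Laurent.subst 1 h ∈
        (Laurent.supp N (upper m k₀)).map (Laurent.euler a α (Pi.single (Fin.last m) 1)) := by
  refine Laurent.supp_induction (P := fun w => ∃ K : ℤ, k₀ ≤ K ∧ ∀ k, K ≤ k → ∃ h : Laurent N m,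
      w - Laurent.mon (Pi.single (Fin.last m) k) * Laurent.subst 1 h ∈
        (Laurent.supp N (upper m k₀)).map (Laurent.euler a α (Pi.single (Fin.last m) 1)))
    ?_ ⟨k₀, le_rfl, fun k _ => ⟨0, by simp⟩⟩ ?_ hw
  · intro u hu p
    refine ⟨u (Fin.last m), hu, fun k hk => ?_⟩
    induction k, hk using Int.leInduction with
    | base =>
      refine ⟨AddMonoidAlgebra.single (Fin.init u) p, ?_⟩
      have : Pi.single (Fin.last m) (u (Fin.last m)) + Laurent.expHom m 1 (Fin.init u) = u := by
        funext i
        refine Fin.lastCases ?_ (fun i => ?_) i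
        · simp [Laurent.expHom]
        · simp [Laurent.expHom, (Fin.castSucc_lt_last i).ne, Fin.init]
      rw [Laurent.subst_one_single, AddMonoidAlgebra.single_mul_single, this, one_mul, sub_self]
      exact zero_mem _
    | succ k hk ih =>
      obtain ⟨h, hh⟩ := ih
      have hk' : k₀ ≤ k := le_trans hu hk
      have hne := sub_ne_zero.2 (hk₀ k hk')
      -- E_n maps x_n^k h to (k - α_n) x_n^k h + x_n^{k+1} g h, so modulo its image x_n^k h can be
      -- traded for a multiple of x_n^{k+1} g h, provided k ≠ α_n.
      refine ⟨-((k : ℂ) - α (Fin.last m))⁻¹ • (g * h), ?_⟩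
      have h1 : Laurent.euler a α (Pi.single (Fin.last m) 1)
          (((k : ℂ) - α (Fin.last m))⁻¹ •
            (Laurent.mon (Pi.single (Fin.last m) k) * Laurent.subst 1 h)) =
          Laurent.mon (Pi.single (Fin.last m) k) * Laurent.subst 1 h +
            ((k : ℂ) - α (Fin.last m))⁻¹ •
              (Laurent.mon (Pi.single (Fin.last m) (k + 1)) * Laurent.subst 1 (g * h)) := by
        refine (((Laurent.euler a α (Pi.single (Fin.last m) 1)).restrictScalars ℂ).map_smul
          _ _).trans ?_
        rw [LinearMap.restrictScalars_apply, euler_last_mon_mul_subst hf, smul_add, smul_smul,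
          inv_mul_cancel₀ hne, one_smul]
      have h2 : Laurent.subst 1 (-((k : ℂ) - α (Fin.last m))⁻¹ • (g * h)) =
          -((k : ℂ) - α (Fin.last m))⁻¹ • Laurent.subst 1 (g * h) :=
        ((Laurent.subst 1).toLinearMap.restrictScalars ℂ).map_smul _ _
      have h3 := add_mem hh (Submodule.mem_map_of_mem
        (f := Laurent.euler a α (Pi.single (Fin.last m) 1))
        (Submodule.smul_of_tower_mem _ ((k : ℂ) - α (Fin.last m))⁻¹
          (mon_mul_subst_mem k hk' h)))
      rw [h1, ← add_assoc, sub_add_cancel] at h3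
      have h4 : ∀ (c : ℂ) (x y : Laurent N (m + 1)), x * (-c • y) = -(c • (x * y)) :=
        fun c x y => by rw [mul_smul_comm]; exact neg_smul c _
      rw [h2, h4, sub_neg_eq_add]
      exact h3
  · rintro v w ⟨K, hK, h⟩ ⟨K', hK', h'⟩
    -- The statement covers all degrees from some K on, precisely so that two summands can be
    -- brought to a common degree.
    refine ⟨max K K', le_max_of_le_left hK, fun k hk => ?_⟩
    obtain ⟨x, hx⟩ := h k ((le_max_left _ _).trans hk)
    obtain ⟨y, hy⟩ := h' k ((le_max_right _ _).trans hk)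
    refine ⟨x + y, ?_⟩
    rw [map_add, mul_add, add_sub_add_comm]
    exact add_mem hx hy

theorem residue_mon_mul_subst (k : ℤ) (h : Laurent N m) :
    residue g α k₀ (Laurent.mon (Pi.single (Fin.last m) k) * Laurent.subst 1 h) =
      algebraMap ℂ (OU g) (gam (α (Fin.last m)) k₀ k) * emon g (Pi.single (Fin.last m) k) *
        algebraMap (Laurent N m) (OU g) h := by
  induction h using AddMonoidAlgebra.induction_linear with
  | zero => simp
  | add p q hp hq => rw [map_add, mul_add, map_add, hp, hq, map_add]; ring
  | single v q =>
    rw [Laurent.subst_one_single, AddMonoidAlgebra.single_mul_single, residue_single, emon_add,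
      emon_expHom, algebraMap_single, one_mul]
    have : (Pi.single (Fin.last m) k + Laurent.expHom m 1 v : Fin (m + 1) → ℤ) (Fin.last m) = k := by
      simp [Laurent.expHom]
    rw [this]
    simp only [Algebra.smul_def]
    ring

theorem emon_mul_neg (u : Fin (m + 1) → ℤ) : emon g u * emon g (-u) = 1 := by
  rw [← emon_add, add_neg_cancel, emon_zero]

/-- Modulo the image of E_n the polynomial is x_n^K h for a single degree K. There the residue is a
nonzero constant times g^{-K} h, and this vanishes only for h = 0, since Laurent polynomials embed
in the localization at g ≠ 0. -/
theorem residue_ker (hg : g ≠ 0)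
    (hf : Laurent.generic a = Laurent.mon (Pi.single (Fin.last m) 1) * Laurent.subst 1 g)
    (hk₀ : ∀ k : ℤ, k₀ ≤ k → (k : ℂ) ≠ α (Fin.last m)) {w : Laurent N (m + 1)}
    (hw : w ∈ Laurent.supp N (upper m k₀)) (h0 : residue g α k₀ w = 0) :
    w ∈ (Laurent.supp N (upper m k₀)).map (Laurent.euler a α (Pi.single (Fin.last m) 1)) := by
  obtain ⟨K, -, hK⟩ := exists_sub_mem_map_euler hf hk₀ hw
  obtain ⟨h, v, hv, e⟩ := hK K le_rfl
  have h1 := residue_euler_last (α := α) hf hv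
  rw [e, map_sub, h0, zero_sub, neg_eq_zero, residue_mon_mul_subst] at h1
  have h2 : algebraMap (Laurent N m) (OU g) h = 0 := by
    have hγ := gam_ne_zero hk₀ K
    have h3 := congrArg (fun z => algebraMap ℂ (OU g) (gam (α (Fin.last m)) k₀ K)⁻¹ *
      emon g (-Pi.single (Fin.last m) K) * z) h1
    have h4 : algebraMap ℂ (OU g) (gam (α (Fin.last m)) k₀ K)⁻¹ *
        algebraMap ℂ (OU g) (gam (α (Fin.last m)) k₀ K) = 1 := by
      rw [← map_mul, inv_mul_cancel₀ hγ, map_one]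
    rw [mul_zero] at h3
    rw [← h3]
    linear_combination -(algebraMap (Laurent N m) (OU g) h) * h4 -
      algebraMap (Laurent N m) (OU g) h * algebraMap ℂ (OU g) (gam (α (Fin.last m)) k₀ K)⁻¹ *
        algebraMap ℂ (OU g) (gam (α (Fin.last m)) k₀ K) *
          emon_mul_neg (g := g) (Pi.single (Fin.last m) K)
  have h3 : h = 0 := by
    have hinj : Function.Injective (algebraMap (Laurent N m) (OU g)) :=
      IsLocalization.injective (OU g) (powers_le_nonZeroDivisors_of_noZeroDivisors hg)
    exact hinj (h2.trans (map_zero _).symm)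
  rw [h3, map_zero, mul_zero, sub_zero] at e
  exact ⟨v, hv, e⟩

theorem residue_surjective
    (hk₀ : ∀ k : ℤ, k₀ ≤ k → (k : ℂ) ≠ α (Fin.last m)) (b : OU g) :
    ∃ w ∈ Laurent.supp N (upper m k₀), residue g α k₀ w = b := by
  obtain ⟨k, p, hp⟩ := exists_mul_gU_pow g b
  -- The denominator exponent k of b may lie below k₀; expanding the fraction by further powers of g
  -- lifts the degree into the allowed range.
  have hK : k₀ ≤ ((k + k₀.toNat : ℕ) : ℤ) := by push_cast; omega
  generalize hl : k₀.toNat = l at hK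
  have hγ := gam_ne_zero hk₀ ((k + l : ℕ) : ℤ)
  refine ⟨((gam (α (Fin.last m)) k₀ ((k + l : ℕ) : ℤ))⁻¹ •
    (Laurent.mon (Pi.single (Fin.last m) ((k + l : ℕ) : ℤ)) * Laurent.subst 1 (p * g ^ l))),
    Submodule.smul_of_tower_mem _ _ (mon_mul_subst_mem _ hK _), ?_⟩
  rw [Algebra.smul_def, residue_algebraMap_mul, residue_mon_mul_subst, map_mul, map_pow, ← hp]
  have h4 : algebraMap ℂ (OU g) (gam (α (Fin.last m)) k₀ ((k + l : ℕ) : ℤ))⁻¹ *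
      algebraMap ℂ (OU g) (gam (α (Fin.last m)) k₀ ((k + l : ℕ) : ℤ)) = 1 := by
    rw [← map_mul, inv_mul_cancel₀ hγ, map_one]
  have h5 : emon g (Pi.single (Fin.last m) ((k + l : ℕ) : ℤ)) = gInv g ^ (k + l) := by
    have : Fin.init (Pi.single (Fin.last m) ((k + l : ℕ) : ℤ) : Fin (m + 1) → ℤ) = 0 := by
      funext i; simp [Fin.init, Fin.castSucc_ne_last]
    rw [emon, this, mon_zero, Pi.single_eq_same, one_mul, zpow_neg, ← inv_zpow, zpow_natCast]
    rfl
  have h6 : gInv g ^ (k + l) * gU g ^ (k + l) = 1 := by rw [← mul_pow, gInv_mul_gU, one_pow]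
  rw [h5]
  change _ * (_ * _ * (_ * gU g ^ l)) = _
  rw [pow_add] at h6 ⊢
  rw [pow_add] at h6
  linear_combination b * gInv g ^ k * gInv g ^ l * gU g ^ k * gU g ^ l * h4 + b * h6

section Equiv

/-- The residue is onto, intertwines E_1, …, E_m with the twisted operators and has kernel exactly
the image of E_n; so the images of all the E_i form the preimage of the images on U. -/
theorem residue_mem_imageSum_iff (hg : g ≠ 0)
    (hf : Laurent.generic a = Laurent.mon (Pi.single (Fin.last m) 1) * Laurent.subst 1 g)
    (h1 : ∀ j, a j (Fin.last m) = 1)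
    (hk₀ : ∀ k : ℤ, k₀ ≤ k → (k : ℂ) ≠ α (Fin.last m)) {w : Laurent N (m + 1)}
    (hw : w ∈ Laurent.supp N (upper m k₀)) :
    residue g α k₀ w ∈ (frame g).imageSum (etaCoeff g (-α)) ↔
      w ∈ Laurent.eulerImage a α (upper m k₀) := by
  have hst := upper_stable (k₀ := k₀) h1
  constructor
  · intro h
    obtain ⟨z, hz, e⟩ : ∃ z ∈ Laurent.eulerImage a α (upper m k₀),
        residue g α k₀ z = residue g α k₀ w := by
      refine Submodule.iSup_induction _ (motive := fun b =>
        ∃ z ∈ Laurent.eulerImage a α (upper m k₀), residue g α k₀ z = b) h ?_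
        ⟨0, zero_mem _, map_zero _⟩ ?_
      · rintro i _ ⟨b, rfl⟩
        obtain ⟨v, hv, rfl⟩ := residue_surjective hk₀ b
        exact ⟨_, Laurent.euler_mem_eulerImage α _ hv, residue_euler_castSucc hf i hv⟩
      · rintro _ _ ⟨y, hy, rfl⟩ ⟨z, hz, rfl⟩
        exact ⟨y + z, add_mem hy hz, map_add _ _ _⟩
    have h2 := residue_ker (w := w - z) hg hf hk₀
      (sub_mem hw (Laurent.eulerImage_le α hst hz)) (by rw [map_sub, e, sub_self])
    obtain ⟨v, hv, e'⟩ := h2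
    rw [← sub_add_cancel w z, ← e']
    exact add_mem (Laurent.euler_mem_eulerImage α _ hv) hz
  · intro h
    refine Laurent.eulerImage_induction α (P := fun w => residue g α k₀ w ∈
      (frame g).imageSum (etaCoeff g (-α))) ?_ ?_ ?_ h
    · intro i w hw
      refine Fin.lastCases ?_ (fun i => ?_) i
      · rw [residue_euler_last hf hw]; exact zero_mem _
      · rw [residue_euler_castSucc hf i hw]
        exact (frame g).op_mem _ i _
    · rw [map_zero]; exact zero_mem _
    · intro v w hv hw; rw [map_add]; exact add_mem hv hw

/-- The isomorphism that is induced by `residue`. -/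
theorem exists_residueEquiv (hg : g ≠ 0)
    (hf : Laurent.generic a = Laurent.mon (Pi.single (Fin.last m) 1) * Laurent.subst 1 g)
    (h1 : ∀ j, a j (Fin.last m) = 1)
    (hk₀ : ∀ k : ℤ, k₀ ≤ k → (k : ℂ) ≠ α (Fin.last m))
    (he : Laurent.EulerEquiv a α (upper m k₀) Set.univ) :
    ∃ e : (Laurent N (m + 1) ⧸ Laurent.eulerImage a α Set.univ) ≃ₗ[PolyRing N]
      OU g ⧸ (frame g).imageSum (etaCoeff g (-α)), ∀ w ∈ Laurent.supp N (upper m k₀),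
        e (Submodule.Quotient.mk w) = Submodule.Quotient.mk (residue g α k₀ w) := by
  let S := Laurent.supp N (upper m k₀)
  let p : S →ₗ[PolyRing N] Laurent N (m + 1) ⧸ Laurent.eulerImage a α Set.univ :=
    (Submodule.mkQ _).comp S.subtype
  let q : S →ₗ[PolyRing N] OU g ⧸ (frame g).imageSum (etaCoeff g (-α)) :=
    (Submodule.mkQ _).comp ((residue g α k₀).comp S.subtype)
  have hp : Function.Surjective p := fun y => by
    obtain ⟨w, rfl⟩ := Submodule.Quotient.mk_surjective _ y
    obtain ⟨v, hv, z, hz, rfl⟩ := Submodule.mem_sup.1 (he.1 (by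
      rw [Laurent.supp_univ]; trivial : w ∈ Laurent.supp N Set.univ))
    refine ⟨⟨v, hv⟩, (Submodule.Quotient.eq _).2 ?_⟩
    change v - (v + z) ∈ _
    rw [sub_add_cancel_left]
    exact neg_mem hz
  have hq : Function.Surjective q := fun y => by
    obtain ⟨b, rfl⟩ := Submodule.Quotient.mk_surjective _ y
    obtain ⟨v, hv, rfl⟩ := residue_surjective hk₀ b
    exact ⟨⟨v, hv⟩, rfl⟩
  have hpq : LinearMap.ker p = LinearMap.ker q := by
    ext ⟨w, hw⟩
    rw [LinearMap.mem_ker, LinearMap.mem_ker]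
    change Submodule.Quotient.mk w = 0 ↔ Submodule.Quotient.mk (residue g α k₀ w) = 0
    rw [Submodule.Quotient.mk_eq_zero, Submodule.Quotient.mk_eq_zero,
      residue_mem_imageSum_iff hg hf h1 hk₀ hw]
    exact ⟨fun h => he.2 ⟨hw, h⟩, fun h => Laurent.eulerImage_mono α (Set.subset_univ _) h⟩
  obtain ⟨e, he⟩ := exists_linearEquiv_of_ker_eq (R := PolyRing N) (M := S)
    (P := Laurent N (m + 1) ⧸ Laurent.eulerImage a α Set.univ)
    (Q := OU g ⧸ (frame g).imageSum (etaCoeff g (-α))) p q hp hq hpq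
  exact ⟨e, fun w hw => he ⟨w, hw⟩⟩

end Equiv

end OU

/-! ### The hypergeometric module is the twisted cohomology of U. -/

section

variable {N m : ℕ} {g : Laurent N m} {a : Fin N → Fin (m + 1) → ℤ} {α : Fin (m + 1) → ℂ}

/-- Exponents may repeat, so the coefficient is a sum of variables; its derivative in λ_j is 1. -/
theorem Laurent.generic_coeff_ne_zero (a : Fin N → Fin (m + 1) → ℤ) (j : Fin N) :
    (Laurent.generic a).coeff (a j) ≠ 0 := by
  intro h
  have h2 : (Laurent.generic a).coeff (a j) =
      ∑ k, if a k = a j then (MvPolynomial.X k : PolyRing N) else 0 := by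
    rw [Laurent.generic, AddMonoidAlgebra.coeff_sum, Finsupp.finsetSum_apply]
    refine Finset.sum_congr rfl fun k _ => ?_
    rw [AddMonoidAlgebra.coeff_single, Finsupp.single_apply]
  rw [h2] at h
  have h3 := congrArg (MvPolynomial.pderiv j) h
  rw [map_sum, map_zero, Finset.sum_eq_single j] at h3
  · simp at h3
  · intro k _ hk
    split_ifs
    · rw [MvPolynomial.pderiv_X_of_ne hk]
    · rw [map_zero]
  · simp

theorem exponent_last
    (hf : Laurent.generic a = Laurent.mon (Pi.single (Fin.last m) 1) * Laurent.subst 1 g)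
    (j : Fin N) : a j (Fin.last m) = 1 := by
  by_contra hne
  apply Laurent.generic_coeff_ne_zero a j
  rw [hf]
  generalize g = h
  induction h using AddMonoidAlgebra.induction_linear with
  | zero => simp
  | add p q hp hq => rw [map_add, mul_add, AddMonoidAlgebra.coeff_add, Finsupp.add_apply, hp, hq,
      add_zero]
  | single u p =>
    rw [Laurent.subst_one_single, AddMonoidAlgebra.single_mul_single,
      AddMonoidAlgebra.coeff_single, Finsupp.single_apply, if_neg]
    intro he
    apply hne
    rw [← he]
    simp [Laurent.expHom]

theorem nonempty_of_closure_eq_top (ha : AddSubgroup.closure (Set.range a) = ⊤) :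
    Nonempty (Fin N) := by
  by_contra h
  rw [not_nonempty_iff] at h
  rw [Set.range_eq_empty, AddSubgroup.closure_empty] at ha
  exact bot_ne_top ha

theorem ne_zero_of_generic_eq (ha : AddSubgroup.closure (Set.range a) = ⊤)
    (hf : Laurent.generic a = Laurent.mon (Pi.single (Fin.last m) 1) * Laurent.subst 1 g) :
    g ≠ 0 := by
  obtain ⟨j⟩ := nonempty_of_closure_eq_top ha
  rintro rfl
  apply Laurent.generic_coeff_ne_zero a j
  rw [hf]
  simp

theorem Laurent.eulerEquiv_expSum (ha : AddSubgroup.closure (Set.range a) = ⊤)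
    (hα : Nonresonant a α) : Laurent.EulerEquiv a α (Set.range (expSum a)) Set.univ := by
  obtain ⟨C, hC, k, hk⟩ := exists_conductor a ha
  exact .of_deep α (Weyl.stable_range_expSum a) (fun _ _ _ => Set.mem_univ _) (Set.subset_univ _)
    C hC hα k hk

/-- The half-space contains all deep points: for u deep enough, u - k₀ a_j is still in ℕA, and on ℕA
the last coordinate is nonnegative because each a_j has last coordinate 1. -/
theorem Laurent.eulerEquiv_upper (ha : AddSubgroup.closure (Set.range a) = ⊤)
    (hα : Nonresonant a α) (h1 : ∀ j, a j (Fin.last m) = 1) (k₀ : ℤ) :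
    Laurent.EulerEquiv a α (OU.upper m k₀) Set.univ := by
  obtain ⟨C, hC, k, hk⟩ := exists_conductor a ha
  obtain ⟨j⟩ := nonempty_of_closure_eq_top ha
  refine .of_deep α (OU.upper_stable h1) (fun _ _ _ => Set.mem_univ _) (Set.subset_univ _)
    C hC hα (k + ∑ c ∈ C, |∑ i, c i * (k₀ * a j i)|) fun u hu => ?_
  obtain ⟨q, hq⟩ := hk (u - k₀ • a j) fun c hc => by
    have h2 := hu c hc
    have h3 := Finset.single_le_sum (f := fun c : Fin (m + 1) → ℤ => |∑ i, c i * (k₀ * a j i)|)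
      (fun c _ => abs_nonneg _) hc
    have h4 := le_abs_self (∑ i, c i * (k₀ * a j i))
    simp only [Pi.sub_apply, Pi.smul_apply, smul_eq_mul, mul_sub, Finset.sum_sub_distrib]
    linarith
  have h5 := congrFun hq (Fin.last m)
  simp only [expSum_apply, Finset.sum_apply, Pi.smul_apply, h1, Pi.sub_apply, smul_eq_mul,
    nsmul_eq_mul, Pi.mul_apply, Pi.natCast_apply, mul_one] at h5
  have h6 : (0 : ℤ) ≤ ∑ j, (q j : ℤ) := Finset.sum_nonneg fun _ _ => Int.natCast_nonneg _
  change k₀ ≤ u (Fin.last m)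
  linarith

/-- The hypergeometric module as a quotient of the ring of functions on `U`. -/
theorem exists_gkz_equiv (ha : AddSubgroup.closure (Set.range a) = ⊤)
    (hf : Laurent.generic a = Laurent.mon (Pi.single (Fin.last m) 1) * Laurent.subst 1 g)
    (hα : Nonresonant a α) :
    ∃ e : GKZ a α ≃ₗ[ℂ] OU g ⧸ (OU.frame g).imageSum (OU.etaCoeff g (-α)),
      ∀ j u, e (Weyl.lam j • u) = (MvPolynomial.X j : PolyRing N) • e u ∧
        ∃ b, e u = Submodule.Quotient.mk b ∧ e (Weyl.par j • u) =
          Submodule.Quotient.mk (OU.der g j b + OU.shift g (-α) j * b) := by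
  have h1 := exponent_last hf
  -- Starting above the real part of α_n keeps all Gamma factors nonzero, even when α_n is an
  -- integer, which nonresonance does not exclude.
  obtain ⟨k₀, hk₀⟩ : ∃ k₀ : ℤ, ∀ k : ℤ, k₀ ≤ k → (k : ℂ) ≠ α (Fin.last m) := by
    refine ⟨⌊(α (Fin.last m)).re⌋ + 1, fun k hk h => ?_⟩
    have h2 := congrArg Complex.re h
    rw [Complex.intCast_re] at h2
    rw [← h2, Int.floor_intCast] at hk
    omega
  have he := Laurent.eulerEquiv_expSum ha hα
  have he' := Laurent.eulerEquiv_upper ha hα h1 k₀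
  obtain ⟨e, h⟩ := OU.exists_residueEquiv (ne_zero_of_generic_eq ha hf) hf h1 hk₀ he'
  refine ⟨(Weyl.gkzEquiv he).trans (e.restrictScalars ℂ), fun j u => ?_⟩
  obtain ⟨P, rfl⟩ := Submodule.Quotient.mk_surjective _ u
  have hl : Weyl.gkzEquiv he (Weyl.lam j • Submodule.Quotient.mk P) =
      (MvPolynomial.X j : PolyRing N) • Weyl.gkzEquiv he (Submodule.Quotient.mk P) := by
    rw [← Submodule.Quotient.mk_smul, smul_eq_mul, Weyl.gkzEquiv_mk, map_mul, Module.End.mul_apply,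
      Weyl.act_lam]
    rfl
  refine ⟨?_, ?_⟩
  · rw [LinearEquiv.trans_apply, hl]
    exact map_smul e _ _
  -- The formula for ∂_j under the residue holds only on the half-space, so each class is first
  -- represented by some v supported there, and b is the residue of v.
  · obtain ⟨v, hv, z, hz, hw⟩ := Submodule.mem_sup.1 (he'.1 (by
      rw [Laurent.supp_univ]; trivial : Weyl.act a P 1 ∈ Laurent.supp N Set.univ))
    have hv1 : Weyl.gkzEquiv he (Submodule.Quotient.mk P) = Submodule.Quotient.mk v := by
      rw [Weyl.gkzEquiv_mk, Submodule.Quotient.eq, ← hw, add_sub_cancel_left]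
      exact hz
    have hv2 : Weyl.gkzEquiv he (Weyl.par j • Submodule.Quotient.mk P) =
        Submodule.Quotient.mk (Laurent.parOp a j v) := by
      rw [← Submodule.Quotient.mk_smul, smul_eq_mul, Weyl.gkzEquiv_mk, map_mul,
        Module.End.mul_apply, Weyl.act_par, Submodule.Quotient.eq, ← hw, map_add,
        add_sub_cancel_left]
      exact Weyl.parOp_mem_eulerImage a α (fun _ _ _ => Set.mem_univ _) j hz
    refine ⟨OU.residue g α k₀ v, ?_, ?_⟩
    · rw [LinearEquiv.trans_apply, hv1]
      exact h v hv
    · rw [LinearEquiv.trans_apply, hv2]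
      refine (h _ (Laurent.parOp_mem_supp (OU.upper_stable h1) j hv)).trans ?_
      rw [OU.residue_parOp hf j hv]

end

theorem OU.op_topEquiv {N m : ℕ} (g : Laurent N m) (α : Fin (m + 1) → ℂ) (j : Fin N) (b : OU g) :
    OU.op g α m j ((OU.frame g).topEquiv (OU.eta_eq g α) (Submodule.Quotient.mk b)) =
      (OU.frame g).topEquiv (OU.eta_eq g α)
        (Submodule.Quotient.mk (OU.der g j b + OU.shift g α j * b)) := by
  have h : OU.opForms g α j (b • (OU.frame g).vol) =
      (OU.der g j b + OU.shift g α j * b) • (OU.frame g).vol := by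
    rw [OU.opForms_apply, (OU.frame g).lie_smul_vol _ _ (fun i => OU.der_mon g j _), add_smul,
      ← Algebra.smul_def, smul_smul]
  exact (OU.frame g).cohMap_topEquiv (OU.eta_eq g α) _ (OU.opForms_mem g α j)
    (OU.nabla_opForms g α j) h

theorem exists_equiv_trans {K R M P Q ι : Type*} [CommRing K] [CommRing R] [Algebra K R]
    [AddCommGroup M] [AddCommGroup P] [AddCommGroup Q] [Module K M] [Module K P] [Module R P]
    [IsScalarTower K R P] [Module K Q] [Module R Q] [IsScalarTower K R Q] (e : M ≃ₗ[K] P)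
    (t : P ≃ₗ[R] Q) (l p : ι → M → M) (r : ι → R) (op : ι → Q → Q)
    (h : ∀ j u, e (l j u) = r j • e u ∧ t (e (p j u)) = op j (t (e u))) :
    ∃ e' : M ≃ₗ[K] Q, ∀ j u, e' (l j u) = r j • e' u ∧ e' (p j u) = op j (e' u) :=
  ⟨e.trans (t.restrictScalars K), fun j u =>
    ⟨(congrArg t (h j u).1).trans (map_smul t _ _), (h j u).2⟩⟩

/-- The hypergeometric module is the twisted cohomology of `U`. -/
theorem exists_gkz_equiv_twistedCohomology {N m : ℕ} {g : Laurent N m}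
    {a : Fin N → Fin (m + 1) → ℤ} {α : Fin (m + 1) → ℂ}
    (ha : AddSubgroup.closure (Set.range a) = ⊤)
    (hf : Laurent.generic a = Laurent.mon (Pi.single (Fin.last m) 1) * Laurent.subst 1 g)
    (hα : Nonresonant a α) :
    ∃ e : GKZ a α ≃ₗ[ℂ] OU.TwistedCohomology g (-α) m, ∀ j u,
      e (Weyl.lam j • u) = (MvPolynomial.X j : PolyRing N) • e u ∧
      e (Weyl.par j • u) = OU.op g (-α) m j (e u) :=
  (exists_gkz_equiv ha hf hα).elim fun e he =>
    exists_equiv_trans e ((OU.frame g).topEquiv (OU.eta_eq g (-α))) (fun j u => Weyl.lam j • u)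
      (fun j u => Weyl.par j • u) (fun j => MvPolynomial.X j) (fun j => OU.op g (-α) m j)
      fun j u => ⟨(he j u).1, by
        obtain ⟨b, hb, h2⟩ := (he j u).2
        refine (congrArg _ h2).trans (Eq.trans ?_ (congrArg _ (congrArg _ hb.symm)))
        exact (OU.op_topEquiv g (-α) j b).symm⟩


/-! ### The hypersurface and its map to U. -/

/-- The derivation induced on the hypersurface `F = 1` by `E - E(F) T`, where `T F = F`. -/
noncomputable def tangentDer {K R B : Type} [CommRing K] [CommRing R] [CommRing B] [Algebra K R]
    [Algebra K B] (π : R →ₐ[K] B) (hπ : Function.Surjective π) (F : R)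
    (hF : ∀ w, π w = 0 ↔ F - 1 ∣ w) (T E : Derivation K R R) (hT : T F = F) : Derivation K B B :=
  Derivation.liftOfSurjective (f := π) (d := E - E F • T) hπ (fun x hx => by
    rw [hF] at hx ⊢
    obtain ⟨y, rfl⟩ := hx
    -- Applied to (F - 1) y, the derivation gives (F - 1)(E y - E F · T y) + y (E F - E F · T F),
    -- and T F = F turns the last term into -(F - 1) y E F.
    refine ⟨E y - E F * T y - E F * y, ?_⟩
    simp only [Derivation.sub_apply, Derivation.smul_apply, Derivation.leibniz, map_sub,
      Derivation.map_one_eq_zero, hT, smul_eq_mul]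
    ring)

theorem tangentDer_apply {K R B : Type} [CommRing K] [CommRing R] [CommRing B] [Algebra K R]
    [Algebra K B] (π : R →ₐ[K] B) (hπ : Function.Surjective π) (F : R)
    (hF : ∀ w, π w = 0 ↔ F - 1 ∣ w) (T E : Derivation K R R) (hT : T F = F) (p : R) :
    tangentDer π hπ F hF T E hT (π p) = π (E p - E F * T p) := by
  unfold tangentDer
  exact Derivation.liftOfSurjective_apply (d := E - E F • T) hπ _ p

/-- The polynomial is homogeneous of degree D in x_n, so x_n ∂/∂x_n divided by D fixes it. This
provides the transversal field T that makes derivations tangent to the hypersurface. -/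
theorem toric_hyperPoly {N m : ℕ} (g : Laurent N m) {D : ℕ} (hD : 0 < D) :
    Laurent.toric (Pi.single (Fin.last m) (D : ℂ)⁻¹) (hyperPoly g D) = hyperPoly g D := by
  have : (D : ℂ) ≠ 0 := Nat.cast_ne_zero.2 hD.ne'
  rw [hyperPoly, Derivation.leibniz, Laurent.toric_last_subst, smul_zero, zero_add,
    Laurent.toric_single, smul_eq_mul, mul_comm]
  simp [Pi.single_apply, this]

theorem toric_last_mon (N : ℕ) {m : ℕ} (D : ℕ) (u : Fin (m + 1) → ℤ) :
    Laurent.toric (Pi.single (Fin.last m) (D : ℂ)⁻¹) (Laurent.mon u : Laurent N (m + 1)) =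
      ((u (Fin.last m) : ℂ) / D) • Laurent.mon u := by
  rw [Laurent.toric_single]
  simp [Pi.single_apply, div_eq_inv_mul]

/-- A presentation of `B` as the ring of functions on the hypersurface
`x_n^D g(x_1^D, …, x_{n-1}^D) = 1`. -/
structure HyperRing {N m : ℕ} (g : Laurent N m) (D : ℕ) (B : Type) [CommRing B]
    [Algebra (PolyRing N) B] where
  π : Laurent N (m + 1) →ₐ[PolyRing N] B
  surjective : Function.Surjective π
  eq_zero_iff : ∀ w, π w = 0 ↔ hyperPoly g D - 1 ∣ w

namespace HyperRing

variable {N m : ℕ} {g : Laurent N m} {D : ℕ} {B : Type} [CommRing B] [Algebra (PolyRing N) B]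
  (H : HyperRing g D B)

/-- The function `x^u` on the hypersurface. -/
noncomputable def mon (u : Fin (m + 1) → ℤ) : B := H.π (Laurent.mon u)

theorem mon_add (u v : Fin (m + 1) → ℤ) : H.mon (u + v) = H.mon u * H.mon v := by
  rw [mon, mon, mon, ← map_mul, AddMonoidAlgebra.single_mul_single, one_mul]

theorem mon_zero : H.mon 0 = 1 := map_one _

theorem mon_mul_mon_neg (u : Fin (m + 1) → ℤ) : H.mon u * H.mon (-u) = 1 := by
  rw [← mon_add, add_neg_cancel, mon_zero]

theorem mon_neg_mul_mon (u : Fin (m + 1) → ℤ) : H.mon (-u) * H.mon u = 1 := by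
  rw [← mon_add, neg_add_cancel, mon_zero]

theorem π_single (u : Fin (m + 1) → ℤ) (p : PolyRing N) :
    H.π (AddMonoidAlgebra.single u p) = p • H.mon u := by
  have : AddMonoidAlgebra.single u p = p • (Laurent.mon u : Laurent N (m + 1)) := by simp
  rw [this, map_smul]
  rfl

theorem induction {P : B → Prop} (h0 : P 0) (hadd : ∀ x y, P x → P y → P (x + y))
    (hmon : ∀ (p : PolyRing N) u, P (p • H.mon u)) (x : B) : P x := by
  obtain ⟨w, rfl⟩ := H.surjective x
  induction w using AddMonoidAlgebra.induction_linear with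
  | zero => rw [map_zero]; exact h0
  | add p q hp hq => rw [map_add]; exact hadd _ _ hp hq
  | single u p => rw [π_single]; exact hmon p u

theorem π_hyperPoly : H.π (hyperPoly g D) = 1 := by
  rw [← sub_eq_zero, ← map_one H.π, ← map_sub, H.eq_zero_iff]

theorem mon_mul_π_subst :
    H.mon (Pi.single (Fin.last m) (D : ℤ)) * H.π (Laurent.subst D g) = 1 := by
  rw [mon, ← map_mul]
  exact H.π_hyperPoly

theorem isUnit_π_subst : IsUnit ((H.π.comp (Laurent.subst D)) g) :=
  IsUnit.of_mul_eq_one _ ((mul_comm _ _).trans H.mon_mul_π_subst)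

/-- The homomorphism of rings of functions given by `x_i ↦ x_i^D`. -/
noncomputable def ofU : OU g →ₐ[PolyRing N] B :=
  IsLocalization.Away.liftAlgHom (f := H.π.comp (Laurent.subst D)) g H.isUnit_π_subst

theorem ofU_algebraMap (p : Laurent N m) :
    H.ofU (algebraMap (Laurent N m) (OU g) p) = H.π (Laurent.subst D p) :=
  IsLocalization.Away.lift_eq (S := OU g) (g := (H.π.comp (Laurent.subst D)).toRingHom) g
    H.isUnit_π_subst p

theorem ofU_gU : H.ofU (OU.gU g) = H.π (Laurent.subst D g) := H.ofU_algebraMap g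

theorem ofU_gInv : H.ofU (OU.gInv g) = H.mon (Pi.single (Fin.last m) (D : ℤ)) := by
  have h1 : H.ofU (OU.gU g) * H.ofU (OU.gInv g) = 1 := by
    rw [← map_mul, OU.gU_mul_gInv, map_one]
  have h2 := H.mon_mul_π_subst
  rw [← ofU_gU] at h2
  linear_combination (H.mon (Pi.single (Fin.last m) (D : ℤ))) * h1 - H.ofU (OU.gInv g) * h2

theorem ofU_mon (u : Fin m → ℤ) : H.ofU (OU.mon g u) = H.mon (Laurent.expHom m D u) := by
  rw [OU.mon, ofU_algebraMap, Laurent.subst_single, mon]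

/-- Under x_i ↦ x_i^D the function 1/g becomes x_n^D, so the last exponent behaves like the others.
-/
theorem ofU_emon (u : Fin (m + 1) → ℤ) : H.ofU (OU.emon g u) = H.mon ((D : ℤ) • u) := by
  have h : ∀ k : ℤ, H.ofU ((OU.gUnit g ^ (-k) : (OU g)ˣ) : OU g) =
      H.mon (Pi.single (Fin.last m) (D * k)) := fun k => by
    let x : Bˣ := ⟨_, _, H.mon_mul_mon_neg (Pi.single (Fin.last m) (D : ℤ)),
      H.mon_neg_mul_mon _⟩
    have h1 : Units.map (H.ofU : OU g →* B) (OU.gUnit g)⁻¹ = x := Units.ext H.ofU_gInv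
    have h2 : ∀ k : ℤ, ((x ^ k : Bˣ) : B) = H.mon (Pi.single (Fin.last m) (D * k)) := fun k => by
      induction k with
      | zero => simp [mon_zero]
      | succ k ih =>
        rw [zpow_add_one, Units.val_mul, ih, mul_add, Pi.single_add, mon_add, mul_one]
      | pred k ih =>
        have h3 : (Pi.single (Fin.last m) (D * (-(k : ℤ) - 1)) : Fin (m + 1) → ℤ) =
            Pi.single (Fin.last m) (D * -(k : ℤ)) + -Pi.single (Fin.last m) (D : ℤ) := by
          rw [← Pi.single_neg, ← Pi.single_add]
          congr 1
          ring
        rw [zpow_sub_one, Units.val_mul, ih, h3, mon_add]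
        rfl
    rw [← h2, ← h1, ← map_zpow, inv_zpow, zpow_neg]
    rfl
  rw [OU.emon, map_mul, ofU_mon, h, ← mon_add]
  congr 1
  funext i
  refine Fin.lastCases ?_ (fun i => ?_) i
  · simp [Laurent.expHom]
  · simp [Laurent.expHom, (Fin.castSucc_lt_last i).ne, Fin.init]

/-- A map of the form of a derivation along `x_i ↦ x_i^D` vanishes if it does so on Laurent
polynomials. -/
theorem eq_zero_of_leibniz (d : OU g →+ B)
    (h : ∀ b c, d (b * c) = H.ofU b * d c + H.ofU c * d b)
    (h0 : ∀ p, d (algebraMap (Laurent N m) (OU g) p) = 0) (b : OU g) : d b = 0 := by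
  obtain ⟨k, p, hp⟩ := OU.exists_mul_gU_pow g b
  have h1 := congrArg d hp
  have h2 : d (OU.gU g ^ k) = 0 := by rw [OU.gU, ← map_pow, h0]
  rw [h0, h, h2, mul_zero, zero_add, map_pow] at h1
  have h3 : H.ofU (OU.gInv g) * H.ofU (OU.gU g) = 1 := by
    rw [← map_mul, OU.gInv_mul_gU, map_one]
  have h4 := congrArg (H.ofU (OU.gInv g) ^ k * ·) h1
  simpa only [mul_zero, ← mul_assoc, ← mul_pow, h3, one_pow, one_mul] using h4

theorem π_coefLin_hyperPoly (j : Fin N) :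
    H.π (Laurent.coefLin (m + 1) j (hyperPoly g D)) =
      H.ofU (OU.gInv g * OU.der g j (OU.gU g)) := by
  simp only [hyperPoly]
  rw [Laurent.coefLin_mul, Laurent.coefLin_single, Derivation.map_one_eq_zero,
    AddMonoidAlgebra.single_zero, zero_mul, add_zero, map_mul, map_mul, ofU_gInv, OU.gU,
    OU.der_algebraMap, ofU_algebraMap, Laurent.coefLin_subst]
  rfl

section Derivations

variable (hD : 0 < D)

/-- The derivation `x_i ∂/∂x_i` of the functions on the hypersurface, where `x_1, …, x_m` are
the coordinates. -/
noncomputable def dlog (i : Fin m) : Derivation (PolyRing N) B B :=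
  tangentDer H.π H.surjective _ H.eq_zero_iff (Laurent.toric (Pi.single (Fin.last m) (D : ℂ)⁻¹))
    (Laurent.toric (Pi.single i.castSucc 1)) (toric_hyperPoly g hD)

theorem dlog_π (i : Fin m) (p : Laurent N (m + 1)) :
    H.dlog hD i (H.π p) = H.π (Laurent.toric (Pi.single i.castSucc 1) p -
      Laurent.toric (Pi.single i.castSucc 1) (hyperPoly g D) *
        Laurent.toric (Pi.single (Fin.last m) (D : ℂ)⁻¹) p) :=
  tangentDer_apply _ _ _ _ _ _ _ _

variable [Algebra ℂ B] [IsScalarTower ℂ (PolyRing N) B]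

theorem π_smul (c : ℂ) (w : Laurent N (m + 1)) : H.π (c • w) = c • H.π w :=
  map_smul (H.π.restrictScalars ℂ) c w

theorem ofU_smul (c : ℂ) (b : OU g) : H.ofU (c • b) = c • H.ofU b :=
  map_smul (H.ofU.restrictScalars ℂ) c b

/-- The lift of `∂_j` to the hypersurface with `∂_j x_i = 0` for `i ≤ m`. -/
noncomputable def der (j : Fin N) : Derivation ℂ B B :=
  tangentDer (H.π.restrictScalars ℂ) H.surjective _ H.eq_zero_iff
    ((Laurent.toric (Pi.single (Fin.last m) (D : ℂ)⁻¹)).restrictScalars ℂ)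
    (Laurent.coefDer (m + 1) j) (toric_hyperPoly g hD)

theorem der_π (j : Fin N) (p : Laurent N (m + 1)) :
    H.der hD j (H.π p) = H.π (Laurent.coefLin (m + 1) j p -
      Laurent.coefLin (m + 1) j (hyperPoly g D) *
        Laurent.toric (Pi.single (Fin.last m) (D : ℂ)⁻¹) p) :=
  tangentDer_apply (H.π.restrictScalars ℂ) _ _ _ _ _ _ _

theorem dlog_π_subst (i : Fin m) (p : Laurent N m) :
    H.dlog hD i (H.π (Laurent.subst D p)) =
      (D : ℂ) • H.π (Laurent.subst D (Laurent.toric (Pi.single i 1) p)) := by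
  rw [dlog_π, Laurent.toric_last_subst, mul_zero, sub_zero, Laurent.toric_castSucc_subst, π_smul]

theorem der_π_subst (j : Fin N) (p : Laurent N m) :
    H.der hD j (H.π (Laurent.subst D p)) = H.π (Laurent.subst D (Laurent.coefLin m j p)) := by
  rw [der_π, Laurent.toric_last_subst, mul_zero, sub_zero, Laurent.coefLin_subst]

/-- The chain rule for x_i ↦ x_i^D produces the factor D. Uniqueness of derivations along `ofU`
reduces the claim to Laurent polynomials. -/
theorem dlog_ofU (i : Fin m) (b : OU g) :
    H.dlog hD i (H.ofU b) = (D : ℂ) • H.ofU (OU.dlog g i b) := by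
  let d : OU g →+ B :=
    ((H.dlog hD i : B →+ B).comp (H.ofU : OU g →+ B)) -
      (DistribSMul.toAddMonoidHom _ (D : ℂ)).comp
        ((H.ofU : OU g →+ B).comp (OU.dlog g i : OU g →+ OU g))
  have hd : ∀ b, d b = H.dlog hD i (H.ofU b) - (D : ℂ) • H.ofU (OU.dlog g i b) := fun _ => rfl
  rw [← sub_eq_zero, ← hd]
  refine H.eq_zero_of_leibniz d (fun b c => ?_) (fun p => ?_) b
  · simp only [hd, map_mul, Derivation.leibniz, smul_eq_mul, map_add, Algebra.smul_def]
    ring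
  · rw [hd, OU.dlog_algebraMap, ofU_algebraMap, ofU_algebraMap, dlog_π_subst, sub_self]

theorem der_ofU (j : Fin N) (b : OU g) :
    H.der hD j (H.ofU b) = H.ofU (OU.der g j b) := by
  let d : OU g →+ B :=
    ((H.der hD j : B →+ B).comp (H.ofU : OU g →+ B)) -
      ((H.ofU : OU g →+ B).comp (OU.der g j : OU g →+ OU g))
  have hd : ∀ b, d b = H.der hD j (H.ofU b) - H.ofU (OU.der g j b) := fun _ => rfl
  rw [← sub_eq_zero, ← hd]
  refine H.eq_zero_of_leibniz d (fun b c => ?_) (fun p => ?_) b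
  · simp only [hd, map_mul, Derivation.leibniz, smul_eq_mul, map_add]
    ring
  · rw [hd, OU.der_algebraMap, ofU_algebraMap, ofU_algebraMap, der_π_subst]
    exact sub_self _

theorem π_toric_hyperPoly (i : Fin m) :
    H.π (Laurent.toric (Pi.single i.castSucc 1) (hyperPoly g D)) =
      (D : ℂ) • H.ofU (OU.gInv g * OU.dlog g i (OU.gU g)) := by
  have h : Laurent.toric (Pi.single i.castSucc 1)
      (Laurent.mon (Pi.single (Fin.last m) (D : ℤ)) : Laurent N (m + 1)) = 0 := by
    rw [Laurent.toric_single_one]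
    simp [(Fin.castSucc_lt_last i).ne]
  simp only [hyperPoly]
  rw [Derivation.leibniz, h, smul_zero, add_zero, smul_eq_mul, map_mul, map_mul,
    ofU_gInv, OU.gU, OU.dlog_algebraMap, ofU_algebraMap, Laurent.toric_castSucc_subst, π_smul,
    mul_smul_comm]
  rfl

/-- On the hypersurface D dx_n/x_n = -dg/g, with g evaluated at the x_i^D; the factor D from the
substitution cancels the D on the left. -/
theorem dlog_mon (i : Fin m) (u : Fin (m + 1) → ℤ) : H.dlog hD i (H.mon u) =
    H.mon u * H.ofU ((u i.castSucc : ℂ) • 1 -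
      (u (Fin.last m) : ℂ) • (OU.gInv g * OU.dlog g i (OU.gU g))) := by
  have hD' : (D : ℂ) ≠ 0 := Nat.cast_ne_zero.2 hD.ne'
  rw [mon, dlog_π, map_sub, map_mul, toric_last_mon, Laurent.toric_single_one, π_smul, π_smul,
    π_toric_hyperPoly, map_sub, ofU_smul, ofU_smul, map_one, smul_mul_smul_comm,
    mul_div_cancel₀ _ hD']
  simp only [Algebra.smul_def]
  ring

theorem der_mon (j : Fin N) (u : Fin (m + 1) → ℤ) : H.der hD j (H.mon u) =
    H.mon u * H.ofU (-(((u (Fin.last m) : ℂ) / D) • (OU.gInv g * OU.der g j (OU.gU g)))) := by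
  rw [mon, der_π, map_sub, map_mul, toric_last_mon, Laurent.coefLin_single, π_smul,
    π_coefLin_hyperPoly, map_neg, ofU_smul, Derivation.map_one_eq_zero,
    AddMonoidAlgebra.single_zero, map_zero]
  simp only [Algebra.smul_def]
  ring

theorem der_isLift (j : Fin N) : IsLift j (H.der hD j) := fun p => by
  have h := H.der_ofU hD j (algebraMap (PolyRing N) (OU g) p)
  rwa [AlgHom.commutes, OU.der_poly, AlgHom.commutes] at h

end Derivations

end HyperRing


/-! ### Characters of (μ_D)^n and the eigenspaces of functions. -/

theorem Laurent.toric_pi_single {N n : ℕ} (i : Fin n) (c : ℂ) (w : Laurent N n) :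
    Laurent.toric (Pi.single i c) w = c • Laurent.toric (Pi.single i 1) w := by
  rw [Laurent.toric_eq_sum, Finset.sum_eq_single i]
  · simp
  · intro k _ hk
    simp [hk]
  · simp

/-- The sum of a character of `(μ_D)^n`. -/
theorem sum_rootsOfUnity_prod_zpow {n D : ℕ} [Fintype (Fin n → rootsOfUnity D ℂ)]
    (hD : D ≠ 0) (w : Fin n → ℤ) (hw : ¬ ∀ i, (D : ℤ) ∣ w i) :
    ∑ s : Fin n → rootsOfUnity D ℂ, ((∏ i, (s i : ℂˣ) ^ w i : ℂˣ) : ℂ) = 0 := by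
  let f : (Fin n → rootsOfUnity D ℂ) →* ℂ :=
    { toFun := fun s => ((∏ i, (s i : ℂˣ) ^ w i : ℂˣ) : ℂ)
      map_one' := by simp
      map_mul' := fun s t => by simp [mul_zpow, Finset.prod_mul_distrib] }
  -- A trivial character takes the value 1 at a primitive D-th root of unity placed in position i,
  -- which forces D to divide w_i.
  refine sum_hom_units_eq_zero f fun h => hw fun i => ?_
  have hζ := Complex.isPrimitiveRoot_exp D hD
  have : NeZero D := ⟨hD⟩
  let ζ : rootsOfUnity D ℂ := hζ.toRootsOfUnity
  have h1 : f (Pi.mulSingle i ζ) = 1 := by rw [h]; rfl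
  have h2 : (∏ k, (((Pi.mulSingle i ζ : Fin n → rootsOfUnity D ℂ) k : ℂˣ)) ^ w k : ℂˣ) =
      (ζ : ℂˣ) ^ w i := by
    rw [Finset.prod_eq_single i]
    · simp
    · intro k _ hk
      simp [Pi.mulSingle_eq_of_ne hk]
    · simp
  have h3 : (((ζ : ℂˣ) ^ w i : ℂˣ) : ℂ) = 1 := by rw [← h2]; exact h1
  rw [Units.val_zpow_eq_zpow_val] at h3
  exact (hζ.zpow_eq_one_iff_dvd _).1 h3

theorem prod_zpow_rootsOfUnity {n D : ℕ} (s : Fin n → rootsOfUnity D ℂ) (v : Fin n → ℤ) :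
    ∏ i, (s i : ℂˣ) ^ ((D : ℤ) • v) i = 1 := by
  refine Finset.prod_eq_one fun i _ => ?_
  have h : (s i : ℂˣ) ^ D = 1 := (s i).2
  rw [Pi.smul_apply, smul_eq_mul, zpow_mul, zpow_natCast, h, one_zpow]

section Sieve

variable {N m : ℕ} (g : Laurent N m) (D : ℕ) (e : Fin (m + 1) → ℤ)

open Classical in
/-- The projection of Laurent polynomials to the span of the monomials `x^u` with `D ∣ u - e`,
followed by `x_i^D ↦ x_i` and `x_n^D ↦ 1/g`. -/
noncomputable def sieve : Laurent N (m + 1) →ₗ[PolyRing N] OU g :=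
  Laurent.linLift fun u =>
    if h : ∃ v : Fin (m + 1) → ℤ, u = e + (D : ℤ) • v then OU.emon g h.choose else 0

variable {D}

theorem sieve_single_of_eq (hD : 0 < D) (v : Fin (m + 1) → ℤ) (p : PolyRing N) :
    sieve g D e (AddMonoidAlgebra.single (e + (D : ℤ) • v) p) = p • OU.emon g v := by
  have h : ∃ v' : Fin (m + 1) → ℤ, e + (D : ℤ) • v = e + (D : ℤ) • v' := ⟨v, rfl⟩
  rw [sieve, Laurent.linLift_single, dif_pos h]
  congr 2
  have h1 := add_left_cancel h.choose_spec
  funext i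
  have h2 := congrFun h1 i
  simp only [Pi.smul_apply, smul_eq_mul] at h2
  exact (mul_left_cancel₀ (by exact_mod_cast hD.ne') h2).symm

theorem sieve_single_of_not {u : Fin (m + 1) → ℤ}
    (hu : ¬ ∃ v : Fin (m + 1) → ℤ, u = e + (D : ℤ) • v) (p : PolyRing N) :
    sieve g D e (AddMonoidAlgebra.single u p) = 0 := by
  rw [sieve, Laurent.linLift_single, dif_neg hu, smul_zero]

theorem sieve_single_mul (hD : 0 < D) (v : Fin (m + 1) → ℤ) (p : PolyRing N)
    (w : Laurent N (m + 1)) :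
    sieve g D e (AddMonoidAlgebra.single ((D : ℤ) • v) p * w) =
      p • OU.emon g v * sieve g D e w := by
  induction w using AddMonoidAlgebra.induction_linear with
  | zero => simp
  | add w w' h h' => rw [mul_add, map_add, h, h', map_add, mul_add]
  | single u q =>
    rw [AddMonoidAlgebra.single_mul_single]
    by_cases hu : ∃ v : Fin (m + 1) → ℤ, u = e + (D : ℤ) • v
    · obtain ⟨v', rfl⟩ := hu
      rw [add_left_comm, ← smul_add, sieve_single_of_eq g e hD, sieve_single_of_eq g e hD,
        OU.emon_add, smul_mul_smul_comm]
    · rw [sieve_single_of_not g e hu, sieve_single_of_not, mul_zero]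
      rintro ⟨v', h⟩
      refine hu ⟨v' - v, ?_⟩
      rw [smul_sub, add_sub, ← h]
      abel

theorem expHom_eq_smul (u : Fin m → ℤ) :
    Laurent.expHom m D u = (D : ℤ) • Laurent.expHom m 1 u := by
  funext i
  refine Fin.lastCases ?_ (fun i => ?_) i <;> simp [Laurent.expHom]

theorem sieve_subst_mul (hD : 0 < D) (h : Laurent N m) (w : Laurent N (m + 1)) :
    sieve g D e (Laurent.subst D h * w) =
      algebraMap (Laurent N m) (OU g) h * sieve g D e w := by
  induction h using AddMonoidAlgebra.induction_linear with
  | zero => simp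
  | add p q hp hq => rw [map_add, add_mul, map_add, hp, hq, map_add, add_mul]
  | single u p =>
    rw [Laurent.subst_single, expHom_eq_smul, sieve_single_mul g e hD, OU.emon_expHom,
      OU.algebraMap_single]

/-- The polynomial x_n^D g(x_1^D, …) goes to g/g = 1, so the sieve descends to functions on the
hypersurface. -/
theorem sieve_hyperPoly_mul (hD : 0 < D) (w : Laurent N (m + 1)) :
    sieve g D e (hyperPoly g D * w) = sieve g D e w := by
  have h : (Pi.single (Fin.last m) (D : ℤ) : Fin (m + 1) → ℤ) =
      (D : ℤ) • Pi.single (Fin.last m) 1 := by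
    rw [← Pi.single_smul, smul_eq_mul, mul_one]
  have h1 : algebraMap (Laurent N m) (OU g) g = OU.gU g := rfl
  rw [hyperPoly, mul_assoc, h, Laurent.mon, sieve_single_mul g e hD, one_smul, OU.emon_last,
    sieve_subst_mul g e hD, ← mul_assoc, h1, OU.gInv_mul_gU, one_mul]

end Sieve

namespace HyperRing

variable {N m : ℕ} {g : Laurent N m} {D : ℕ} {B : Type} [CommRing B] [Algebra (PolyRing N) B]
  (H : HyperRing g D B) (hD : 0 < D) (e : Fin (m + 1) → ℤ)

/-- The map of functions on the hypersurface that is induced by `sieve`. -/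
noncomputable def retr : B →ₗ[PolyRing N] OU g :=
  (Submodule.liftQ (LinearMap.ker H.π.toLinearMap) (sieve g D e) (fun w hw => by
    obtain ⟨y, rfl⟩ := (H.eq_zero_iff w).1 hw
    rw [LinearMap.mem_ker, sub_mul, map_sub, sieve_hyperPoly_mul g e hD, one_mul, sub_self])).comp
  (LinearMap.quotKerEquivOfSurjective H.π.toLinearMap H.surjective).symm.toLinearMap

theorem retr_π (w : Laurent N (m + 1)) : H.retr hD e (H.π w) = sieve g D e w := by
  have : (LinearMap.quotKerEquivOfSurjective H.π.toLinearMap H.surjective).symm (H.π w) =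
      Submodule.Quotient.mk w := by
    rw [LinearEquiv.symm_apply_eq]
    rfl
  rw [retr, LinearMap.comp_apply, LinearEquiv.coe_coe, this]
  rfl

/-- Clear to begin with for Laurent polynomials; a general b becomes one after multiplication by a
power of the unit g. -/
theorem retr_ofU_mul (b : OU g) (z : B) : H.retr hD e (H.ofU b * z) = b * H.retr hD e z := by
  have h0 : ∀ p z, H.retr hD e (H.ofU (algebraMap (Laurent N m) (OU g) p) * z) =
      algebraMap (Laurent N m) (OU g) p * H.retr hD e z := fun p z => by
    obtain ⟨w, rfl⟩ := H.surjective z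
    rw [ofU_algebraMap, ← map_mul, retr_π, retr_π, sieve_subst_mul g e hD]
  obtain ⟨k, p, hp⟩ := OU.exists_mul_gU_pow g b
  have h1 : OU.gU g ^ k * H.retr hD e (H.ofU b * z) = OU.gU g ^ k * (b * H.retr hD e z) := by
    have h2 : OU.gU g ^ k = algebraMap (Laurent N m) (OU g) (g ^ k) := (map_pow _ _ _).symm
    rw [← mul_assoc, mul_comm _ b, hp, h2, ← h0, ← h0, ← hp, h2, ← mul_assoc, ← map_mul H.ofU,
      mul_comm b]
  have h2 := congrArg (OU.gInv g ^ k * ·) h1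
  simpa only [← mul_assoc, ← mul_pow, OU.gInv_mul_gU, one_pow, one_mul] using h2

theorem retr_mon_mul (b : OU g) : H.retr hD e (H.mon e * H.ofU b) = b := by
  have h : H.retr hD e (H.mon e) = 1 := by
    have := sieve_single_of_eq g e hD 0 1
    rw [smul_zero, add_zero, one_smul, OU.emon_zero] at this
    rw [mon, retr_π, this]
  rw [mul_comm, retr_ofU_mul, h, mul_one]

theorem retr_mon_of_not {u : Fin (m + 1) → ℤ}
    (hu : ¬ ∃ v : Fin (m + 1) → ℤ, u = e + (D : ℤ) • v) : H.retr hD e (H.mon u) = 0 := by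
  rw [mon, retr_π, sieve_single_of_not g e hu]

theorem mon_add_smul (v : Fin (m + 1) → ℤ) :
    H.mon (e + (D : ℤ) • v) = H.mon e * H.ofU (OU.emon g v) := by
  rw [mon_add, ofU_emon]

section Frame

variable [Algebra ℂ B] [IsScalarTower ℂ (PolyRing N) B]

theorem D_π (p : Laurent N (m + 1)) : KaehlerDifferential.D (PolyRing N) B (H.π p) =
    ∑ i, H.π (Laurent.toric (Pi.single i 1) p) • H.mon (-Pi.single i 1) •
      KaehlerDifferential.D (PolyRing N) B (H.mon (Pi.single i 1)) := by
  induction p using AddMonoidAlgebra.induction_linear with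
  | zero => simp
  | add p q hp hq => simp only [map_add, hp, hq, add_smul, Finset.sum_add_distrib]
  | single u p =>
    rw [π_single, Derivation.map_smul, derivation_apply_of_multiplicative
      (KaehlerDifferential.D (PolyRing N) B) H.mon H.mon_zero H.mon_add, Finset.smul_sum,
      Finset.smul_sum]
    refine Finset.sum_congr rfl fun i _ => ?_
    rw [Laurent.toric_single_one, π_smul, π_single, smul_comm (H.mon u), smul_comm p,
      Int.cast_smul_eq_zsmul, smul_assoc, smul_assoc]

/-- The coordinates `x_1, …, x_m` on the hypersurface. -/
noncomputable def frame : LogFrame (PolyRing N) B m where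
  x i := ⟨_, _, H.mon_mul_mon_neg (Pi.single i.castSucc 1), H.mon_neg_mul_mon _⟩
  δ := H.dlog hD
  δ_x i k := by
    change H.dlog hD i (H.mon (Pi.single k.castSucc 1)) = _
    rw [dlog_mon]
    by_cases h : i = k
    · subst h; simp [(Fin.castSucc_lt_last i).ne']
    · simp [h, (Fin.castSucc_lt_last k).ne']
  D_eq b := by
    have hD' : (D : ℂ) ≠ 0 := Nat.cast_ne_zero.2 hD.ne'
    change KaehlerDifferential.D (PolyRing N) B b = ∑ i, H.dlog hD i b •
      H.mon (-Pi.single i.castSucc 1) •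
        KaehlerDifferential.D (PolyRing N) B (H.mon (Pi.single i.castSucc 1))
    obtain ⟨p, rfl⟩ := H.surjective b
    have hl : ∀ p, H.π (Laurent.toric (Pi.single (Fin.last m) 1) p) =
        (D : ℂ) • H.π (Laurent.toric (Pi.single (Fin.last m) (D : ℂ)⁻¹) p) := fun p => by
      rw [Laurent.toric_pi_single _ (D : ℂ)⁻¹, π_smul, smul_smul, mul_inv_cancel₀ hD', one_smul]
    -- The relation dF = 0 has coefficient D at dx_n/x_n, because F equals 1 on the hypersurface. It
    -- eliminates dx_n/x_n in favour of the other coordinates.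
    have h := H.D_π (hyperPoly g D)
    rw [π_hyperPoly, Derivation.map_one_eq_zero, Fin.sum_univ_castSucc, hl,
      toric_hyperPoly g hD, π_hyperPoly] at h
    rw [D_π, Fin.sum_univ_castSucc, hl]
    simp only [dlog_π, map_sub, map_mul, sub_smul, Finset.sum_sub_distrib]
    have h3 := congrArg (H.π (Laurent.toric (Pi.single (Fin.last m) (D : ℂ)⁻¹) p) • ·) h
    simp only [smul_zero, smul_add, Finset.smul_sum, smul_smul] at h3
    rw [sub_eq_add_neg]
    congr 1
    rw [eq_neg_iff_add_eq_zero, add_comm]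
    simp only [smul_smul]
    refine Eq.trans ?_ h3.symm
    congr 1
    · exact Finset.sum_congr rfl fun i _ => by
        rw [mul_comm (H.π (Laurent.toric _ (hyperPoly g D))), mul_assoc]
    · congr 1
      rw [smul_mul_assoc, smul_mul_assoc, one_mul, mul_smul_comm]

variable {e} {β : Fin (m + 1) → ℂ}

/-- With e = Dβ, x^e is the pullback under x_i ↦ x_i^D of the multivalued function ∏ x_i^{β_i}
g^{-β_n}, whose logarithmic differential is the twist. Multiplication by it untwists the connection.
-/
theorem dlog_mon_mul (hβ : ∀ i, (D : ℂ) * β i = e i) (i : Fin m) (b : OU g) :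
    H.dlog hD i (H.mon e * H.ofU b) =
      (D : ℂ) • (H.mon e * H.ofU ((OU.frame g).op (OU.etaCoeff g β) i b)) := by
  have h : (OU.frame g).op (OU.etaCoeff g β) i b = OU.dlog g i b + OU.etaCoeff g β i * b := rfl
  rw [h, Derivation.leibniz, dlog_ofU, dlog_mon, OU.etaCoeff, ← hβ, ← hβ]
  simp only [smul_eq_mul]
  simp only [Algebra.smul_def, map_add, map_sub, map_mul, map_one]
  have hc : ∀ c : ℂ, H.ofU (algebraMap ℂ (OU g) c) = algebraMap ℂ B c :=
    fun c => (H.ofU.restrictScalars ℂ).commutes c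
  simp only [hc]
  ring

theorem der_mon_mul (hβ : ∀ i, (D : ℂ) * β i = e i) (j : Fin N) (b : OU g) :
    H.der hD j (H.mon e * H.ofU b) =
      H.mon e * H.ofU (OU.der g j b + OU.shift g β j * b) := by
  have hD' : (D : ℂ) ≠ 0 := Nat.cast_ne_zero.2 hD.ne'
  rw [Derivation.leibniz, der_ofU, der_mon, OU.shift, ← hβ, mul_div_cancel_left₀ _ hD']
  simp only [smul_eq_mul]
  simp only [Algebra.smul_def, map_add, map_neg, map_mul]
  ring

/-- The logarithmic derivations preserve the class of exponents modulo D. The class of e is handled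
by `dlog_mon_mul`, and on every other class both sides vanish. -/
theorem retr_dlog (hβ : ∀ i, (D : ℂ) * β i = e i) (i : Fin m) (z : B) :
    H.retr hD e (H.dlog hD i z) =
      (OU.frame g).op (OU.etaCoeff g β) i (D • H.retr hD e z) := by
  induction z using H.induction with
  | h0 => simp
  | hadd x y hx hy => simp only [map_add, hx, hy, smul_add]
  | hmon p u =>
    have h2 : ∀ z, H.retr hD e (p • z) = p • H.retr hD e z := map_smul (H.retr hD e) p
    by_cases hu : ∃ v : Fin (m + 1) → ℤ, u = e + (D : ℤ) • v
    · obtain ⟨v, rfl⟩ := hu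
      rw [mon_add_smul, Derivation.map_smul, dlog_mon_mul H hD hβ, Nat.cast_smul_eq_nsmul, h2,
        map_nsmul, retr_mon_mul, h2, retr_mon_mul, map_nsmul, LinearMap.map_smul, smul_comm]
    · rw [Derivation.map_smul, dlog_mon, h2, h2, mul_comm, retr_ofU_mul,
        H.retr_mon_of_not hD e hu, mul_zero, smul_zero, nsmul_zero, map_zero]

end Frame

end HyperRing


/-! ### The isotypic part of de Rham cohomology. -/

/-- For a one-dimensional χ the isotypic part is an eigenspace: copies of χ consist of eigenvectors,
and a nonzero eigenvector spans a copy. -/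
theorem mem_isotypicPart_iff {N : ℕ} {B : Type} [CommRing B] [Algebra (PolyRing N) B] [Algebra ℂ B]
    [IsScalarTower ℂ (PolyRing N) B] {G : Type} [Group G] (k : ℕ)
    (ψ : G →* (B ≃ₐ[PolyRing N] B)) (χ : Representation ℂ G ℂ) (c : G → ℂ)
    (hχ : ∀ s v, χ s v = c s • v) (z : HDR N B k) :
    z ∈ isotypicPart k ψ χ ↔ ∀ s, autAct k (ψ s) z = c s • z := by
  constructor
  · intro hz
    let E : Submodule ℂ (HDR N B k) := ⨅ s, LinearMap.eqLocus (autAct k (ψ s)) (c s • LinearMap.id)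
    have hE : ∀ z, z ∈ E ↔ ∀ s, autAct k (ψ s) z = c s • z := fun z => by
      simp only [E, Submodule.mem_iInf, LinearMap.mem_eqLocus, LinearMap.smul_apply,
        LinearMap.id_apply]
    have h : isotypicPart k ψ χ ≤ E := sSup_le fun W ⟨f, hf⟩ w hw => (hE w).2 fun s => by
      have h1 := hf s (f.symm ⟨w, hw⟩)
      rw [hχ, map_smul, f.apply_symm_apply] at h1
      exact h1.symm
    exact (hE z).1 (h hz)
  · intro h
    by_cases hz : z = 0
    · rw [hz]; exact zero_mem _
    · have hW : Submodule.span ℂ {z} ≤ isotypicPart k ψ χ :=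
        le_sSup ⟨LinearEquiv.toSpanNonzeroSingleton ℂ _ z hz, fun s v => by
          rw [LinearEquiv.toSpanNonzeroSingleton_apply, LinearEquiv.toSpanNonzeroSingleton_apply,
            hχ, smul_eq_mul]
          change (c s * v) • z = autAct k (ψ s) (v • z)
          rw [map_smul, h, smul_smul, mul_comm]⟩
      exact hW (Submodule.mem_span_singleton_self z)

namespace HyperRing

variable {N m : ℕ} {g : Laurent N m} {D : ℕ} {B : Type} [CommRing B] [Algebra (PolyRing N) B]
  (H : HyperRing g D B)

/-- Multiplication by `x^e` after `x_i ↦ x_i^D`. -/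
noncomputable def incl (e : Fin (m + 1) → ℤ) : OU g →ₗ[PolyRing N] B :=
  (LinearMap.mulLeft (PolyRing N) (H.mon e)).comp H.ofU.toLinearMap

theorem incl_apply (e : Fin (m + 1) → ℤ) (b : OU g) : H.incl e b = H.mon e * H.ofU b := rfl

variable [Algebra ℂ B]

theorem apply_ofU (ψ : (Fin (m + 1) → rootsOfUnity D ℂ) →* (B ≃ₐ[PolyRing N] B)) (hψ : ∀ s u, ψ s (H.mon u) =
    ((∏ i, (s i : ℂˣ) ^ u i : ℂˣ) : ℂ) • H.mon u) (s : Fin (m + 1) → rootsOfUnity D ℂ) (b : OU g) :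
    ψ s (H.ofU b) = H.ofU b := by
  have h : ((ψ s : B →+* B).comp (H.ofU : OU g →+* B)) = (H.ofU : OU g →+* B) := by
    refine IsLocalization.ringHom_ext (Submonoid.powers g) (RingHom.ext fun p => ?_)
    change ψ s (H.ofU (algebraMap (Laurent N m) (OU g) p)) =
      H.ofU (algebraMap (Laurent N m) (OU g) p)
    induction p using AddMonoidAlgebra.induction_linear with
    | zero => simp
    | add p q hp hq => simp only [map_add, hp, hq]
    | single u p =>
      rw [OU.algebraMap_single, map_smul, map_smul, ofU_mon, hψ, expHom_eq_smul,
        prod_zpow_rootsOfUnity, Units.val_one, one_smul]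
  exact RingHom.congr_fun h b

variable [IsScalarTower ℂ (PolyRing N) B] (hD : 0 < D)

variable {e : Fin (m + 1) → ℤ} {β : Fin (m + 1) → ℂ}

/-- `incl` and its left inverse `retr` both carry images of derivations to images of derivations,
twisted on U and untwisted on X. Hence `incl` is injective on cohomology. -/
theorem incl_mem_imageSum_iff (hβ : ∀ i, (D : ℂ) * β i = e i) (b : OU g) :
    H.incl e b ∈ (H.frame hD).imageSum 0 ↔ b ∈ (OU.frame g).imageSum (OU.etaCoeff g β) := by
  have hD' : (D : ℂ) ≠ 0 := Nat.cast_ne_zero.2 hD.ne'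
  have h0 : ∀ i z, (H.frame hD).op 0 i z = H.dlog hD i z := fun i z =>
    ((H.frame hD).op_apply 0 i z).trans (by rw [Pi.zero_apply, zero_mul, add_zero]; rfl)
  constructor
  · intro hb
    have h : (H.frame hD).imageSum 0 ≤
        ((OU.frame g).imageSum (OU.etaCoeff g β)).comap (H.retr hD e) := by
      refine iSup_le fun i => ?_
      rintro _ ⟨z, rfl⟩
      rw [Submodule.mem_comap, h0, H.retr_dlog hD hβ]
      exact (OU.frame g).op_mem _ i _
    have h1 := h hb
    rwa [Submodule.mem_comap, incl_apply, retr_mon_mul] at h1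
  · intro hb
    have h : (OU.frame g).imageSum (OU.etaCoeff g β) ≤
        ((H.frame hD).imageSum 0).comap (H.incl e) := by
      refine iSup_le fun i => ?_
      rintro _ ⟨z, rfl⟩
      have h1 := H.dlog_mon_mul hD hβ i z
      have h2 : H.incl e ((OU.frame g).op (OU.etaCoeff g β) i z) =
          (D : ℂ)⁻¹ • (H.frame hD).op 0 i (H.incl e z) := by
        rw [h0, incl_apply, incl_apply, h1, smul_smul, inv_mul_cancel₀ hD', one_smul]
      rw [Submodule.mem_comap, h2]
      exact Submodule.smul_of_tower_mem _ _ ((H.frame hD).op_mem 0 i _)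
    exact h hb

theorem zero_eq_sum_τ : (0 : Ω[B⁄PolyRing N]) =
    ∑ i, (0 : Fin m → B) i • (H.frame hD).τ i := by simp

/-- The class in the top cohomology of a function, as the coefficient of a form. -/
noncomputable def cls : B →ₗ[PolyRing N] HDR N B m :=
  ((H.frame hD).topEquiv (H.zero_eq_sum_τ hD)).toLinearMap.comp
    (Submodule.mkQ ((H.frame hD).imageSum 0))

theorem cls_surjective : Function.Surjective (H.cls hD) :=
  ((H.frame hD).topEquiv (H.zero_eq_sum_τ hD)).surjective.comp
    (Submodule.Quotient.mk_surjective _)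

theorem cls_eq_zero_iff (b : B) : H.cls hD b = 0 ↔ b ∈ (H.frame hD).imageSum 0 := by
  rw [← Submodule.Quotient.mk_eq_zero ((H.frame hD).imageSum 0)]
  exact LinearEquiv.map_eq_zero_iff ((H.frame hD).topEquiv (H.zero_eq_sum_τ hD))

/-- The chosen lift of ∂_j kills x_1, …, x_m, so it differentiates only the coefficient of the
volume form. -/
theorem gaussManin_cls (j : Fin N) (b : B) :
    gaussManin m j (H.der hD j) (H.der_isLift hD j) (H.cls hD b) =
      H.cls hD (H.der hD j b) := by
  refine (H.frame hD).cohMap_topEquiv (H.zero_eq_sum_τ hD) _ _ _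
    ((H.frame hD).lie_smul_vol _ _ (fun i => ?_) b)
  change H.der hD j (H.mon (Pi.single i.castSucc 1)) = 0
  rw [der_mon]
  simp [(Fin.castSucc_lt_last i).ne']

variable (ψ : (Fin (m + 1) → rootsOfUnity D ℂ) →* (B ≃ₐ[PolyRing N] B))

theorem autAct_cls (hψ : ∀ s u, ψ s (H.mon u) =
    ((∏ i, (s i : ℂˣ) ^ u i : ℂˣ) : ℂ) • H.mon u) (s : Fin (m + 1) → rootsOfUnity D ℂ) (b : B) :
    autAct m (ψ s) (H.cls hD b) = H.cls hD (ψ s b) := by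
  refine (H.frame hD).cohMap_topEquiv (H.zero_eq_sum_τ hD) _ _ _
    ((H.frame hD).pull_smul_vol (ψ s) (fun i => algebraMap ℂ (PolyRing N)
      ((∏ k, (s k : ℂˣ) ^ (Pi.single i.castSucc 1 : Fin (m + 1) → ℤ) k : ℂˣ) : ℂ)) (fun i => ?_) b)
  rw [algebraMap_smul]
  exact hψ s _

/-- By orthogonality of characters, averaging against the inverse character keeps exactly the
monomials with exponent congruent to e modulo D, as does `incl` after `retr`. -/
theorem sum_apply [Fintype (Fin (m + 1) → rootsOfUnity D ℂ)] (hψ : ∀ s u, ψ s (H.mon u) =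
    ((∏ i, (s i : ℂˣ) ^ u i : ℂˣ) : ℂ) • H.mon u) (b : B) :
    ∑ s, ((∏ i, (s i : ℂˣ) ^ e i : ℂˣ) : ℂ)⁻¹ • ψ s b =
      (Fintype.card (Fin (m + 1) → rootsOfUnity D ℂ) : ℂ) • H.incl e (H.retr hD e b) := by
  induction b using H.induction with
  | h0 => simp
  | hadd x y hx hy => simp only [map_add, smul_add, Finset.sum_add_distrib, hx, hy]
  | hmon p u =>
    have h1 : ∀ s : Fin (m + 1) → rootsOfUnity D ℂ,
        ((∏ i, (s i : ℂˣ) ^ e i : ℂˣ) : ℂ)⁻¹ • ψ s (p • H.mon u) =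
        ((∏ i, (s i : ℂˣ) ^ (u - e) i : ℂˣ) : ℂ) • p • H.mon u := fun s => by
      have h2 : (∏ i, (s i : ℂˣ) ^ (u - e) i) =
          (∏ i, (s i : ℂˣ) ^ e i)⁻¹ * ∏ i, (s i : ℂˣ) ^ u i := by
        rw [← Finset.prod_inv_distrib, ← Finset.prod_mul_distrib]
        exact Finset.prod_congr rfl fun i _ => by
          rw [Pi.sub_apply, zpow_sub, mul_comm]
      rw [map_smul, hψ, h2, smul_comm p, smul_smul, Units.val_mul, Units.val_inv_eq_inv_val]
    rw [Finset.sum_congr rfl fun s _ => h1 s, ← Finset.sum_smul]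
    by_cases hu : ∃ v : Fin (m + 1) → ℤ, u = e + (D : ℤ) • v
    · obtain ⟨v, rfl⟩ := hu
      simp only [add_sub_cancel_left, prod_zpow_rootsOfUnity, Units.val_one, Finset.sum_const,
        nsmul_eq_mul, mul_one, Finset.card_univ]
      rw [map_smul, map_smul, mon_add_smul, retr_mon_mul, incl_apply]
    · rw [sum_rootsOfUnity_prod_zpow hD.ne', zero_smul, map_smul, H.retr_mon_of_not hD e hu,
        smul_zero, map_zero, smul_zero]
      intro h
      choose v hv using h
      refine hu ⟨v, funext fun i => ?_⟩
      rw [Pi.add_apply, Pi.smul_apply, smul_eq_mul, ← hv, Pi.sub_apply]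
      ring

theorem cls_smul_complex (c : ℂ) (b : B) : H.cls hD (c • b) = c • H.cls hD b := by
  rw [← algebraMap_smul (PolyRing N), map_smul, algebraMap_smul]

theorem cls_sum {ι : Type} (s : Finset ι) (f : ι → B) :
    H.cls hD (∑ i ∈ s, f i) = ∑ i ∈ s, H.cls hD (f i) :=
  map_sum (H.cls hD) f s

/-- Averaging multiplies an eigenclass by the group order, which is invertible, and replaces a
representing function by one of the form x^e b. So no eigenclass is missed by passing to cohomology.
-/
theorem eigen_iff (hψ : ∀ s u, ψ s (H.mon u) =
    ((∏ i, (s i : ℂˣ) ^ u i : ℂˣ) : ℂ) • H.mon u) (z : HDR N B m) :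
    (∀ s, autAct m (ψ s) z = ((∏ i, (s i : ℂˣ) ^ e i : ℂˣ) : ℂ) • z) ↔
      ∃ b, H.cls hD (H.incl e b) = z := by
  constructor
  · intro hz
    have : NeZero D := ⟨hD.ne'⟩
    let _ := Fintype.ofFinite (Fin (m + 1) → rootsOfUnity D ℂ)
    have hc : (Fintype.card (Fin (m + 1) → rootsOfUnity D ℂ) : ℂ) ≠ 0 :=
      Nat.cast_ne_zero.2 Fintype.card_ne_zero
    refine (H.cls_surjective hD z).elim fun b hb => ⟨H.retr hD e b, ?_⟩
    have h1 := congrArg (H.cls hD) (H.sum_apply hD (e := e) ψ hψ b)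
    have h2 : ∀ s, H.cls hD (((∏ i, (s i : ℂˣ) ^ e i : ℂˣ) : ℂ)⁻¹ • ψ s b) = z := fun s => by
      rw [cls_smul_complex, ← H.autAct_cls hD ψ hψ, hb, hz, smul_smul,
        inv_mul_cancel₀ (Units.ne_zero _), one_smul]
    rw [cls_sum, Finset.sum_congr rfl fun s _ => h2 s, Finset.sum_const, Finset.card_univ,
      cls_smul_complex, ← Nat.cast_smul_eq_nsmul ℂ] at h1
    exact (smul_right_injective _ hc h1).symm
  · rintro ⟨b, rfl⟩ s
    rw [H.autAct_cls hD ψ hψ, incl_apply, map_mul, H.apply_ofU ψ hψ, hψ, smul_mul_assoc,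
      cls_smul_complex]

/-- The map from the twisted cohomology of `U`. -/
theorem exists_linearMap (hβ : ∀ i, (D : ℂ) * β i = e i) :
    ∃ J : (OU g ⧸ (OU.frame g).imageSum (OU.etaCoeff g β)) →ₗ[PolyRing N] HDR N B m,
      Function.Injective J ∧ ∀ b, J (Submodule.Quotient.mk b) = H.cls hD (H.incl e b) := by
  let J := ((H.frame hD).topEquiv (H.zero_eq_sum_τ hD)).toLinearMap.comp
    (Submodule.mapQ ((OU.frame g).imageSum (OU.etaCoeff g β)) ((H.frame hD).imageSum 0) (H.incl e)
      fun b hb => (H.incl_mem_imageSum_iff hD hβ b).2 hb)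
  have hJ : ∀ b, J (Submodule.Quotient.mk b) = H.cls hD (H.incl e b) := fun _ => rfl
  refine ⟨J, (injective_iff_map_eq_zero J).2 fun y => ?_, hJ⟩
  refine (Submodule.Quotient.mk_surjective _ y).elim fun b hb => ?_
  rw [← hb, hJ, cls_eq_zero_iff, H.incl_mem_imageSum_iff hD hβ, Submodule.Quotient.mk_eq_zero]
  exact id

end HyperRing

/-- An abstract form of the comparison of two modules with operators. -/
theorem exists_equiv_range {K R M P Q ι : Type*} [CommRing K] [CommRing R] [Algebra K R]
    [AddCommGroup M] [AddCommGroup P] [AddCommGroup Q] [Module K M] [Module K P] [Module R P]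
    [IsScalarTower K R P] [Module K Q] [Module R Q] [IsScalarTower K R Q] (e : M ≃ₗ[K] P)
    (J : P →ₗ[R] Q) (hJ : Function.Injective J) (W : Submodule K Q) (hW : ∀ z, z ∈ W ↔ ∃ y, J y = z)
    (l p : ι → M → M) (r : ι → R) (op : ι → Q → Q)
    (h : ∀ j u, e (l j u) = r j • e u ∧ J (e (p j u)) = op j (J (e u))) :
    ∃ e' : M ≃ₗ[K] W, ∀ j u, (e' (l j u) : Q) = r j • (e' u : Q) ∧
      (e' (p j u) : Q) = op j (e' u) := by
  let f : P →ₗ[K] W := (J.restrictScalars K).codRestrict W fun y => (hW _).2 ⟨y, rfl⟩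
  have hf : Function.Bijective f :=
    ⟨fun x y h => hJ (congrArg Subtype.val h), fun z => by
      obtain ⟨y, hy⟩ := (hW z).1 z.2
      exact ⟨y, Subtype.ext hy⟩⟩
  exact ⟨e.trans (LinearEquiv.ofBijective f hf), fun j u =>
    ⟨(congrArg J (h j u).1).trans (map_smul J _ _), (h j u).2⟩⟩

theorem HyperRing.isIsotypicPart {N m : ℕ} {g : Laurent N m} {D : ℕ} {B : Type} [CommRing B]
    [Algebra (PolyRing N) B] [Algebra ℂ B] [IsScalarTower ℂ (PolyRing N) B]
    (H : HyperRing g D B) (hD : 0 < D) {e : Fin (m + 1) → ℤ} {β : Fin (m + 1) → ℂ}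
    (hβ : ∀ i, (D : ℂ) * β i = e i) (ψ : (Fin (m + 1) → rootsOfUnity D ℂ) →* (B ≃ₐ[PolyRing N] B))
    (hψ : ∀ s u, ψ s (H.mon u) = ((∏ i, (s i : ℂˣ) ^ u i : ℂˣ) : ℂ) • H.mon u)
    {M : Type} [AddCommGroup M] [Module ℂ M] [Module (Weyl N) M]
    (E : M ≃ₗ[ℂ] OU g ⧸ (OU.frame g).imageSum (OU.etaCoeff g β))
    (hE : ∀ j u, E (Weyl.lam j • u) = (MvPolynomial.X j : PolyRing N) • E u ∧
      ∃ b, E u = Submodule.Quotient.mk b ∧ E (Weyl.par j • u) =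
        Submodule.Quotient.mk (OU.der g j b + OU.shift g β j * b)) :
    IsIsotypicPart (N := N) (B := B) M m ψ (muChar (m + 1) D e) := by
  refine (H.exists_linearMap hD hβ).elim fun J hJ => ?_
  refine ⟨H.der hD, H.der_isLift hD, exists_equiv_range E J hJ.1 _ (fun z => ?_)
    (fun j u => Weyl.lam j • u) (fun j u => Weyl.par j • u) (fun j => MvPolynomial.X j)
    (fun j => gaussManin m j (H.der hD j) (H.der_isLift hD j)) fun j u => ⟨(hE j u).1, ?_⟩⟩
  · refine (mem_isotypicPart_iff m ψ _ _ (fun s v => rfl) z).trans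
      ((H.eigen_iff hD ψ hψ z).trans ⟨fun ⟨b, hb⟩ => ⟨_, (hJ.2 b).trans hb⟩, fun ⟨y, hy⟩ => ?_⟩)
    exact (Submodule.Quotient.mk_surjective _ y).elim fun b hb =>
      ⟨b, (hJ.2 b).symm.trans ((congrArg J hb).trans hy)⟩
  · obtain ⟨b, hb, h2⟩ := (hE j u).2
    rw [h2, hb, hJ.2, hJ.2, H.gaussManin_cls, HyperRing.incl_apply, HyperRing.incl_apply,
      H.der_mon_mul hD hβ]


/-! ### Smoothness of the hypersurface. -/

theorem multiplicative_eq_prod {C : Type} [CommRing C] {n : ℕ} (μ : (Fin n → ℤ) → C) (h0 : μ 0 = 1)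
    (hadd : ∀ u v, μ (u + v) = μ u * μ v) (U : Fin n → Cˣ) (hU : ∀ i, (U i : C) = μ (Pi.single i 1))
    (u : Fin n → ℤ) : μ u = ((∏ i, U i ^ u i : Cˣ) : C) := by
  have hneg : ∀ u, μ u * μ (-u) = 1 := fun u => by rw [← hadd, add_neg_cancel, h0]
  let L : (Fin n → ℤ) →+ Additive Cˣ :=
    { toFun := fun u => Additive.ofMul ⟨μ u, μ (-u), hneg u, by rw [mul_comm, hneg]⟩
      map_zero' := congrArg Additive.ofMul (Units.ext h0)
      map_add' := fun u v => congrArg Additive.ofMul (Units.ext (hadd u v)) }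
  have hu : u = ∑ i, u i • (Pi.single i 1 : Fin n → ℤ) := by
    funext k
    simp [Finset.sum_apply, Pi.single_apply]
  have hs : L u = ∑ i, u i • L (Pi.single i 1) := by
    conv_lhs => rw [hu]
    simp only [map_sum, map_zsmul]
  have hL : ∀ i, L (Pi.single i 1) = Additive.ofMul (U i) := fun i =>
    congrArg Additive.ofMul (Units.ext (hU i).symm)
  have h1 := congrArg (fun x => ((Additive.toMul x : Cˣ) : C)) hs
  simp only [hL, ← ofMul_zpow, ← ofMul_prod, toMul_ofMul] at h1
  exact h1

namespace Laurent

variable {N n m : ℕ} {C : Type} [CommRing C] [Algebra (PolyRing N) C]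

/-- The homomorphism `x_i ↦ w_i`, for units `w_i`. -/
noncomputable def ofUnits (w : Fin n → Cˣ) : Laurent N n →ₐ[PolyRing N] C :=
  AddMonoidAlgebra.lift (PolyRing N) C (Fin n → ℤ)
    { toFun := fun u => ((∏ i, w i ^ u.toAdd i : Cˣ) : C)
      map_one' := by simp
      map_mul' := fun u v => by simp [zpow_add, Finset.prod_mul_distrib] }

theorem ofUnits_single (w : Fin n → Cˣ) (u : Fin n → ℤ) (p : PolyRing N) :
    ofUnits w (AddMonoidAlgebra.single u p) = p • ((∏ i, w i ^ u i : Cˣ) : C) := by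
  simp [ofUnits]

theorem eq_ofUnits (f : Laurent N n →ₐ[PolyRing N] C) (w : Fin n → Cˣ)
    (hw : ∀ i, (w i : C) = f (mon (Pi.single i 1))) : f = ofUnits w := by
  refine AlgHom.ext fun p => ?_
  induction p using AddMonoidAlgebra.induction_linear with
  | zero => simp
  | add p q hp hq => rw [map_add, hp, hq, map_add]
  | single u p =>
    have h := multiplicative_eq_prod (fun u => f (mon u)) (map_one f) (fun u v => by
      rw [← map_mul, AddMonoidAlgebra.single_mul_single, one_mul]) w hw u
    have h1 : AddMonoidAlgebra.single u p = p • (mon u : Laurent N n) := by simp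
    rw [ofUnits_single, ← h, h1, map_smul]

theorem ofUnits_update_subst (w : Fin (m + 1) → Cˣ) (v : Cˣ) (D : ℕ) (p : Laurent N m) :
    ofUnits (Function.update w (Fin.last m) v) (subst D p) = ofUnits w (subst D p) := by
  induction p using AddMonoidAlgebra.induction_linear with
  | zero => simp
  | add p q hp hq => simp only [map_add, hp, hq]
  | single u p =>
    rw [subst_single, ofUnits_single, ofUnits_single, Fin.prod_univ_castSucc,
      Fin.prod_univ_castSucc]
    simp [expHom, (Fin.castSucc_lt_last _).ne]

theorem ofUnits_hyperPoly (w : Fin (m + 1) → Cˣ) (g : Laurent N m) (D : ℕ) :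
    ofUnits w (hyperPoly g D) = (w (Fin.last m) : C) ^ D * ofUnits w (subst D g) := by
  rw [hyperPoly, map_mul, mon, ofUnits_single, Fin.prod_univ_castSucc]
  simp [(Fin.castSucc_lt_last _).ne]

end Laurent

theorem exists_unit_lift {C : Type} [CommRing C] {I : Ideal C} (hI : I ^ 2 = ⊥) (x y : C ⧸ I)
    (hxy : x * y = 1) : ∃ w : Cˣ, Ideal.Quotient.mk I (w : C) = x := by
  obtain ⟨c, rfl⟩ := Ideal.Quotient.mk_surjective x
  obtain ⟨d, rfl⟩ := Ideal.Quotient.mk_surjective y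
  have h : c * d - 1 ∈ I := by
    rw [← Ideal.Quotient.eq, map_mul, hxy, map_one]
  have h2 : (c * d - 1) * (c * d - 1) = 0 := by
    have := Ideal.mul_mem_mul h h
    rwa [← sq, hI] at this
  -- One Newton step: c d (2 - c d) = 1 - (c d - 1)^2, and the square vanishes.
  exact ⟨⟨c, d * (2 - c * d), by linear_combination -h2, by linear_combination -h2⟩, rfl⟩

/-- Infinitesimal lifting: lift the coordinates to units, so that the equation holds up to some ε in
I, and correct the lift of x_n alone. Since x_n enters as x_n^D and D is invertible, a rescaling
removes ε. -/
theorem OX.formallySmooth {N m : ℕ} (g : Laurent N m) {D : ℕ} (hD : 0 < D) :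
    Algebra.FormallySmooth (PolyRing N) (OX g D) := by
  refine .of_comp_surjective fun C _ _ I hI φ => ?_
  have hsq : ∀ x ∈ I, ∀ y ∈ I, x * y = 0 := fun x hx y hy => by
    have := Ideal.mul_mem_mul hx hy
    rwa [← sq, hI] at this
  let f : Laurent N (m + 1) →ₐ[PolyRing N] C ⧸ I := φ.comp (Ideal.Quotient.mkₐ _ _)
  have hf : f (hyperPoly g D) = 1 := by
    have : Ideal.Quotient.mk (Ideal.span {hyperPoly g D - 1}) (hyperPoly g D) = 1 := by
      rw [← map_one (Ideal.Quotient.mk _), Ideal.Quotient.eq]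
      exact Ideal.mem_span_singleton_self _
    exact (congrArg φ this).trans (map_one φ)
  have hu : ∀ i, ∃ w : Cˣ, Ideal.Quotient.mk I (w : C) = f (Laurent.mon (Pi.single i 1)) :=
    fun i => exists_unit_lift hI _ (f (Laurent.mon (-Pi.single i 1))) (by
      rw [← map_mul, AddMonoidAlgebra.single_mul_single, add_neg_cancel, one_mul]
      exact map_one f)
  choose w hw using hu
  have hmk : ∀ w' : Fin (m + 1) → Cˣ,
      (∀ i, Ideal.Quotient.mk I (w' i : C) = f (Laurent.mon (Pi.single i 1))) →
      (Ideal.Quotient.mkₐ (PolyRing N) I).comp (Laurent.ofUnits w') = f := fun w' hw' => by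
    let W : Fin (m + 1) → (C ⧸ I)ˣ := fun i => Units.map (Ideal.Quotient.mk I : C →* C ⧸ I) (w' i)
    rw [Laurent.eq_ofUnits f W hw']
    refine Laurent.eq_ofUnits _ W fun i => ?_
    rw [AlgHom.comp_apply, Laurent.mon, Laurent.ofUnits_single, Finset.prod_eq_single i]
    · simp [W]
    · intro k _ hk; simp [hk]
    · simp
  have hε : Laurent.ofUnits w (hyperPoly g D) - 1 ∈ I := by
    rw [← Ideal.Quotient.eq, map_one, ← hf, ← hmk w hw]
    rfl
  obtain ⟨ε, hε'⟩ : ∃ ε, Laurent.ofUnits w (hyperPoly g D) = 1 + ε := ⟨_, (add_sub_cancel _ _).symm⟩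
  rw [hε', add_sub_cancel_left] at hε
  let r : C := algebraMap (PolyRing N) C (algebraMap ℂ (PolyRing N) (D : ℂ)⁻¹)
  have hr : (D : C) * r = 1 := by
    have : (D : C) = algebraMap (PolyRing N) C (algebraMap ℂ (PolyRing N) D) := by simp
    rw [this, ← map_mul, ← map_mul, mul_inv_cancel₀ (Nat.cast_ne_zero.2 hD.ne'), map_one, map_one]
  have hη : -(r * ε) ∈ I := neg_mem (I.mul_mem_left _ hε)
  have hη2 := hsq _ hη _ hη
  -- With r = 1/D, the D-th power of 1 - ε/D is 1 - ε because I has square zero; it cancels the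
  -- factor 1 + ε.
  let v : Cˣ := ⟨1 + -(r * ε), 1 - -(r * ε), by linear_combination -hη2,
    by linear_combination -hη2⟩
  have hv : ∀ k : ℕ, (v : C) ^ k = 1 + k * -(r * ε) := fun k => by
    induction k with
    | zero => simp
    | succ k ih =>
      rw [pow_succ, ih, Nat.cast_succ]
      linear_combination (k : C) * hη2
  let w' := Function.update w (Fin.last m) (w (Fin.last m) * v)
  have hw' : ∀ i, Ideal.Quotient.mk I (w' i : C) = f (Laurent.mon (Pi.single i 1)) := fun i => by
    by_cases hi : i = Fin.last m
    · subst hi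
      have h1 : Ideal.Quotient.mk I (v : C) = 1 := by
        rw [← map_one (Ideal.Quotient.mk I), Ideal.Quotient.eq]
        change 1 + -(r * ε) - 1 ∈ I
        rwa [add_sub_cancel_left]
      simp only [w', Function.update_self, Units.val_mul, map_mul, h1, mul_one, hw]
    · simp only [w', Function.update_of_ne hi, hw]
  have hF : Laurent.ofUnits w' (hyperPoly g D - 1) = 0 := by
    have h1 := Laurent.ofUnits_hyperPoly w g D
    rw [map_sub, map_one, Laurent.ofUnits_hyperPoly, Laurent.ofUnits_update_subst]
    simp only [w', Function.update_self, Units.val_mul, mul_pow, hv]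
    rw [hε'] at h1
    linear_combination -(1 + (D : C) * -(r * ε)) * h1 - ε * (1 + ε) * hr - hsq _ hε _ hε
  refine ⟨Ideal.Quotient.liftₐ _ (Laurent.ofUnits w') fun x hx => ?_, AlgHom.ext fun x => ?_⟩
  · obtain ⟨y, rfl⟩ := Ideal.mem_span_singleton.1 hx
    rw [map_mul, hF, zero_mul]
  · obtain ⟨p, rfl⟩ := Ideal.Quotient.mk_surjective x
    exact DFunLike.congr_fun (hmk w' hw') p

theorem OX.smooth {N m : ℕ} (g : Laurent N m) {D : ℕ} (hD : 0 < D) :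
    Algebra.Smooth (PolyRing N) (OX g D) := by
  have h1 := OX.formallySmooth g hD
  have h2 : Algebra.FiniteType (PolyRing N) (OX g D) :=
    Algebra.FiniteType.of_surjective (Ideal.Quotient.mkₐ (PolyRing N) (Ideal.span {hyperPoly g D - 1}))
      (Ideal.Quotient.mkₐ_surjective _ _)
  have h3 : Algebra.FinitePresentation (PolyRing N) (OX g D) :=
    (Algebra.FinitePresentation.of_finiteType (R := PolyRing N) (A := OX g D)).1 h2
  exact {}

/-! ### The actual hypersurface, and the conclusion. -/

/-- The presentation of the ring of functions on the hypersurface. -/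
noncomputable def OX.hyperRing {N m : ℕ} (g : Laurent N m) (D : ℕ) : HyperRing g D (OX g D) where
  π := Ideal.Quotient.mkₐ _ _
  surjective := Ideal.Quotient.mkₐ_surjective _ _
  eq_zero_iff w := by
    rw [Ideal.Quotient.mkₐ_eq_mk, Ideal.Quotient.eq_zero_iff_mem, Ideal.mem_span_singleton]

theorem OX.muAct_mon {N m : ℕ} (g : Laurent N m) (D : ℕ) (s : Fin (m + 1) → rootsOfUnity D ℂ)
    (u : Fin (m + 1) → ℤ) : muAct g D s ((OX.hyperRing g D).mon u) =
      ((∏ i, (s i : ℂˣ) ^ u i : ℂˣ) : ℂ) • (OX.hyperRing g D).mon u := by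
  have h : scale N (fun i => (s i : ℂˣ)) (Laurent.mon u) =
      ((∏ i, (s i : ℂˣ) ^ u i : ℂˣ) : ℂ) • (Laurent.mon u : Laurent N (m + 1)) := by
    rw [scale_single, one_mul, AddMonoidAlgebra.smul_single, MvPolynomial.smul_eq_C_mul, mul_one]
  exact congrArg (Ideal.Quotient.mk _) h

/-- The twist is β = -α, so the exponent of the untwisting monomial, and with it the character, is
-k = -Dα. -/
theorem isIsotypicPart_gkz {N m : ℕ} {a : Fin N → Fin (m + 1) → ℤ}
    (ha : AddSubgroup.closure (Set.range a) = ⊤) {g : Laurent N m}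
    (hf : Laurent.generic a = Laurent.mon (Pi.single (Fin.last m) 1) * Laurent.subst 1 g)
    {α : Fin (m + 1) → ℂ} (hα : Nonresonant a α) {D : ℕ} {k : Fin (m + 1) → ℤ} (hD : 0 < D)
    (hk : ∀ i, (D : ℂ) * α i = k i) :
    IsIsotypicPart (N := N) (B := OX g D) (GKZ a α) m (muAct g D) (muChar (m + 1) D (-k)) :=
  (exists_gkz_equiv ha hf hα).elim fun E hE =>
    (OX.hyperRing g D).isIsotypicPart hD (fun i => by simp [← hk]) (muAct g D) (OX.muAct_mon g D)
      E hE


theorem isIrreducible_of_complex {G : Type} [Group G] (χ : Representation ℂ G ℂ) :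
    χ.IsIrreducible := by
  have h : ∀ W : Subrepresentation χ, W.toSubmodule = ⊥ ∨ W.toSubmodule = ⊤ :=
    fun W => eq_bot_or_eq_top _
  exact
    { exists_pair_ne := ⟨⊥, ⊤, fun h => by
        have h1 : (⊥ : Submodule ℂ ℂ) = ⊤ := congrArg Subrepresentation.toSubmodule h
        exact bot_ne_top h1⟩
      eq_bot_or_eq_top := fun W => (h W).imp
        (fun h => Subrepresentation.toSubmodule_injective h)
        (fun h => Subrepresentation.toSubmodule_injective h) }

theorem exists_common_denominator {n : ℕ} (α : Fin n → ℂ) (h : ∀ i, ∃ q : ℚ, α i = q) :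
    ∃ (D : ℕ) (k : Fin n → ℤ), 0 < D ∧ ∀ i, (D : ℂ) * α i = k i := by
  choose q hq using h
  have hd : ∀ i, ∃ c : ℕ, ∏ i, (q i).den = (q i).den * c := fun i =>
    Finset.dvd_prod_of_mem _ (Finset.mem_univ i)
  choose c hc using hd
  refine ⟨∏ i, (q i).den, fun i => c i * (q i).num, Finset.prod_pos fun i _ => (q i).den_pos,
    fun i => ?_⟩
  have h1 : ((q i).den : ℂ) * (q i : ℂ) = (q i).num := by
    exact_mod_cast congrArg (fun x : ℚ => (x : ℂ)) (Rat.den_mul_eq_num (q i))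
  rw [hc i, hq]
  push_cast
  linear_combination (c i : ℂ) * h1

theorem comesFromGeometry_gkz {N m : ℕ} {a : Fin N → Fin (m + 1) → ℤ}
    (ha : AddSubgroup.closure (Set.range a) = ⊤) {g : Laurent N m}
    (hf : Laurent.generic a = Laurent.mon (Pi.single (Fin.last m) 1) * Laurent.subst 1 g)
    {α : Fin (m + 1) → ℂ} (hα : Nonresonant a α) (hq : ∀ i, ∃ q : ℚ, α i = q) :
    ComesFromGeometry N (GKZ a α) := by
  obtain ⟨D, k, hD, hk⟩ := exists_common_denominator α hq
  have : NeZero D := ⟨hD.ne'⟩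
  exact ⟨OX g D, inferInstance, inferInstance, inferInstance, inferInstance,
    Fin (m + 1) → rootsOfUnity D ℂ, ℂ, inferInstance, inferInstance, inferInstance, muAct g D,
    muChar (m + 1) D (-k), m, OX.smooth g hD, inferInstance, isIrreducible_of_complex _,
    isIsotypicPart_gkz ha hf hα hD hk⟩

end AHyp

theorem corollary1p6 (m N : ℕ) (a : Fin N → Fin (m + 1) → ℤ)
    (ha : AddSubgroup.closure (Set.range a) = ⊤) (g : Laurent N m)
    (hf : Laurent.generic a = Laurent.mon (Pi.single (Fin.last m) 1) * Laurent.subst 1 g)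
    (α : Fin (m + 1) → ℂ) (hα : Nonresonant a α) :
    (∃ e : GKZ a α ≃ₗ[ℂ] OU.TwistedCohomology g (-α) m, ∀ j u,
      e (Weyl.lam j • u) = (MvPolynomial.X j : PolyRing N) • e u ∧
      e (Weyl.par j • u) = OU.op g (-α) m j (e u)) ∧
    ((∀ i, ∃ q : ℚ, α i = q) → ComesFromGeometry N (GKZ a α)) ∧
    ∀ (D : ℕ) (k : Fin (m + 1) → ℤ), 0 < D → (∀ i, (D : ℂ) * α i = k i) →
      Algebra.Smooth (PolyRing N) (OX g D) ∧
      IsIsotypicPart (N := N) (B := OX g D) (GKZ a α) m (muAct g D) (muChar (m + 1) D (-k)) :=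
  ⟨exists_gkz_equiv_twistedCohomology ha hf hα, comesFromGeometry_gkz ha hf hα,
    fun _ _ hD hk => ⟨OX.smooth g hD, isIsotypicPart_gkz ha hf hα hD hk⟩⟩
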